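/- All points lie in $\mathbb{R}^2$. Let $G$ be a digraph with $n\ge 3$ vertices that consists of two directed paths $P_L$ and $P_R$, both from a vertex $s$ to a vertex $t$, that share only $s$ and $t$ (such a $G$ is a planar $st$-graph whose underlying graph is a cycle). Let $S$ be a set of $n$ points in general position, that is, no three points of $S$ lie on a line; moreover, no two points of $S$ have the same $y$-coordinate. An *upward pointset embedding* (UPSE) of $G$ on $S$ is a bijection from the vertices of $G$ to $S$ such that, when every edge is drawn as the straight-line segment between the images of its end vertices, the tail of every edge is drawn strictly lower than its head, and two distinct edges meet at most in a common end vertex. In a UPSE, $P_L$ is *to the left of* $P_R$ if on every horizontal line that meets the drawings, the point of $P_L$ is not to the right of the point of $P_R$ (the two then coincide only at $s$ and $t$). Let $p_s$ and $p_t$ be the lowest and the highest point of $S$, and let $\mathrm{conv}_L(S)$ (respectively $\mathrm{conv}_R(S)$) be the set of the points of $S$ on the boundary of the convex hull of $S$ that are equal to $p_s$ or $p_t$ or lie strictly to the left (respectively right) of the line through $p_s$ and $p_t$. For a path $P$, let $|P|$ be its number of vertices. Then $G$ admits a UPSE on $S$ with $P_L$ to the left of $P_R$ if and only if $|P_L|\ge|\mathrm{conv}_L(S)|$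 and $|P_R|\ge|\mathrm{conv}_R(S)|$. Moreover, there is an algorithm for the real RAM (unit-cost operations on natural numbers and real numbers, arrays with indirect addressing, and no rounding of reals) that, given the list of the edges of such a $G$ in any order and the list of the points of such an $S$ in any order, decides in $O(n\log n)$ time whether $G$ admits a UPSE on $S$ (with either of the two paths to the left of the other). -/

import Mathlib

namespace UPSE

/-! ### Directed graphs made of two st-paths -/

section Graph

variable {V : Type*}

/-- `P` is a directed path of `G` from `s` to `t`, listed by its vertices. -/
structure IsSTPath (G : Digraph V) (s t : V) (P : List V) : Prop where
  head : P.head? = some s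
  last : P.getLast? = some t
  nodup : P.Nodup
  chain : P.IsChain G.Adj

/-- `G` consists of the two `st`-paths `PL` and `PR`, which share only `s` and `t`: every vertex and
every edge of `G` lies on one of them. Such a `G` is acyclic, has only the source `s` and only the
sink `t`, and is planar with `s` and `t` on the outer face. -/
structure ConsistsOfTwoSTPaths (G : Digraph V) (s t : V) (PL PR : List V) : Prop where
  left : IsSTPath G s t PL
  right : IsSTPath G s t PR
  internally_disjoint : ∀ v, v ∈ PL → v ∈ PR → v = s ∨ v = t
  vertices : ∀ v, v ∈ PL ∨ v ∈ PR
  edges : ∀ u v, G.Adj u v → [u, v] <:+: PL ∨ [u, v] <:+: PR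

end Graph

/-! ### Point sets in the plane `ℝ × ℝ` -/

/-- No two points of `S` have the same `y`-coordinate. -/
def DistinctHeights (S : Finset (ℝ × ℝ)) : Prop :=
  ∀ p ∈ S, ∀ q ∈ S, p.2 = q.2 → p = q

/-- No three points of `S` lie on a line. -/
def GeneralPosition (S : Finset (ℝ × ℝ)) : Prop :=
  ∀ p ∈ S, ∀ q ∈ S, ∀ r ∈ S, p ≠ q → p ≠ r → q ≠ r → ¬ Collinear ℝ ({p, q, r} : Set (ℝ × ℝ))

def IsSouthExtreme (S : Finset (ℝ × ℝ)) (p : ℝ × ℝ) : Prop :=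
  p ∈ S ∧ ∀ q ∈ S, p.2 ≤ q.2

def IsNorthExtreme (S : Finset (ℝ × ℝ)) (p : ℝ × ℝ) : Prop :=
  p ∈ S ∧ ∀ q ∈ S, q.2 ≤ p.2

/-- The cross product `(b - a) × (p - a)`: positive if `p` lies to the left of the line through `a`
and `b`, directed from `a` to `b`, and negative if `p` lies to the right of it. -/
def orient (a b p : ℝ × ℝ) : ℝ :=
  (b.1 - a.1) * (p.2 - a.2) - (b.2 - a.2) * (p.1 - a.1)

/-- The points of `S` on the left envelope: those on the boundary of the convex hull that are one of
the extremes or lie to the left of the line through the extremes. -/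
def convL (S : Finset (ℝ × ℝ)) : Set (ℝ × ℝ) :=
  {p | p ∈ S ∧ p ∈ frontier (convexHull ℝ (S : Set (ℝ × ℝ))) ∧
    ∃ a b, IsSouthExtreme S a ∧ IsNorthExtreme S b ∧ (p = a ∨ p = b ∨ 0 < orient a b p)}

/-- The points of `S` on the right envelope. -/
def convR (S : Finset (ℝ × ℝ)) : Set (ℝ × ℝ) :=
  {p | p ∈ S ∧ p ∈ frontier (convexHull ℝ (S : Set (ℝ × ℝ))) ∧
    ∃ a b, IsSouthExtreme S a ∧ IsNorthExtreme S b ∧ (p = a ∨ p = b ∨ orient a b p < 0)}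

/-! ### Upward pointset embeddings -/

section Drawing

variable {V : Type*}

/-- `φ` places the vertices of `G` on distinct points of `S` so that the straight-line drawing
is upward and planar (two distinct edges meet at most in a common end vertex). -/
structure IsUPSE (G : Digraph V) (S : Finset (ℝ × ℝ)) (φ : V → ℝ × ℝ) : Prop where
  injective : Function.Injective φ
  mem : ∀ v, φ v ∈ S
  upward : ∀ u v, G.Adj u v → (φ u).2 < (φ v).2
  planar : ∀ u v u' v', G.Adj u v → G.Adj u' v' → (u, v) ≠ (u', v') →
    ∀ x ∈ segment ℝ (φ u) (φ v), x ∈ segment ℝ (φ u') (φ v') →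
      ∃ w, (w = u ∨ w = v) ∧ (w = u' ∨ w = v') ∧ x = φ w

/-- The polyline that represents the path `P`. -/
def pathDrawing (φ : V → ℝ × ℝ) (P : List V) : Set (ℝ × ℝ) :=
  {x | ∃ u v, [u, v] <:+: P ∧ x ∈ segment ℝ (φ u) (φ v)}

/-- On every horizontal line, the drawing of `PL` is to the left of the drawing of `PR`. In a planar
drawing, equality occurs only at the common end vertices of the two paths. -/
def DrawnLeftOf (φ : V → ℝ × ℝ) (PL PR : List V) : Prop :=
  ∀ p ∈ pathDrawing φ PL, ∀ q ∈ pathDrawing φ PR, p.2 = q.2 → p.1 ≤ q.1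

end Drawing

/-! ### The real RAM

Programs are written with assignments, conditionals and loops over natural-number registers,
real registers, and arrays of both kinds with indirect addressing. The running time
counts every operation that is executed, each at unit cost. The only operations on reals are
`+`, `-`, `*`, integer constants and comparison; there is no rounding. -/

namespace RealRAM

structure State where
  /-- natural-number registers -/
  nreg : ℕ → ℕ
  /-- real registers -/
  rreg : ℕ → ℝ
  /-- `narr a i` is cell `i` of the natural-number array `a` -/
  narr : ℕ → ℕ → ℕ
  /-- `rarr a i` is cell `i` of the real array `a` -/
  rarr : ℕ → ℕ → ℝ

/-- Natural-number expressions; `sub` is truncated subtraction, `get a i` reads cell `i` of the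
array with the fixed name `a`. -/
inductive NExpr where
  | const (k : ℕ)
  | reg (i : ℕ)
  | get (a : ℕ) (i : NExpr)
  | add (e f : NExpr)
  | sub (e f : NExpr)

inductive RExpr where
  | const (k : ℤ)
  | reg (i : ℕ)
  | get (a : ℕ) (i : NExpr)
  | add (e f : RExpr)
  | sub (e f : RExpr)
  | mul (e f : RExpr)

inductive BExpr where
  | nlt (e f : NExpr)
  | neq (e f : NExpr)
  | rlt (e f : RExpr)
  | not (b : BExpr)
  | and (b c : BExpr)

def NExpr.eval (σ : State) : NExpr → ℕ
  | .const k => k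
  | .reg i => σ.nreg i
  | .get a i => σ.narr a (i.eval σ)
  | .add e f => e.eval σ + f.eval σ
  | .sub e f => e.eval σ - f.eval σ

noncomputable def RExpr.eval (σ : State) : RExpr → ℝ
  | .const k => (k : ℝ)
  | .reg i => σ.rreg i
  | .get a i => σ.rarr a (i.eval σ)
  | .add e f => e.eval σ + f.eval σ
  | .sub e f => e.eval σ - f.eval σ
  | .mul e f => e.eval σ * f.eval σ

/-- The condition holds in the state `σ`. -/
def BExpr.Holds (σ : State) : BExpr → Prop
  | .nlt e f => e.eval σ < f.eval σ
  | .neq e f => e.eval σ = f.eval σ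
  | .rlt e f => e.eval σ < f.eval σ
  | .not b => ¬ b.Holds σ
  | .and b c => b.Holds σ ∧ c.Holds σ

/-- The time to evaluate an expression: the number of its operations, constants, and accesses. -/
def NExpr.cost : NExpr → ℕ
  | .const _ => 1
  | .reg _ => 1
  | .get _ i => i.cost + 1
  | .add e f => e.cost + f.cost + 1
  | .sub e f => e.cost + f.cost + 1

def RExpr.cost : RExpr → ℕ
  | .const _ => 1
  | .reg _ => 1
  | .get _ i => i.cost + 1
  | .add e f => e.cost + f.cost + 1
  | .sub e f => e.cost + f.cost + 1
  | .mul e f => e.cost + f.cost + 1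

def BExpr.cost : BExpr → ℕ
  | .nlt e f => e.cost + f.cost + 1
  | .neq e f => e.cost + f.cost + 1
  | .rlt e f => e.cost + f.cost + 1
  | .not b => b.cost + 1
  | .and b c => b.cost + c.cost + 1

inductive Cmd where
  | skip
  | nset (i : ℕ) (e : NExpr)
  | rset (i : ℕ) (e : RExpr)
  | nput (a : ℕ) (i : NExpr) (e : NExpr)
  | rput (a : ℕ) (i : NExpr) (e : RExpr)
  | seq (c d : Cmd)
  | ite (b : BExpr) (c d : Cmd)
  | loop (b : BExpr) (c : Cmd)

def State.setN (σ : State) (i v : ℕ) : State :=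
  { σ with nreg := Function.update σ.nreg i v }

noncomputable def State.setR (σ : State) (i : ℕ) (v : ℝ) : State :=
  { σ with rreg := Function.update σ.rreg i v }

def State.putN (σ : State) (a i v : ℕ) : State :=
  { σ with narr := Function.update σ.narr a (Function.update (σ.narr a) i v) }

noncomputable def State.putR (σ : State) (a i : ℕ) (v : ℝ) : State :=
  { σ with rarr := Function.update σ.rarr a (Function.update (σ.rarr a) i v) }

/-- `Exec c σ T τ`: started in the state `σ`, the program `c` halts in the state `τ` after exactly `T`
unit-cost steps. `loop b c` repeats `c` while `b` holds. -/
inductive Exec : Cmd → State → ℕ → State → Prop where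
  | skip (σ) : Exec .skip σ 1 σ
  | nset (i e σ) : Exec (.nset i e) σ (e.cost + 1) (σ.setN i (e.eval σ))
  | rset (i e σ) : Exec (.rset i e) σ (e.cost + 1) (σ.setR i (e.eval σ))
  | nput (a i e σ) :
      Exec (.nput a i e) σ (i.cost + e.cost + 1) (σ.putN a (i.eval σ) (e.eval σ))
  | rput (a i e σ) :
      Exec (.rput a i e) σ (i.cost + e.cost + 1) (σ.putR a (i.eval σ) (e.eval σ))
  | seq {c d σ τ υ T U} : Exec c σ T τ → Exec d τ U υ → Exec (.seq c d) σ (T + U) υ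
  | ite_true {b c d σ τ T} : b.Holds σ → Exec c σ T τ →
      Exec (.ite b c d) σ (b.cost + T + 1) τ
  | ite_false {b c d σ τ T} : ¬ b.Holds σ → Exec d σ T τ →
      Exec (.ite b c d) σ (b.cost + T + 1) τ
  | loop_false {b c σ} : ¬ b.Holds σ → Exec (.loop b c) σ (b.cost + 1) σ
  | loop_true {b c σ τ υ T U} : b.Holds σ → Exec c σ T τ → Exec (.loop b c) τ U υ →
      Exec (.loop b c) σ (b.cost + T + 1 + U) υ

end RealRAM

/-- The initial state for a digraph on the vertices `0, …, n - 1`, given as a list of its edges, and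
a list of points. Register `0` holds `n` and register `1` the number of edges; the natural-number
arrays `0` and `1` hold the tails and the heads of the edges; the real arrays `0` and `1` hold the
`x`- and the `y`-coordinates of the points. Everything else is zero. -/
noncomputable def inputState {n : ℕ} (edges : List (Fin n × Fin n)) (points : List (ℝ × ℝ)) :
    RealRAM.State where
  nreg i := if i = 0 then n else if i = 1 then edges.length else 0
  rreg _ := 0
  narr a i :=
    if a = 0 then (edges.map fun e => (e.1 : ℕ)).getD i 0
    else if a = 1 then (edges.map fun e => (e.2 : ℕ)).getD i 0
    else 0
  rarr a i :=
    if a = 0 then (points.map Prod.fst).getD i 0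
    else if a = 1 then (points.map Prod.snd).getD i 0
    else 0

end UPSE

/-! Call a point of `S` right extreme if no segment that joins a lower to a higher point of `S`
passes strictly to its right; left extreme is the mirror image. For distinct heights and general
position these points are exactly the two envelopes (`mem_convR_iff`, `mem_convL_iff`): a right
extreme point has a supporting line, and a point with segments strictly on both sides is interior to
the hull.

Necessity. If a vertex off `PL` is drawn on a left extreme point, then some edge of `PL` crosses its
height; that edge lies strictly to its left, because the two drawings meet only at `s` and `t`. This
contradicts left extremity, so the left envelope injects into `PL`, and likewise the right one into
`PR`.

Sufficiency. An embedding amounts to a split of `S` (`IsSplit`) into a left and a right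
height-monotone chain that share only the two extremes, with the sizes of the paths. The left
envelope together with all remaining points is a split (`isSplit_leftExtreme`), whose right chain is
as large as possible. The core is `IsSplit.exists_move`: while the right chain is not the right
envelope, one of its points can pass to the left chain. A chain that contains the right envelope and
a further point has a concave vertex (`exists_concave_vertex`). Among the concave vertices in one
height gap of the left chain, take the one nearest to the edge that spans the gap. Were a point of
the right chain on the wrong side of one of the two new edges, the worst such point would be a
concave vertex nearer to that edge. Since the right chain loses one point at a time, every
admissible size is reached.

For the decision problem, the intermediate value theorem shows that in every embedding one path is
to the left of the other (`drawnLeftOf_or`). The answer thus depends only on two path lengths and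
two envelope sizes. The program finds one path length by following successors, and the other one
from the sum `n + 2`. It sorts the points by height with merge sort and obtains each envelope by a
stack scan, which is correct by `exists_concave_vertex` again. Only sorting exceeds linear time. -/

namespace UPSE

/-! ### Orientation and extreme points -/

/-- No point pair of `S` has `p` strictly to the left of its connecting segment. -/
def IsRightExtreme (S : Finset (ℝ × ℝ)) (p : ℝ × ℝ) : Prop :=
  p ∈ S ∧ ∀ q ∈ S, ∀ r ∈ S, q.2 < p.2 → p.2 < r.2 → orient q r p ≤ 0

/-- No point pair of `S` has `p` strictly to the right of its connecting segment. -/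
def IsLeftExtreme (S : Finset (ℝ × ℝ)) (p : ℝ × ℝ) : Prop :=
  p ∈ S ∧ ∀ q ∈ S, ∀ r ∈ S, q.2 < p.2 → p.2 < r.2 → 0 ≤ orient q r p

/-- `p` and `q` are consecutive, by height, among the points of `B`. -/
def Consec (B : Finset (ℝ × ℝ)) (p q : ℝ × ℝ) : Prop :=
  p ∈ B ∧ q ∈ B ∧ p.2 < q.2 ∧ ∀ r ∈ B, r.2 ≤ p.2 ∨ q.2 ≤ r.2

/-- A vanishing cross product makes the three points collinear. As `p` and `q` differ in height, the
height serves as parameter on their line. -/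
theorem orient_ne_zero {S : Finset (ℝ × ℝ)} (hD : DistinctHeights S) (hG : GeneralPosition S)
    {p q r : ℝ × ℝ} (hp : p ∈ S) (hq : q ∈ S) (hr : r ∈ S) (hpq : p ≠ q) (hpr : p ≠ r)
    (hqr : q ≠ r) : orient p q r ≠ 0 := by
  intro h
  have h2 : q.2 - p.2 ≠ 0 := fun h0 => hpq (hD p hp q hq (by linarith))
  refine hG p hp q hq r hr hpq hpr hqr ?_
  rw [collinear_iff_of_mem (p₀ := p) (by simp)]
  refine ⟨q - p, ?_⟩
  intro x hx
  simp only [Set.mem_insert_iff, Set.mem_singleton_iff] at hx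
  rcases hx with rfl | rfl | rfl
  · exact ⟨0, by simp⟩
  · exact ⟨1, by simp⟩
  · refine ⟨(x.2 - p.2) / (q.2 - p.2), ?_⟩
    unfold orient at h
    ext
    · simp only [vadd_eq_add, Prod.fst_add, Prod.smul_fst, Prod.fst_sub, smul_eq_mul]
      field_simp
      linarith
    · simp only [vadd_eq_add, Prod.snd_add, Prod.smul_snd, Prod.snd_sub, smul_eq_mul]
      field_simp
      ring

/-- Up to the factor `v.2 - u.2`, `orient p r q` is a combination, with positive height differences
as coefficients, of the drops of the affine function `orient u v` from `q` to `p` and to `r`. So a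
local maximum of that function along a chain is a turn. -/
theorem orient_nonneg_of_extreme {u v p q r : ℝ × ℝ} (huv : u.2 < v.2) (hpq : p.2 < q.2)
    (hqr : q.2 < r.2) (h1 : orient u v p ≤ orient u v q) (h2 : orient u v r ≤ orient u v q) :
    0 ≤ orient p r q := by
  have key : (v.2 - u.2) * orient p r q =
      (r.2 - q.2) * (orient u v q - orient u v p) * (-1) * (-1)
        + (q.2 - p.2) * (orient u v q - orient u v r) := by
    unfold orient; ring
  have : 0 ≤ (v.2 - u.2) * orient p r q := by
    rw [key]
    have := mul_nonneg (sub_nonneg.2 hqr.le) (sub_nonneg.2 h1)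
    have := mul_nonneg (sub_nonneg.2 hpq.le) (sub_nonneg.2 h2)
    linarith
  exact nonneg_of_mul_nonneg_right this (sub_pos.2 huv)

theorem exists_consec_above {B : Finset (ℝ × ℝ)} {p r : ℝ × ℝ} (hp : p ∈ B) (hr : r ∈ B)
    (h : p.2 < r.2) : ∃ q, Consec B p q ∧ q.2 ≤ r.2 := by
  obtain ⟨q, hq, hmin⟩ := Finset.exists_min_image (B.filter (fun x => p.2 < x.2)) Prod.snd
    ⟨r, by simp [hr, h]⟩
  simp only [Finset.mem_filter] at hq hmin
  refine ⟨q, ⟨hp, hq.1, hq.2, fun x hx => ?_⟩, hmin r ⟨hr, h⟩⟩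
  by_contra! hc
  exact absurd (hmin x ⟨hx, hc.1⟩) (not_le.2 hc.2)

theorem exists_consec_below {B : Finset (ℝ × ℝ)} {p r : ℝ × ℝ} (hp : p ∈ B) (hr : r ∈ B)
    (h : r.2 < p.2) : ∃ q, Consec B q p ∧ r.2 ≤ q.2 := by
  obtain ⟨q, hq, hmin⟩ := Finset.exists_max_image (B.filter (fun x => x.2 < p.2)) Prod.snd
    ⟨r, by simp [hr, h]⟩
  simp only [Finset.mem_filter] at hq hmin
  refine ⟨q, ⟨hq.1, hp, hq.2, fun x hx => ?_⟩, hmin r ⟨hr, h⟩⟩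
  by_contra! hc
  exact absurd (hmin x ⟨hx, hc.2⟩) (not_le.2 hc.1)

/-- Among the segments that cross the height of `b`, the one that passes farthest to the right of
`b` is an edge of the right hull. -/
theorem exists_supporting_edge {S : Finset (ℝ × ℝ)} (hD : DistinctHeights S) {b : ℝ × ℝ}
    (hb : b ∈ S) (h : ¬ IsRightExtreme S b) :
    ∃ q r, IsRightExtreme S q ∧ IsRightExtreme S r ∧ q.2 < b.2 ∧ b.2 < r.2 ∧ 0 < orient q r b ∧
      ∀ p ∈ S, 0 ≤ orient q r p := by
  unfold IsRightExtreme at h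
  push Not at h
  obtain ⟨q0, hq0, r0, hr0, hqb, hbr, hpos⟩ := h hb
  -- The quotient is the signed horizontal distance from `b` to the segment at the height of `b`.
  obtain ⟨⟨q, r⟩, hqr, hmax⟩ := Finset.exists_max_image
    ((S ×ˢ S).filter (fun x => x.1.2 < b.2 ∧ b.2 < x.2.2))
    (fun x => orient x.1 x.2 b / (x.2.2 - x.1.2)) ⟨(q0, r0), by simp [*]⟩
  replace hmax : ∀ u v, u ∈ S → v ∈ S → u.2 < b.2 → b.2 < v.2 →
      orient u v b / (v.2 - u.2) ≤ orient q r b / (r.2 - q.2) := fun u v hu hv h1 h2 =>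
    hmax (u, v) (by simp [*])
  simp only [Finset.mem_filter, Finset.mem_product] at hqr
  obtain ⟨⟨hq, hr⟩, h1, h2⟩ := hqr
  have hposq : 0 < orient q r b := by
    have h3 := hmax q0 r0 hq0 hr0 hqb hbr
    have h4 : 0 < orient q0 r0 b / (r0.2 - q0.2) := div_pos hpos (by linarith)
    have h5 := lt_of_lt_of_le h4 h3
    have h6 : 0 < r.2 - q.2 := by linarith
    exact (div_pos_iff_of_pos_right h6).1 h5
  -- If `p` were strictly to the right of the line, then replacing by `p` the end on the same side
  -- of the height of `b` would give a segment farther to the right.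
  have hall : ∀ p ∈ S, 0 ≤ orient q r p := by
    intro p hp
    by_contra! hneg
    rcases lt_trichotomy p.2 b.2 with hlt | heq | hgt
    · have h3 := hmax p r hp hr hlt h2
      rw [div_le_div_iff₀ (by linarith) (by linarith)] at h3
      have key : orient p r b * (r.2 - q.2) - orient q r b * (r.2 - p.2)
          = - (r.2 - b.2) * orient q r p := by unfold orient; ring
      have := mul_neg_of_pos_of_neg (sub_pos.2 h2) hneg
      linarith
    · rw [hD p hp b hb heq] at hneg
      linarith
    · have h3 := hmax q p hq hp h1 hgt
      rw [div_le_div_iff₀ (by linarith) (by linarith)] at h3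
      have key : orient q p b * (r.2 - q.2) - orient q r b * (p.2 - q.2)
          = - (b.2 - q.2) * orient q r p := by unfold orient; ring
      have := mul_neg_of_pos_of_neg (sub_pos.2 h1) hneg
      linarith
  have hqr : q.2 < r.2 := h1.trans h2
  refine ⟨q, r, ⟨hq, ?_⟩, ⟨hr, ?_⟩, h1, h2, hposq, hall⟩
  -- Since `u` and `v` are not to the right of the line through `q` and `r`, the segment `u v`
  -- cannot pass strictly to the right of `q`.
  · intro u hu v hv huq hqv
    have key : (r.2 - q.2) * orient u v q = - ((v.2 - q.2) * orient q r u)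
        - (q.2 - u.2) * orient q r v := by unfold orient; ring
    have := mul_nonneg (sub_nonneg.2 hqv.le) (hall u hu)
    have := mul_nonneg (sub_nonneg.2 huq.le) (hall v hv)
    by_contra! hc
    have := mul_pos (sub_pos.2 hqr) hc
    linarith
  · intro u hu v hv huq hqv
    have key : (r.2 - q.2) * orient u v r = - ((v.2 - r.2) * orient q r u)
        - (r.2 - u.2) * orient q r v := by unfold orient; ring
    have := mul_nonneg (sub_nonneg.2 hqv.le) (hall u hu)
    have := mul_nonneg (sub_nonneg.2 huq.le) (hall v hv)
    by_contra! hc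
    have := mul_pos (sub_pos.2 hqr) hc
    linarith

/-- A chain that contains all right extreme points and another point has a vertex at which it
turns away from the hull. -/
theorem exists_concave_vertex {S B : Finset (ℝ × ℝ)} (hD : DistinctHeights S)
    (hG : GeneralPosition S) (hBS : B ⊆ S) (hB : ∀ p, IsRightExtreme S p → p ∈ B) {b : ℝ × ℝ}
    (hb : b ∈ B) (h : ¬ IsRightExtreme S b) :
    ∃ p q r, Consec B p q ∧ Consec B q r ∧ 0 < orient p r q := by
  obtain ⟨u, v, hu, hv, hub, hbv, hpos, hall⟩ := exists_supporting_edge hD (hBS hb) h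
  -- The point of the chain farthest to the left of the hull edge `u v` is the required vertex.
  -- Because `u` and `v` belong to `B`, its neighbours stay between them in height and so do not
  -- exceed the maximum.
  obtain ⟨q, hq, hmax⟩ := Finset.exists_max_image
    (B.filter (fun x => u.2 ≤ x.2 ∧ x.2 ≤ v.2)) (orient u v) ⟨b, by simp [hb, hub.le, hbv.le]⟩
  simp only [Finset.mem_filter, and_imp] at hq hmax
  have hqpos : 0 < orient u v q := lt_of_lt_of_le hpos (hmax b hb hub.le hbv.le)
  have huq : u.2 < q.2 := by
    refine lt_of_le_of_ne hq.2.1 fun he => ?_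
    rw [← hD u hu.1 q (hBS hq.1) he] at hqpos
    simp [orient] at hqpos
  have hqv : q.2 < v.2 := by
    refine lt_of_le_of_ne hq.2.2 fun he => ?_
    rw [hD q (hBS hq.1) v hv.1 he] at hqpos
    simp [orient, mul_comm] at hqpos
  obtain ⟨p, hp, hup⟩ := exists_consec_below hq.1 (hB u hu) huq
  obtain ⟨r, hr, hrv⟩ := exists_consec_above hq.1 (hB v hv) hqv
  refine ⟨p, q, r, hp, hr, lt_of_le_of_ne ?_ (Ne.symm ?_)⟩
  · exact orient_nonneg_of_extreme (hub.trans hbv) hp.2.2.1 hr.2.2.1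
      (hmax p hp.1 hup (hp.2.2.1.trans hqv).le) (hmax r hr.2.1 (huq.trans hr.2.2.1).le hrv)
  · have h1 := hp.2.2.1
    have h2 := hr.2.2.1
    exact orient_ne_zero hD hG (hBS hp.1) (hBS hr.2.1) (hBS hq.1)
      (fun e => by rw [e] at h1; linarith) (fun e => by rw [e] at h1; linarith)
      (fun e => by rw [e] at h2; linarith)

/-! ### Reflection in the vertical axis -/

/-- Heights are kept and orientations change sign, so results on right extreme points carry over to
left extreme ones. -/
def mirror (p : ℝ × ℝ) : ℝ × ℝ := (-p.1, p.2)

@[simp] theorem mirror_snd (p : ℝ × ℝ) : (mirror p).2 = p.2 := rfl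

@[simp] theorem mirror_mirror (p : ℝ × ℝ) : mirror (mirror p) = p := by simp [mirror]

theorem mirror_injective : Function.Injective mirror :=
  Function.LeftInverse.injective mirror_mirror

@[simp] theorem orient_mirror (a b p : ℝ × ℝ) :
    orient (mirror a) (mirror b) (mirror p) = - orient a b p := by
  simp only [orient, mirror]; ring

theorem distinctHeights_mirror {S : Finset (ℝ × ℝ)} (h : DistinctHeights S) :
    DistinctHeights (S.image mirror) := by
  intro p hp q hq he
  simp only [Finset.mem_image] at hp hq
  obtain ⟨p, hp, rfl⟩ := hp
  obtain ⟨q, hq, rfl⟩ := hq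
  rw [h p hp q hq he]

theorem isRightExtreme_mirror {S : Finset (ℝ × ℝ)} {p : ℝ × ℝ} :
    IsRightExtreme (S.image mirror) (mirror p) ↔ IsLeftExtreme S p := by
  simp only [IsRightExtreme, IsLeftExtreme, orient_mirror, mirror_snd, Finset.mem_image,
    mirror_injective.eq_iff, exists_eq_right, Left.neg_nonpos_iff,
    forall_exists_index, and_imp, forall_apply_eq_imp_iff₂]

theorem exists_supporting_edge_left {S : Finset (ℝ × ℝ)} (hD : DistinctHeights S) {b : ℝ × ℝ}
    (hb : b ∈ S) (h : ¬ IsLeftExtreme S b) :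
    ∃ q r, IsLeftExtreme S q ∧ IsLeftExtreme S r ∧ q.2 < b.2 ∧ b.2 < r.2 ∧ orient q r b < 0 ∧
      ∀ p ∈ S, orient q r p ≤ 0 := by
  obtain ⟨q, r, hq, hr, h1, h2, h3, h4⟩ := exists_supporting_edge (distinctHeights_mirror hD)
    (Finset.mem_image_of_mem _ hb) (isRightExtreme_mirror.not.2 h)
  obtain ⟨q, rfl⟩ : ∃ q', q = mirror q' := ⟨mirror q, by simp⟩
  obtain ⟨r, rfl⟩ : ∃ q', r = mirror q' := ⟨mirror r, by simp⟩
  refine ⟨q, r, isRightExtreme_mirror.1 hq, isRightExtreme_mirror.1 hr, h1, h2, ?_, ?_⟩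
  · simpa using h3
  · intro p hp
    simpa using h4 _ (Finset.mem_image_of_mem _ hp)

/-! ### Splitting a point set into a left and a right chain -/

/-- `A` and `B` cover `S`, share only the extremes, and the chain through `A` is to the left of the
chain through `B`. -/
structure IsSplit (S A B : Finset (ℝ × ℝ)) (s t : ℝ × ℝ) : Prop where
  union : A ∪ B = S
  inter : A ∩ B = {s, t}
  right_mem : ∀ p, IsRightExtreme S p → p ∈ B
  left_of : ∀ a ∈ A, ∀ p q, Consec B p q → p.2 < a.2 → a.2 < q.2 → 0 < orient p q a
  right_of : ∀ b ∈ B, ∀ p q, Consec A p q → p.2 < b.2 → b.2 < q.2 → orient p q b < 0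

theorem IsSouthExtreme.isLeftExtreme {S : Finset (ℝ × ℝ)} {s : ℝ × ℝ} (h : IsSouthExtreme S s) :
    IsLeftExtreme S s :=
  ⟨h.1, fun q hq _ _ h1 _ => absurd (h.2 q hq) (not_le.2 h1)⟩

theorem IsNorthExtreme.isLeftExtreme {S : Finset (ℝ × ℝ)} {s : ℝ × ℝ} (h : IsNorthExtreme S s) :
    IsLeftExtreme S s :=
  ⟨h.1, fun _ _ r hr _ h1 => absurd (h.2 r hr) (not_le.2 h1)⟩

theorem IsSouthExtreme.isRightExtreme {S : Finset (ℝ × ℝ)} {s : ℝ × ℝ} (h : IsSouthExtreme S s) :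
    IsRightExtreme S s :=
  ⟨h.1, fun q hq _ _ h1 _ => absurd (h.2 q hq) (not_le.2 h1)⟩

theorem IsNorthExtreme.isRightExtreme {S : Finset (ℝ × ℝ)} {s : ℝ × ℝ} (h : IsNorthExtreme S s) :
    IsRightExtreme S s :=
  ⟨h.1, fun _ _ r hr _ h1 => absurd (h.2 r hr) (not_le.2 h1)⟩

theorem ne_of_snd_lt {p q : ℝ × ℝ} (h : p.2 < q.2) : p ≠ q := fun e => by
  rw [e] at h; exact lt_irrefl _ h

/-- Only an extreme point is both left and right extreme. -/
theorem eq_or_eq_of_extreme {S : Finset (ℝ × ℝ)} (hD : DistinctHeights S) (hG : GeneralPosition S)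
    {s t p : ℝ × ℝ} (hs : IsSouthExtreme S s) (ht : IsNorthExtreme S t)
    (hl : IsLeftExtreme S p) (hr : IsRightExtreme S p) : p = s ∨ p = t := by
  by_contra! hc
  have h1 : s.2 < p.2 := lt_of_le_of_ne (hs.2 p hl.1) fun e => hc.1 (hD _ hs.1 _ hl.1 e).symm
  have h2 : p.2 < t.2 := lt_of_le_of_ne (ht.2 p hl.1) fun e => hc.2 (hD _ hl.1 _ ht.1 e)
  exact orient_ne_zero hD hG hs.1 ht.1 hl.1 (ne_of_snd_lt (h1.trans h2)) (ne_of_snd_lt h1)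
    (ne_of_snd_lt h2).symm
    (le_antisymm (hr.2 s hs.1 t ht.1 h1 h2) (hl.2 s hs.1 t ht.1 h1 h2))

open Classical in
-- The starting point of the moves. One side condition is left extremity itself. For the other, a
-- point that is not left extreme has a left hull edge beyond it, and this edge is the edge of the
-- left chain at its height.
theorem isSplit_leftExtreme {S : Finset (ℝ × ℝ)} (hD : DistinctHeights S) (hG : GeneralPosition S)
    {s t : ℝ × ℝ} (hs : IsSouthExtreme S s) (ht : IsNorthExtreme S t) :
    IsSplit S (S.filter (IsLeftExtreme S))
      (S.filter (fun p => p = s ∨ p = t ∨ ¬ IsLeftExtreme S p)) s t where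
  union := by
    ext p
    simp only [Finset.mem_union, Finset.mem_filter]
    tauto
  inter := by
    ext p
    simp only [Finset.mem_inter, Finset.mem_filter, Finset.mem_insert, Finset.mem_singleton]
    constructor
    · rintro ⟨⟨h1, h2⟩, h3, h4⟩
      tauto
    · rintro (rfl | rfl)
      · exact ⟨⟨hs.1, hs.isLeftExtreme⟩, hs.1, Or.inl rfl⟩
      · exact ⟨⟨ht.1, ht.isLeftExtreme⟩, ht.1, Or.inr (Or.inl rfl)⟩
  right_mem := by
    intro p hp
    simp only [Finset.mem_filter]
    refine ⟨hp.1, ?_⟩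
    by_cases h : IsLeftExtreme S p
    · rcases eq_or_eq_of_extreme hD hG hs ht h hp with h | h <;> simp [h]
    · exact Or.inr (Or.inr h)
  left_of := by
    intro a ha p q hpq h1 h2
    simp only [Finset.mem_filter] at ha
    obtain ⟨hp, hq, h3, -⟩ := hpq
    simp only [Finset.mem_filter] at hp hq
    exact lt_of_le_of_ne (ha.2.2 p hp.1 q hq.1 h1 h2)
      (orient_ne_zero hD hG hp.1 hq.1 ha.1 (ne_of_snd_lt h3) (ne_of_snd_lt h1)
        (ne_of_snd_lt h2).symm).symm
  right_of := by
    intro b hb p q hpq h1 h2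
    simp only [Finset.mem_filter] at hb
    obtain ⟨hp, hq, h3, hcons⟩ := hpq
    simp only [Finset.mem_filter] at hp hq hcons
    have hbl : ¬ IsLeftExtreme S b := by
      intro hbl
      rcases hcons b ⟨hb.1, hbl⟩ with h | h <;> linarith
    obtain ⟨u, v, hu, hv, hub, hbv, hneg, hall⟩ := exists_supporting_edge_left hD hb.1 hbl
    have hup : u.2 ≤ p.2 := by
      rcases hcons u ⟨hu.1, hu⟩ with h | h <;> linarith
    have hqv : q.2 ≤ v.2 := by
      rcases hcons v ⟨hv.1, hv⟩ with h | h <;> linarith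
    -- A left extreme point strictly between `u` and `v` in height would lie on the line `u v`,
    -- against general position. Hence `u` and `v` are the consecutive points `p` and `q`.
    have key : ∀ x ∈ S, IsLeftExtreme S x → u.2 < x.2 → x.2 < v.2 → False := by
      intro x hx hxl hux hxv
      exact orient_ne_zero hD hG hu.1 hv.1 hx (ne_of_snd_lt (hux.trans hxv)) (ne_of_snd_lt hux)
        (ne_of_snd_lt hxv).symm (le_antisymm (hall x hx) (hxl.2 u hu.1 v hv.1 hux hxv))
    have hpu : u = p := by
      refine hD u hu.1 p hp.1 (le_antisymm hup ?_)
      by_contra! hlt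
      exact key p hp.1 hp.2 hlt (h1.trans hbv)
    have hqv' : q = v := by
      refine hD q hq.1 v hv.1 (le_antisymm hqv ?_)
      by_contra! hlt
      exact key q hq.1 hq.2 (hub.trans h2) hlt
    rw [← hpu, hqv']
    exact hneg

/-- If `b` is concave on the right chain and the two new edges of the left chain through `b` leave
the rest of the right chain on their right side, then `b` can be moved to the left chain. -/
theorem IsSplit.move {S A B : Finset (ℝ × ℝ)} {s t : ℝ × ℝ} (hD : DistinctHeights S)
    (h : IsSplit S A B s t) {a a' p b r : ℝ × ℝ}
    (hpb : Consec B p b) (hbr : Consec B b r) (hconc : 0 < orient p r b)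
    (ha : Consec A a a') (hab : a.2 < b.2) (hba : b.2 < a'.2)
    (hlow : ∀ x ∈ B, a.2 < x.2 → x.2 < b.2 → orient a b x < 0)
    (hhigh : ∀ x ∈ B, b.2 < x.2 → x.2 < a'.2 → orient b a' x < 0) :
    IsSplit S (insert b A) (B.erase b) s t := by
  have hAS : A ⊆ S := h.union ▸ Finset.subset_union_left
  have hBS : B ⊆ S := h.union ▸ Finset.subset_union_right
  have hbB : b ∈ B := hpb.2.1
  have hbA : b ∉ A := fun hb => by rcases ha.2.2.2 b hb with h | h <;> linarith
  refine ⟨?_, ?_, ?_, ?_, ?_⟩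
  · rw [← h.union]
    ext x
    simp only [Finset.mem_union, Finset.mem_insert, Finset.mem_erase]
    by_cases hx : x = b
    · simp [hx, hbB]
    · simp [hx]
  · rw [← h.inter]
    ext x
    simp only [Finset.mem_inter, Finset.mem_insert, Finset.mem_erase]
    by_cases hx : x = b
    · simp [hx, hbA]
    · simp [hx]
  -- The removed point is not right extreme, because the segment from `p` to `r` passes to its
  -- right.
  · intro x hx
    refine Finset.mem_erase.2 ⟨?_, h.right_mem x hx⟩
    rintro rfl
    exact absurd (hx.2 p (hBS hpb.1) r (hBS hbr.2.1) hpb.2.2.1 hbr.2.2.1) (not_le.2 hconc)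
  · intro x hx u v huv hux hxv
    obtain ⟨hu, hv, huv', hcons⟩ := huv
    simp only [Finset.mem_erase] at hu hv hcons
    -- The only new edge of the right chain is the chord from `p` to `r`. By concavity the old path
    -- over `b` runs to the left of this chord, so whatever was to the left of the path is to the
    -- left of the chord.
    by_cases hb : u.2 < b.2 ∧ b.2 < v.2
    · have hup : u = p := by
        refine hD u (hBS hu.2) p (hBS hpb.1) (le_antisymm ?_ ?_)
        · rcases hpb.2.2.2 u hu.2 with h | h <;> linarith [hb.1]
        · have := hpb.2.2.1
          rcases hcons p ⟨ne_of_snd_lt this, hpb.1⟩ with h | h <;> linarith [hb.2]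
      have hvr : v = r := by
        refine hD v (hBS hv.2) r (hBS hbr.2.1) (le_antisymm ?_ ?_)
        · have := hbr.2.2.1
          rcases hcons r ⟨(ne_of_snd_lt this).symm, hbr.2.1⟩ with h | h <;> linarith [hb.1]
        · rcases hbr.2.2.2 v hv.2 with h | h <;> linarith [hb.2]
      subst hup hvr
      rcases Finset.mem_insert.1 hx with rfl | hxA
      · exact hconc
      · rcases lt_trichotomy x.2 b.2 with hlt | heq | hgt
        · have h1 := h.left_of x hxA u b hpb hux hlt
          have key : (b.2 - u.2) * orient u v x = (v.2 - u.2) * orient u b x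
            + (x.2 - u.2) * orient u v b := by unfold orient; ring
          have h2 := mul_pos (sub_pos.2 huv') h1
          have h3 := mul_pos (sub_pos.2 hux) hconc
          exact (mul_pos_iff_of_pos_left (sub_pos.2 hpb.2.2.1)).1 (by linarith)
        · exact absurd (hD x (hAS hxA) b (hBS hbB) heq ▸ hxA) hbA
        · have h1 := h.left_of x hxA b v hbr hgt hxv
          have key : (v.2 - b.2) * orient u v x = (v.2 - u.2) * orient b v x
            + (v.2 - x.2) * orient u v b := by unfold orient; ring
          have h2 := mul_pos (sub_pos.2 huv') h1
          have h3 := mul_pos (sub_pos.2 hxv) hconc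
          exact (mul_pos_iff_of_pos_left (sub_pos.2 hbr.2.2.1)).1 (by linarith)
    · have huvB : Consec B u v := by
        refine ⟨hu.2, hv.2, huv', fun y hy => ?_⟩
        by_cases hyb : y = b
        · subst hyb
          by_contra! hc
          exact hb hc
        · exact hcons y ⟨hyb, hy⟩
      rcases Finset.mem_insert.1 hx with rfl | hxA
      · exact absurd ⟨hux, hxv⟩ hb
      · exact h.left_of x hxA u v huvB hux hxv
  · intro y hy u v huv huy hyv
    obtain ⟨hyb, hyB⟩ := Finset.mem_erase.1 hy
    obtain ⟨hu, hv, huv', hcons⟩ := huv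
    simp only [Finset.mem_insert] at hu hv hcons
    -- The new edges of the left chain are those that end or start at `b`, which `hlow` and `hhigh`
    -- control; every other edge was already there.
    rcases hu with rfl | hu
    · rcases hv with rfl | hv
      · exact absurd huv' (lt_irrefl _)
      · have : v = a' := by
          refine hD v (hAS hv) a' (hAS ha.2.1) (le_antisymm ?_ ?_)
          · rcases hcons a' (Or.inr ha.2.1) with h | h <;> linarith
          · rcases ha.2.2.2 v hv with h | h <;> linarith
        subst this
        exact hhigh y hyB huy hyv
    · rcases hv with rfl | hv
      · have : u = a := by
          refine hD u (hAS hu) a (hAS ha.1) (le_antisymm ?_ ?_)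
          · rcases ha.2.2.2 u hu with h | h <;> linarith
          · rcases hcons a (Or.inr ha.1) with h | h <;> linarith
        subst this
        exact hlow y hyB huy hyv
      · exact h.right_of y hyB u v ⟨hu, hv, huv', fun x hx => hcons x (Or.inr hx)⟩ huy hyv

theorem exists_consec_around {A : Finset (ℝ × ℝ)} {u v : ℝ × ℝ} {y : ℝ} (hu : u ∈ A) (hv : v ∈ A)
    (huy : u.2 < y) (hyv : y < v.2) (hy : ∀ x ∈ A, x.2 ≠ y) :
    ∃ a a', Consec A a a' ∧ a.2 < y ∧ y < a'.2 := by
  obtain ⟨a, ha, hmax⟩ := Finset.exists_max_image (A.filter (fun x => x.2 < y)) Prod.snd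
    ⟨u, by simp [hu, huy]⟩
  simp only [Finset.mem_filter, and_imp] at ha hmax
  obtain ⟨a', ha', -⟩ := exists_consec_above ha.1 hv (ha.2.trans hyv)
  refine ⟨a, a', ha', ha.2, ?_⟩
  by_contra! hc
  exact absurd (hmax a' ha'.2.1 (lt_of_le_of_ne hc (hy a' ha'.2.1))) (not_le.2 ha'.2.2.1)

/-- As long as the right chain contains a point that is not right extreme, some point can be moved
from the right chain to the left one. -/
theorem IsSplit.exists_move {S A B : Finset (ℝ × ℝ)} {s t : ℝ × ℝ} (hD : DistinctHeights S)
    (hG : GeneralPosition S) (hs : IsSouthExtreme S s) (ht : IsNorthExtreme S t)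
    (h : IsSplit S A B s t) {b₀ : ℝ × ℝ} (hb₀ : b₀ ∈ B) (hb₀' : ¬ IsRightExtreme S b₀) :
    ∃ b ∈ B, b ∉ A ∧ IsSplit S (insert b A) (B.erase b) s t := by
  have hAS : A ⊆ S := h.union ▸ Finset.subset_union_left
  have hBS : B ⊆ S := h.union ▸ Finset.subset_union_right
  have hmem : ∀ x, x ∈ A → x ∈ B → x = s ∨ x = t := fun x hx hx' => by
    have := h.inter ▸ Finset.mem_inter.2 ⟨hx, hx'⟩
    simpa using this
  have hsAB : s ∈ A ∧ s ∈ B := Finset.mem_inter.1 (h.inter ▸ by simp)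
  have htAB : t ∈ A ∧ t ∈ B := Finset.mem_inter.1 (h.inter ▸ by simp)
  obtain ⟨p₀, q₀, r₀, hpq₀, hqr₀, hconc₀⟩ := exists_concave_vertex hD hG hBS h.right_mem hb₀ hb₀'
  have hsq₀ : s.2 < q₀.2 := lt_of_le_of_lt (hs.2 p₀ (hBS hpq₀.1)) hpq₀.2.2.1
  have hqt₀ : q₀.2 < t.2 := lt_of_lt_of_le hqr₀.2.2.1 (ht.2 r₀ (hBS hqr₀.2.1))
  -- The edge of the left chain that spans the height of the concave vertex `q₀`; the search is
  -- restricted to its height range.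
  obtain ⟨a, a', ha, haq₀, hqa₀⟩ := exists_consec_around hsAB.1 htAB.1 hsq₀ hqt₀
    (fun x hx he => by
      rw [hD x (hAS hx) q₀ (hBS hpq₀.2.1) he] at hx
      rcases hmem q₀ hx hpq₀.2.1 with rfl | rfl <;> linarith)
  classical
  -- Right of the edge `a a'` the function `orient a a'` is negative, so its maximum is attained at
  -- the concave vertex nearest to that edge.
  obtain ⟨b, hb, hmin⟩ := Finset.exists_max_image
    (B.filter (fun x => a.2 < x.2 ∧ x.2 < a'.2 ∧
      ∃ p r, Consec B p x ∧ Consec B x r ∧ 0 < orient p r x)) (orient a a')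
    ⟨q₀, by simp only [Finset.mem_filter]; exact ⟨hpq₀.2.1, haq₀, hqa₀, p₀, r₀, hpq₀, hqr₀, hconc₀⟩⟩
  simp only [Finset.mem_filter, and_imp] at hb hmin
  obtain ⟨hbB, hab, hba, p, r, hpb, hbr, hconc⟩ := hb
  have hbneg := h.right_of b hbB a a' ha hab hba
  -- General position makes a weak left turn strict, so maximality applies to weakly concave
  -- vertices too.
  have contra : ∀ x ∈ B, a.2 < x.2 → x.2 < a'.2 → (∃ p, Consec B p x ∧ ∃ r, Consec B x r ∧
      0 ≤ orient p r x) → orient a a' x ≤ orient a a' b := by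
    rintro x hx h1 h2 ⟨p, hpx, r, hxr, h3⟩
    refine hmin x hx h1 h2 ⟨p, r, hpx, hxr, lt_of_le_of_ne h3 (Ne.symm ?_)⟩
    exact orient_ne_zero hD hG (hBS hpx.1) (hBS hxr.2.1) (hBS hx)
      (ne_of_snd_lt (hpx.2.2.1.trans hxr.2.2.1)) (ne_of_snd_lt hpx.2.2.1)
      (ne_of_snd_lt hxr.2.2.1).symm
  have hbA : b ∉ A := fun hb => by rcases ha.2.2.2 b hb with h | h <;> linarith
  refine ⟨b, hbB, hbA, h.move hD hpb hbr hconc ha hab hba ?_ ?_⟩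
  · intro x hx hax hxb
    by_contra! hpos
    -- The worst offender: the point farthest to the left of the prospective edge `a b`. It is shown
    -- to be concave.
    obtain ⟨c, hc, hmax⟩ := Finset.exists_max_image
      (B.filter (fun x => a.2 < x.2 ∧ x.2 < b.2)) (orient a b) ⟨x, by simp [hx, hax, hxb]⟩
    simp only [Finset.mem_filter, and_imp] at hc hmax
    obtain ⟨hcB, hac, hcb⟩ := hc
    have hcpos : 0 ≤ orient a b c := hpos.trans (hmax x hx hax hxb)
    obtain ⟨u, hu, -⟩ := exists_consec_below hcB hsAB.2 (lt_of_le_of_lt (hs.2 a (hAS ha.1)) hac)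
    obtain ⟨v, hv, hvb⟩ := exists_consec_above hcB hbB hcb
    have hle := contra c hcB hac (hcb.trans hba) ⟨u, hu, v, hv, by
      refine orient_nonneg_of_extreme hab hu.2.2.1 hv.2.2.1 ?_ ?_
      · rcases lt_trichotomy a.2 u.2 with hlt | heq | hgt
        · exact hmax u hu.1 hlt (hu.2.2.1.trans hcb)
        · rw [← hD a (hAS ha.1) u (hBS hu.1) heq]
          refine le_trans (le_of_eq ?_) hcpos
          simp [orient]
        -- The lower neighbour `u` may lie below `a`, outside the range of the maximum. But `a` is
        -- to the left of the edge `u c`, and this keeps `u` from exceeding `c`.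
        · have h1 := h.left_of a ha.1 u c hu hgt hac
          have key : (c.2 - a.2) * orient a b u + (a.2 - u.2) * orient a b c
              = - ((b.2 - a.2) * orient u c a) := by unfold orient; ring
          have h2 := mul_pos (sub_pos.2 hab) h1
          have h3 := mul_nonneg (sub_nonneg.2 hgt.le) hcpos
          by_contra! hcon
          have h4 := mul_nonneg (sub_nonneg.2 hac.le) (hcpos.trans hcon.le)
          linarith
      · rcases hvb.lt_or_eq with hlt | heq
        · exact hmax v hv.2.1 (hac.trans hv.2.2.1) hlt
        · rw [hD v (hBS hv.2.1) b (hBS hbB) heq]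
          refine le_trans (le_of_eq ?_) hcpos
          simp [orient, mul_comm]⟩
    -- Being below `b` and not to the right of `a b`, the point `c` is nearer to `a a'` than `b`,
    -- against the choice of `b`.
    have key : (b.2 - a.2) * orient a a' c =
        (c.2 - a.2) * orient a a' b + (a'.2 - a.2) * orient a b c := by unfold orient; ring
    have h1 := mul_le_mul_of_nonneg_left hle (sub_nonneg.2 hab.le)
    have h2 := mul_nonneg (sub_nonneg.2 (hab.trans hba).le) hcpos
    have h3 := mul_neg_of_pos_of_neg (sub_pos.2 hcb) hbneg
    linarith
  · intro x hx hbx hxa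
    by_contra! hpos
    obtain ⟨c, hc, hmax⟩ := Finset.exists_max_image
      (B.filter (fun x => b.2 < x.2 ∧ x.2 < a'.2)) (orient b a') ⟨x, by simp [hx, hbx, hxa]⟩
    simp only [Finset.mem_filter, and_imp] at hc hmax
    obtain ⟨hcB, hbc, hca⟩ := hc
    have hcpos : 0 ≤ orient b a' c := hpos.trans (hmax x hx hbx hxa)
    obtain ⟨v, hv, -⟩ := exists_consec_above hcB htAB.2 (lt_of_lt_of_le hca (ht.2 a' (hAS ha.2.1)))
    obtain ⟨u, hu, hbu⟩ := exists_consec_below hcB hbB hbc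
    have hle := contra c hcB (hab.trans hbc) hca ⟨u, hu, v, hv, by
      refine orient_nonneg_of_extreme hba hu.2.2.1 hv.2.2.1 ?_ ?_
      · rcases hbu.lt_or_eq with hlt | heq
        · exact hmax u hu.1 hlt (hu.2.2.1.trans hca)
        · rw [← hD b (hBS hbB) u (hBS hu.1) heq]
          refine le_trans (le_of_eq ?_) hcpos
          simp [orient]
      · rcases lt_trichotomy v.2 a'.2 with hlt | heq | hgt
        · exact hmax v hv.2.1 (hbc.trans hv.2.2.1) hlt
        · rw [hD v (hBS hv.2.1) a' (hAS ha.2.1) heq]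
          refine le_trans (le_of_eq ?_) hcpos
          simp [orient, mul_comm]
        · have h1 := h.left_of a' ha.2.1 c v hv hca hgt
          have key : (a'.2 - c.2) * orient b a' v + (v.2 - a'.2) * orient b a' c
              = - ((a'.2 - b.2) * orient c v a') := by unfold orient; ring
          have h2 := mul_pos (sub_pos.2 hba) h1
          have h3 := mul_nonneg (sub_nonneg.2 hgt.le) hcpos
          by_contra! hcon
          have h4 := mul_nonneg (sub_nonneg.2 hca.le) (hcpos.trans hcon.le)
          linarith⟩
    have key : (a'.2 - b.2) * orient a a' c =
        (a'.2 - c.2) * orient a a' b + (a'.2 - a.2) * orient b a' c := by unfold orient; ring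
    have h1 := mul_le_mul_of_nonneg_left hle (sub_nonneg.2 hba.le)
    have h2 := mul_nonneg (sub_nonneg.2 (hab.trans hba).le) hcpos
    have h3 := mul_neg_of_pos_of_neg (sub_pos.2 hbc) hbneg
    linarith

open Classical in
/-- A split with right chain of any prescribed size between the extreme possibilities. -/
theorem exists_isSplit_card {S : Finset (ℝ × ℝ)} {s t : ℝ × ℝ} (hD : DistinctHeights S)
    (hG : GeneralPosition S) (hs : IsSouthExtreme S s) (ht : IsNorthExtreme S t) {k l : ℕ}
    (hst : s ≠ t) (hkl : k + l = S.card + 2) (hk : (S.filter (IsLeftExtreme S)).card ≤ k)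
    (hl : (S.filter (IsRightExtreme S)).card ≤ l) :
    ∃ A B, IsSplit S A B s t ∧ A.card = k ∧ B.card = l := by
  have hcard : ∀ A B, IsSplit S A B s t → A.card + B.card = S.card + 2 := fun A B h => by
    rw [← Finset.card_union_add_card_inter, h.union, h.inter, Finset.card_pair hst]
  -- Here `m` counts the moves still to be made.
  have main : ∀ m A B, IsSplit S A B s t → B.card = l + m → ∃ A B, IsSplit S A B s t ∧
      B.card = l := by
    intro m
    induction m with
    | zero => intro A B h hB; exact ⟨A, B, h, hB⟩
    | succ m ih =>
      intro A B h hB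
      have : ∃ b ∈ B, ¬ IsRightExtreme S b := by
        by_contra! hc
        have : B ⊆ S.filter (IsRightExtreme S) := fun x hx =>
          Finset.mem_filter.2 ⟨(hc x hx).1, hc x hx⟩
        have := Finset.card_le_card this
        omega
      obtain ⟨b₀, h1, h2⟩ := this
      obtain ⟨b, hb, -, hsplit⟩ := h.exists_move hD hG hs ht h1 h2
      exact ih _ _ hsplit (by rw [Finset.card_erase_of_mem hb]; omega)
  have h0 := isSplit_leftExtreme hD hG hs ht
  have h1 := hcard _ _ h0
  obtain ⟨A, B, h, hB⟩ := main _ _ _ h0 (Nat.add_sub_of_le (by omega : l ≤ _)).symm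
  exact ⟨A, B, h, by have := hcard _ _ h; omega, hB⟩

/-! ### The envelopes -/

/-- The hull lies in the half-plane where the functional is at most its value at `p`; arbitrarily
short steps from `p` along the normal `(α, β)` leave it. -/
theorem mem_frontier_convexHull {S : Finset (ℝ × ℝ)} {p : ℝ × ℝ} (hp : p ∈ S) {α β : ℝ}
    (h0 : 0 < α * α + β * β) (h : ∀ q ∈ S, α * q.1 + β * q.2 ≤ α * p.1 + β * p.2) :
    p ∈ frontier (convexHull ℝ (S : Set (ℝ × ℝ))) := by
  refine ⟨subset_closure (subset_convexHull ℝ _ hp), fun hint => ?_⟩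
  have hsub : convexHull ℝ (S : Set (ℝ × ℝ)) ⊆
      {x | α * x.1 + β * x.2 ≤ α * p.1 + β * p.2} := by
    refine convexHull_min (fun q hq => h q hq) ?_
    intro x hx y hy a b ha hb hab
    simp only [Set.mem_ofPred_eq, Prod.fst_add, Prod.smul_fst, Prod.snd_add, Prod.smul_snd,
      smul_eq_mul] at hx hy ⊢
    have h1 := mul_le_mul_of_nonneg_left hx ha
    have h2 := mul_le_mul_of_nonneg_left hy hb
    have h3 : α * p.1 + β * p.2 = a * (α * p.1 + β * p.2) + b * (α * p.1 + β * p.2) := by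
      rw [← add_mul, hab, one_mul]
    linarith
  have hcont : Filter.Tendsto (fun ε : ℝ => (p.1 + ε * α, p.2 + ε * β)) (nhdsWithin 0 (Set.Ioi 0))
      (nhds p) := by
    have : Continuous (fun ε : ℝ => (p.1 + ε * α, p.2 + ε * β)) := by fun_prop
    have h2 := this.tendsto 0
    simp only [zero_mul, add_zero, Prod.mk.eta] at h2
    exact h2.mono_left nhdsWithin_le_nhds
  have h1 := hcont.eventually (mem_interior_iff_mem_nhds.1 hint)
  obtain ⟨ε, hε, hpos⟩ := (h1.and self_mem_nhdsWithin).exists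
  have h2 := hsub hε
  simp only [Set.mem_ofPred_eq] at h2 hpos
  have := mul_pos hpos h0
  linarith

/-- Central projection from `b` to the horizontal line through `p` is continuous near `p`, so points
near `p` on the side of `b` project between `z₁` and `z₂` and lie in the triangle. -/
theorem eventually_mem_of_triangle {C : Set (ℝ × ℝ)} (hC : Convex ℝ C) {p b z₁ z₂ : ℝ × ℝ}
    (hb : b ∈ C) (hz₁ : z₁ ∈ C) (hz₂ : z₂ ∈ C) (h₁ : z₁.2 = p.2) (h₂ : z₂.2 = p.2)
    (hl : z₁.1 < p.1) (hr : p.1 < z₂.1) (hpb : b.2 ≠ p.2) :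
    ∀ᶠ x in nhds p, 0 ≤ (x.2 - p.2) / (b.2 - p.2) → x ∈ C := by
  have hb0 : b.2 - p.2 ≠ 0 := sub_ne_zero.2 hpb
  -- `l x` is the weight of `b`, and `z x` below is the abscissa of the projection, so that `x` is
  -- `(1 - l x) • (z x, p.2) + l x • b`.
  let l : ℝ × ℝ → ℝ := fun x => (x.2 - p.2) / (b.2 - p.2)
  have hlc : ContinuousAt l p := by fun_prop
  have hlp : l p = 0 := by simp [l]
  let z : ℝ × ℝ → ℝ := fun x => (x.1 - l x * b.1) / (1 - l x)
  have hzc : ContinuousAt z p := by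
    refine ContinuousAt.div (by fun_prop) (by fun_prop) ?_
    simp [hlp]
  have hzp : z p = p.1 := by simp [z, hlp]
  filter_upwards [hlc.eventually (gt_mem_nhds (by rw [hlp]; exact one_pos)),
    hzc.eventually (lt_mem_nhds (by rw [hzp]; exact hl)),
    hzc.eventually (gt_mem_nhds (by rw [hzp]; exact hr))] with x h1 h2 h3 h4
  have hzC : (z x, p.2) ∈ C := by
    have hd : 0 < z₂.1 - z₁.1 := by linarith
    have := hC hz₁ hz₂ (a := (z₂.1 - z x) / (z₂.1 - z₁.1)) (b := (z x - z₁.1) / (z₂.1 - z₁.1))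
      (div_nonneg (by linarith) hd.le) (div_nonneg (by linarith) hd.le) (by field_simp; ring)
    convert this using 1
    ext
    · simp only [Prod.fst_add, Prod.smul_fst, smul_eq_mul]
      field_simp
      ring
    · simp only [Prod.snd_add, Prod.smul_snd, smul_eq_mul, h₁, h₂]
      field_simp
      ring
  have := hC hzC hb (a := 1 - l x) (b := l x) (by linarith) h4 (by ring)
  convert this using 1
  ext
  · simp only [Prod.fst_add, Prod.smul_fst, smul_eq_mul]
    have : 1 - l x ≠ 0 := by linarith
    simp only [z]
    field_simp
    ring
  · simp only [Prod.snd_add, Prod.smul_snd, smul_eq_mul, l]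
    field_simp
    ring

/-- The point at height `y` of the line through `q` and `r`. -/
noncomputable def atHeight (q r : ℝ × ℝ) (y : ℝ) : ℝ × ℝ :=
  (q.1 + (y - q.2) / (r.2 - q.2) * (r.1 - q.1), y)

theorem atHeight_mem_segment {q r : ℝ × ℝ} {y : ℝ} (h1 : q.2 ≤ y) (h2 : y ≤ r.2)
    (h : q.2 < r.2) : atHeight q r y ∈ segment ℝ q r := by
  have h0 : 0 < r.2 - q.2 := sub_pos.2 h
  refine ⟨1 - (y - q.2) / (r.2 - q.2), (y - q.2) / (r.2 - q.2), ?_, ?_, by ring, ?_⟩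
  · rw [sub_nonneg, div_le_one h0]; linarith
  · exact div_nonneg (by linarith) h0.le
  · ext
    · simp [atHeight]; ring
    · simp [atHeight]; field_simp; ring

/-- The dictionary between cross products and horizontal comparison with a segment. -/
theorem orient_eq_atHeight {q r : ℝ × ℝ} (p : ℝ × ℝ) (h : q.2 < r.2) :
    orient q r p = (r.2 - q.2) * ((atHeight q r p.2).1 - p.1) := by
  have h0 : r.2 - q.2 ≠ 0 := sub_ne_zero.2 h.ne'
  simp only [orient, atHeight]
  field_simp
  ring

/-- The two segments provide hull points at the height of `p` on both sides of it. The triangles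
that these span with `b` above and `a` below together cover a neighbourhood of `p`. -/
theorem mem_interior_convexHull {S : Finset (ℝ × ℝ)} {p a b q r : ℝ × ℝ} (ha : a ∈ S) (hb : b ∈ S)
    (hq : q ∈ S) (hr : r ∈ S) (h1 : a.2 < p.2) (h2 : p.2 < b.2) (h3 : q.2 < p.2) (h4 : p.2 < r.2)
    (h5 : orient a b p < 0) (h6 : 0 < orient q r p) :
    p ∈ interior (convexHull ℝ (S : Set (ℝ × ℝ))) := by
  have hC : Convex ℝ (convexHull ℝ (S : Set (ℝ × ℝ))) := convex_convexHull ℝ _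
  have hsub := subset_convexHull ℝ (S : Set (ℝ × ℝ))
  have hz₁ := hC.segment_subset (hsub ha) (hsub hb)
    (atHeight_mem_segment h1.le h2.le (h1.trans h2))
  have hz₂ := hC.segment_subset (hsub hq) (hsub hr)
    (atHeight_mem_segment h3.le h4.le (h3.trans h4))
  rw [orient_eq_atHeight p (h1.trans h2)] at h5
  rw [orient_eq_atHeight p (h3.trans h4)] at h6
  have h7 := neg_of_mul_neg_right h5 (by linarith)
  have h8 := (mul_pos_iff_of_pos_left (by linarith)).1 h6
  rw [mem_interior_iff_mem_nhds]
  filter_upwards [eventually_mem_of_triangle hC (hsub hb) hz₁ hz₂ rfl rfl (by linarith)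
      (by linarith) h2.ne', eventually_mem_of_triangle hC (hsub ha) hz₁ hz₂ rfl rfl (by linarith)
      (by linarith) h1.ne] with x hx hx'
  rcases le_total p.2 x.2 with h | h
  · exact hx (div_nonneg (by linarith) (by linarith))
  · exact hx' (div_nonneg_of_nonpos (by linarith) (by linarith))

/-- Below the top, the supporting line at `p` goes through the point `r` above `p` that is farthest
to the right in direction. Points above `p` obey it by the choice of `r`, points below because the
segment to `r` may not pass to the right of `p`. -/
theorem IsRightExtreme.mem_frontier {S : Finset (ℝ × ℝ)} (hD : DistinctHeights S) {t p : ℝ × ℝ}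
    (ht : IsNorthExtreme S t) (hp : IsRightExtreme S p) :
    p ∈ frontier (convexHull ℝ (S : Set (ℝ × ℝ))) := by
  by_cases hpt : p.2 < t.2
  · obtain ⟨r, hr, hmax⟩ := Finset.exists_max_image (S.filter (fun x => p.2 < x.2))
      (fun x => (x.1 - p.1) / (x.2 - p.2)) ⟨t, by simp [ht.1, hpt]⟩
    simp only [Finset.mem_filter, and_imp] at hr hmax
    -- The normal that points to the right of the direction from `p` to `r`.
    refine mem_frontier_convexHull hp.1 (α := r.2 - p.2) (β := -(r.1 - p.1)) ?_ ?_
    · have := mul_pos (sub_pos.2 hr.2) (sub_pos.2 hr.2)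
      have := mul_self_nonneg (-(r.1 - p.1))
      linarith
    · intro q hq
      rcases lt_trichotomy p.2 q.2 with h | h | h
      · have := hmax q hq h
        rw [div_le_div_iff₀ (by linarith) (by linarith [hr.2])] at this
        linarith
      · rw [hD p hp.1 q hq h]
      · have := hp.2 q hq r hr.1 h hr.2
        unfold orient at this
        linarith
  · refine mem_frontier_convexHull hp.1 (α := 0) (β := 1) (by norm_num) fun q hq => ?_
    have := ht.2 q hq
    linarith

theorem IsSouthExtreme.unique {S : Finset (ℝ × ℝ)} (hD : DistinctHeights S) {s s' : ℝ × ℝ}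
    (h : IsSouthExtreme S s) (h' : IsSouthExtreme S s') : s = s' :=
  hD s h.1 s' h'.1 (le_antisymm (h.2 s' h'.1) (h'.2 s h.1))

theorem IsNorthExtreme.unique {S : Finset (ℝ × ℝ)} (hD : DistinctHeights S) {s s' : ℝ × ℝ}
    (h : IsNorthExtreme S s) (h' : IsNorthExtreme S s') : s = s' :=
  hD s h.1 s' h'.1 (le_antisymm (h'.2 s h.1) (h.2 s' h'.1))

theorem mem_convR_iff {S : Finset (ℝ × ℝ)} (hD : DistinctHeights S) (hG : GeneralPosition S)
    (hS : S.Nonempty) {p : ℝ × ℝ} : p ∈ convR S ↔ IsRightExtreme S p := by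
  constructor
  · rintro ⟨hp, hfr, a, b, ha, hb, h⟩
    rcases h with rfl | rfl | h
    · exact ha.isRightExtreme
    · exact hb.isRightExtreme
    · refine ⟨hp, fun q hq r hr h1 h2 => ?_⟩
      by_contra! hc
      exact hfr.2 (mem_interior_convexHull ha.1 hb.1 hq hr (lt_of_le_of_lt (ha.2 q hq) h1)
        (lt_of_lt_of_le h2 (hb.2 r hr)) h1 h2 h hc)
  · intro hp
    obtain ⟨s, hs, hs'⟩ := Finset.exists_min_image S Prod.snd hS
    obtain ⟨t, ht, ht'⟩ := Finset.exists_max_image S Prod.snd hS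
    refine ⟨hp.1, hp.mem_frontier hD ⟨ht, ht'⟩, s, t, ⟨hs, hs'⟩, ⟨ht, ht'⟩, ?_⟩
    by_contra! hc
    have h1 : s.2 < p.2 := lt_of_le_of_ne (hs' p hp.1) fun e => hc.1 (hD _ hs _ hp.1 e).symm
    have h2 : p.2 < t.2 := lt_of_le_of_ne (ht' p hp.1) fun e => hc.2.1 (hD _ hp.1 _ ht e)
    exact orient_ne_zero hD hG hs ht hp.1 (ne_of_snd_lt (h1.trans h2)) (ne_of_snd_lt h1)
      (ne_of_snd_lt h2).symm (le_antisymm (hp.2 s hs t ht h1 h2) hc.2.2)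

theorem generalPosition_mirror {S : Finset (ℝ × ℝ)} (h : GeneralPosition S) :
    GeneralPosition (S.image mirror) := by
  intro p hp q hq r hr hpq hpr hqr hcol
  simp only [Finset.mem_image] at hp hq hr
  obtain ⟨p, hp, rfl⟩ := hp
  obtain ⟨q, hq, rfl⟩ := hq
  obtain ⟨r, hr, rfl⟩ := hr
  refine h p hp q hq r hr (fun e => hpq (by rw [e])) (fun e => hpr (by rw [e]))
    (fun e => hqr (by rw [e])) ?_
  rw [collinear_iff_exists_forall_eq_smul_vadd] at hcol ⊢
  obtain ⟨p₀, v, hv⟩ := hcol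
  refine ⟨mirror p₀, mirror v, fun x hx => ?_⟩
  obtain ⟨c, hc⟩ := hv (mirror x) (by
    simp only [Set.mem_insert_iff, Set.mem_singleton_iff] at hx ⊢
    rcases hx with rfl | rfl | rfl <;> simp)
  refine ⟨c, ?_⟩
  rw [← mirror_mirror x, hc]
  ext <;> simp [mirror]
  ring

theorem mem_convL_iff_mirror {S : Finset (ℝ × ℝ)} {p : ℝ × ℝ} :
    p ∈ convL S ↔ mirror p ∈ convR (S.image mirror) := by
  -- As a continuous linear equivalence, the reflection commutes with convex hulls and with
  -- frontiers.
  let e : (ℝ × ℝ) ≃L[ℝ] (ℝ × ℝ) :=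
    (ContinuousLinearEquiv.neg ℝ).prodCongr (ContinuousLinearEquiv.refl ℝ ℝ)
  have he : ∀ x, e x = mirror x := fun x => by simp [e, mirror]
  have hfr : mirror p ∈ frontier (convexHull ℝ ((S.image mirror : Finset _) : Set (ℝ × ℝ))) ↔
      p ∈ frontier (convexHull ℝ (S : Set (ℝ × ℝ))) := by
    have h1 : convexHull ℝ ((S.image mirror : Finset _) : Set (ℝ × ℝ)) =
        e.toHomeomorph '' convexHull ℝ (S : Set (ℝ × ℝ)) := by
      have := LinearMap.image_convexHull (e : (ℝ × ℝ) →ₗ[ℝ] (ℝ × ℝ)) (S : Set (ℝ × ℝ))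
      rw [Finset.coe_image]
      have h2 : (mirror : ℝ × ℝ → ℝ × ℝ) = e := (funext he).symm
      rw [h2]
      exact this.symm
    rw [h1, ← Homeomorph.image_frontier, ← he]
    exact e.toHomeomorph.injective.mem_set_image
  have hmem : ∀ x, mirror x ∈ S.image mirror ↔ x ∈ S := fun x => by
    simp [mirror_injective.eq_iff]
  have hso : ∀ x, IsSouthExtreme (S.image mirror) (mirror x) ↔ IsSouthExtreme S x := fun x => by
    simp only [IsSouthExtreme, hmem, Finset.forall_mem_image, mirror_snd]
  have hno : ∀ x, IsNorthExtreme (S.image mirror) (mirror x) ↔ IsNorthExtreme S x := fun x => by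
    simp only [IsNorthExtreme, hmem, Finset.forall_mem_image, mirror_snd]
  simp only [convL, convR, Set.mem_ofPred_eq, hfr, hmem]
  refine and_congr_right fun _ => and_congr_right fun _ => ?_
  constructor
  · rintro ⟨a, b, ha, hb, h⟩
    refine ⟨mirror a, mirror b, (hso a).2 ha, (hno b).2 hb, ?_⟩
    simpa [mirror_injective.eq_iff] using h
  · rintro ⟨a, b, ha, hb, h⟩
    obtain ⟨a, rfl⟩ : ∃ q', a = mirror q' := ⟨mirror a, by simp⟩
    obtain ⟨b, rfl⟩ : ∃ q', b = mirror q' := ⟨mirror b, by simp⟩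
    refine ⟨a, b, (hso a).1 ha, (hno b).1 hb, ?_⟩
    simpa [mirror_injective.eq_iff] using h

theorem mem_convL_iff {S : Finset (ℝ × ℝ)} (hD : DistinctHeights S) (hG : GeneralPosition S)
    (hS : S.Nonempty) {p : ℝ × ℝ} : p ∈ convL S ↔ IsLeftExtreme S p := by
  rw [mem_convL_iff_mirror, mem_convR_iff (distinctHeights_mirror hD) (generalPosition_mirror hG)
    (hS.image _), isRightExtreme_mirror]

open Classical in
theorem ncard_convR {S : Finset (ℝ × ℝ)} (hD : DistinctHeights S) (hG : GeneralPosition S)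
    (hS : S.Nonempty) : (convR S).ncard = (S.filter (IsRightExtreme S)).card := by
  rw [← Set.ncard_coe_finset]
  congr 1
  ext p
  simp only [mem_convR_iff hD hG hS, Finset.coe_filter, Set.mem_ofPred_eq]
  exact ⟨fun h => ⟨h.1, h⟩, fun h => h.2⟩

open Classical in
theorem ncard_convL {S : Finset (ℝ × ℝ)} (hD : DistinctHeights S) (hG : GeneralPosition S)
    (hS : S.Nonempty) : (convL S).ncard = (S.filter (IsLeftExtreme S)).card := by
  rw [← Set.ncard_coe_finset]
  congr 1
  ext p
  simp only [mem_convL_iff hD hG hS, Finset.coe_filter, Set.mem_ofPred_eq]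
  exact ⟨fun h => ⟨h.1, h⟩, fun h => h.2⟩

/-! ### Chains of segments -/

theorem eq_atHeight_of_mem_segment {q r x : ℝ × ℝ} (h : q.2 < r.2) (hx : x ∈ segment ℝ q r) :
    x = atHeight q r x.2 ∧ q.2 ≤ x.2 ∧ x.2 ≤ r.2 := by
  obtain ⟨a, b, ha, hb, hab, rfl⟩ := hx
  have h0 : r.2 - q.2 ≠ 0 := sub_ne_zero.2 h.ne'
  obtain rfl : a = 1 - b := by linarith
  simp only [atHeight, Prod.snd_add, Prod.smul_snd, smul_eq_mul]
  refine ⟨?_, ?_, ?_⟩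
  · ext
    · simp only [Prod.fst_add, Prod.smul_fst, smul_eq_mul]
      field_simp
      ring
    · simp
  · have := mul_nonneg hb (sub_nonneg.2 h.le)
    linarith
  · have := mul_nonneg ha (sub_nonneg.2 h.le)
    linarith

theorem atHeight_left (q r : ℝ × ℝ) : atHeight q r q.2 = q := by
  simp [atHeight]

theorem atHeight_right {q r : ℝ × ℝ} (h : q.2 < r.2) : atHeight q r r.2 = r := by
  have h0 : r.2 - q.2 ≠ 0 := sub_ne_zero.2 h.ne'
  ext
  · simp only [atHeight]
    field_simp
    ring
  · simp [atHeight]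

/-- Two edges of a chain meet at most in a common end vertex. -/
theorem Consec.segment_inter {A : Finset (ℝ × ℝ)} (hD : DistinctHeights A) {a b a' b' x : ℝ × ℝ}
    (h : Consec A a b) (h' : Consec A a' b') (hx : x ∈ segment ℝ a b)
    (hx' : x ∈ segment ℝ a' b') : (a = a' ∧ b = b') ∨ (x = b ∧ x = a') ∨ (x = a ∧ x = b') := by
  obtain ⟨h1, h2, h3⟩ := eq_atHeight_of_mem_segment h.2.2.1 hx
  obtain ⟨h1', h2', h3'⟩ := eq_atHeight_of_mem_segment h'.2.2.1 hx'
  rcases lt_trichotomy a.2 a'.2 with hlt | heq | hgt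
  · have h4 : b.2 ≤ a'.2 := (h.2.2.2 a' h'.1).resolve_left (not_le.2 hlt)
    refine Or.inr (Or.inl ⟨?_, ?_⟩)
    · rw [h1, show x.2 = b.2 by linarith, atHeight_right h.2.2.1]
    · rw [h1', show x.2 = a'.2 by linarith, atHeight_left]
  · left
    obtain rfl := hD a h.1 a' h'.1 heq
    refine ⟨rfl, hD b h.2.1 b' h'.2.1 (le_antisymm ?_ ?_)⟩
    · exact (h.2.2.2 b' h'.2.1).resolve_left (not_le.2 h'.2.2.1)
    · exact (h'.2.2.2 b h.2.1).resolve_left (not_le.2 h.2.2.1)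
  · have h4 : b'.2 ≤ a.2 := (h'.2.2.2 a h.1).resolve_left (not_le.2 hgt)
    refine Or.inr (Or.inr ⟨?_, ?_⟩)
    · rw [h1, show x.2 = a.2 by linarith, atHeight_left]
    · rw [h1', show x.2 = b'.2 by linarith, atHeight_right h'.2.2.1]

theorem IsSplit.left_mem {S A B : Finset (ℝ × ℝ)} {s t : ℝ × ℝ} (h : IsSplit S A B s t)
    {x : ℝ × ℝ} (hx : x ∈ A) : x ∈ S := h.union ▸ Finset.mem_union_left _ hx

theorem IsSplit.right_mem' {S A B : Finset (ℝ × ℝ)} {s t : ℝ × ℝ} (h : IsSplit S A B s t)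
    {x : ℝ × ℝ} (hx : x ∈ B) : x ∈ S := h.union ▸ Finset.mem_union_right _ hx

theorem IsSplit.eq_or_eq {S A B : Finset (ℝ × ℝ)} {s t : ℝ × ℝ} (h : IsSplit S A B s t)
    {x : ℝ × ℝ} (hx : x ∈ A) (hx' : x ∈ B) : x = s ∨ x = t := by
  have := h.inter ▸ Finset.mem_inter.2 ⟨hx, hx'⟩
  simpa using this

/-- An edge of the left chain is to the left of an edge of the right chain, except for common end
vertices. -/
theorem IsSplit.segment_lt {S A B : Finset (ℝ × ℝ)} {s t : ℝ × ℝ} (h : IsSplit S A B s t)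
    (hD : DistinctHeights S) (hs : IsSouthExtreme S s) (ht : IsNorthExtreme S t)
    (hS : 2 < S.card) {a a' b b' x y : ℝ × ℝ} (ha : Consec A a a') (hb : Consec B b b')
    (hx : x ∈ segment ℝ a a') (hy : y ∈ segment ℝ b b') (hxy : x.2 = y.2) :
    x.1 < y.1 ∨ (x = y ∧ ((a = b ∧ x = a) ∨ (a' = b' ∧ x = a'))) := by
  obtain ⟨hx1, hx2, hx3⟩ := eq_atHeight_of_mem_segment ha.2.2.1 hx
  obtain ⟨hy1, hy2, hy3⟩ := eq_atHeight_of_mem_segment hb.2.2.1 hy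
  rw [← hxy] at hy1 hy2 hy3
  have haa := ha.2.2.1
  have hbb := hb.2.2.1
  have ha0 := h.left_mem ha.1
  have ha0' := h.left_mem ha.2.1
  have hb0 := h.right_mem' hb.1
  have hb0' := h.right_mem' hb.2.1
  -- The horizontal gap between the two supporting lines at height `z`. It is affine, so its sign on
  -- the common height range is determined at the two ends of that range.
  set g : ℝ → ℝ := fun z => (atHeight b b' z).1 - (atHeight a a' z).1 with hg
  have haff : ∀ l u z : ℝ, (u - l) * g z = (u - z) * g l + (z - l) * g u := by
    intro l u z
    simp only [hg, atHeight]
    have h1 : a'.2 - a.2 ≠ 0 := sub_ne_zero.2 haa.ne'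
    have h2 : b'.2 - b.2 ≠ 0 := sub_ne_zero.2 hbb.ne'
    field_simp
    ring
  have hgx : g x.2 = y.1 - x.1 := by
    simp only [hg]
    rw [← hx1, ← hy1]
  -- The common range starts at the higher of the two lower ends. This is a vertex of one chain
  -- strictly beside the edge of the other, unless both edges start at `s`.
  have hlow : (a = b ∧ a = s) ∨ 0 < g (max a.2 b.2) := by
    rcases lt_trichotomy a.2 b.2 with hlt | heq | hgt
    · right
      rw [max_eq_right hlt.le]
      have hba : b.2 < a'.2 := by
        refine lt_of_le_of_ne (by linarith) fun e => ?_
        have := hD b hb0 a' ha0' e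
        rcases h.eq_or_eq (this ▸ ha.2.1) hb.1 with e | e
        · have := hs.2 a ha0
          rw [e] at hlt; linarith
        · have := ht.2 b' hb0'
          rw [e] at hbb; linarith
      have := h.right_of b hb.1 a a' ha hlt hba
      rw [orient_eq_atHeight b haa] at this
      have := neg_of_mul_neg_right this (by linarith)
      simp only [hg]
      rw [atHeight_left]
      linarith
    · left
      have e := hD a ha0 b hb0 heq
      refine ⟨e, (h.eq_or_eq ha.1 (e ▸ hb.1)).resolve_right fun e => ?_⟩
      have := ht.2 a' ha0'
      rw [e] at haa; linarith
    · right
      rw [max_eq_left hgt.le]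
      have hba : a.2 < b'.2 := by
        refine lt_of_le_of_ne (by linarith) fun e => ?_
        have := hD a ha0 b' hb0' e
        rcases h.eq_or_eq ha.1 (this ▸ hb.2.1) with e | e
        · have := hs.2 b hb0
          rw [e] at hgt; linarith
        · have := ht.2 a' ha0'
          rw [e] at haa; linarith
      have := h.left_of a ha.1 b b' hb hgt hba
      rw [orient_eq_atHeight a hbb] at this
      have := (mul_pos_iff_of_pos_left (by linarith)).1 this
      simp only [hg]
      rw [atHeight_left]
      linarith
  have hhigh : (a' = b' ∧ a' = t) ∨ 0 < g (min a'.2 b'.2) := by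
    rcases lt_trichotomy a'.2 b'.2 with hlt | heq | hgt
    · right
      rw [min_eq_left hlt.le]
      have hba : b.2 < a'.2 := by
        refine lt_of_le_of_ne (by linarith) fun e₀ => ?_
        have := hD b hb0 a' ha0' e₀
        rcases h.eq_or_eq (this ▸ ha.2.1) hb.1 with e | e
        · have := hs.2 a ha0
          rw [e] at e₀; linarith
        · have := ht.2 b' hb0'
          rw [e] at hbb; linarith
      have := h.left_of a' ha.2.1 b b' hb hba hlt
      rw [orient_eq_atHeight a' hbb] at this
      have := (mul_pos_iff_of_pos_left (by linarith)).1 this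
      simp only [hg]
      rw [atHeight_right haa]
      linarith
    · left
      have e := hD a' ha0' b' hb0' heq
      refine ⟨e, (h.eq_or_eq ha.2.1 (e ▸ hb.2.1)).resolve_left fun e => ?_⟩
      have := hs.2 a ha0
      rw [e] at haa; linarith
    · right
      rw [min_eq_right hgt.le]
      have hba : a.2 < b'.2 := by
        refine lt_of_le_of_ne (by linarith) fun e₀ => ?_
        have := hD a ha0 b' hb0' e₀
        rcases h.eq_or_eq ha.1 (this ▸ hb.2.1) with e | e
        · have := hs.2 b hb0
          rw [e] at e₀; linarith
        · have := ht.2 a' ha0'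
          rw [e] at haa; linarith
      have := h.right_of b' hb.2.1 a a' ha hba hgt
      rw [orient_eq_atHeight b' haa] at this
      have := neg_of_mul_neg_right this (by linarith)
      simp only [hg]
      rw [atHeight_right hbb]
      linarith
  have hlx : max a.2 b.2 ≤ x.2 := max_le hx2 hy2
  have hxu : x.2 ≤ min a'.2 b'.2 := le_min hx3 hy3
  -- Two edges that share both ends would leave no room for a third point of `S`.
  have hnot : ¬ ((a = b ∧ a = s) ∧ (a' = b' ∧ a' = t)) := by
    rintro ⟨⟨rfl, rfl⟩, rfl, rfl⟩
    have : S ⊆ {a, a'} := by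
      intro z hz
      have h1 := hs.2 z hz
      have h2 := ht.2 z hz
      simp only [Finset.mem_insert, Finset.mem_singleton]
      rcases Finset.mem_union.1 (h.union.symm ▸ hz : z ∈ A ∪ B) with hzA | hzB
      · rcases ha.2.2.2 z hzA with h3 | h3
        · exact Or.inl (hD _ hz _ hs.1 (le_antisymm h3 h1))
        · exact Or.inr (hD _ hz _ ht.1 (le_antisymm h2 h3))
      · rcases hb.2.2.2 z hzB with h3 | h3
        · exact Or.inl (hD _ hz _ hs.1 (le_antisymm h3 h1))
        · exact Or.inr (hD _ hz _ ht.1 (le_antisymm h2 h3))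
    have := (Finset.card_le_card this).trans Finset.card_le_two
    omega
  have hab0 : a = b → g a.2 = 0 := by
    rintro rfl
    simp only [hg]
    rw [atHeight_left, atHeight_left, sub_self]
  have hab0' : a' = b' → g a'.2 = 0 := by
    rintro rfl
    simp only [hg]
    rw [atHeight_right haa, atHeight_right hbb, sub_self]
  have haff' := haff (max a.2 b.2) (min a'.2 b'.2) x.2
  rcases hlow with ⟨hl, hls⟩ | hl
  · rcases hhigh with hh | hh
    · exact absurd ⟨⟨hl, hls⟩, hh⟩ hnot
    · have hm : max a.2 b.2 = a.2 := by rw [hl, max_self]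
      rw [hm] at haff' hlx
      rcases hlx.eq_or_lt with e | hlt
      · have hxa : x = a := by rw [hx1, ← e, atHeight_left]
        refine Or.inr ⟨?_, Or.inl ⟨hl, hxa⟩⟩
        ext
        · have := hab0 hl
          rw [e, hgx] at this
          linarith
        · exact hxy
      · left
        rw [hab0 hl] at haff'
        have h1 := mul_pos (sub_pos.2 hlt) hh
        have h2 : 0 < g x.2 :=
          (mul_pos_iff_of_pos_left (by linarith : 0 < min a'.2 b'.2 - a.2)).1 (by linarith)
        linarith
  · rcases hhigh with ⟨hh, -⟩ | hh
    · have hm : min a'.2 b'.2 = a'.2 := by rw [hh, min_self]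
      rw [hm] at haff' hxu
      rcases hxu.eq_or_lt with e | hlt
      · have hxa : x = a' := by rw [hx1, e, atHeight_right haa]
        refine Or.inr ⟨?_, Or.inr ⟨hh, hxa⟩⟩
        ext
        · have := hab0' hh
          rw [← e, hgx] at this
          linarith
        · exact hxy
      · left
        rw [hab0' hh] at haff'
        have h1 := mul_pos (sub_pos.2 hlt) hl
        have h2 : 0 < g x.2 :=
          (mul_pos_iff_of_pos_left (by linarith : 0 < a'.2 - max a.2 b.2)).1 (by linarith)
        linarith
    · left
      have h1 := mul_nonneg (sub_nonneg.2 hlx) hh.le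
      have h2 := mul_nonneg (sub_nonneg.2 hxu) hl.le
      suffices 0 < g x.2 by linarith
      rcases (hlx.trans hxu).eq_or_lt with e | hlt
      · rw [show x.2 = max a.2 b.2 by linarith]
        exact hl
      · refine (mul_pos_iff_of_pos_left (sub_pos.2 hlt)).1 ?_
        rw [haff']
        rcases hlx.eq_or_lt with e' | hlt'
        · rw [← e']
          have := mul_pos (sub_pos.2 hlt) hl
          linarith
        · have := mul_pos (sub_pos.2 hlt') hh
          linarith

/-! ### Lists sorted by height -/

/-- The points of the list strictly increase in height. -/
def Ascending (l : List (ℝ × ℝ)) : Prop := l.Pairwise (fun p q => p.2 < q.2)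

theorem Ascending.consec {l : List (ℝ × ℝ)} (h : Ascending l) {p q : ℝ × ℝ}
    (hpq : [p, q] <:+: l) : Consec l.toFinset p q := by
  obtain ⟨l₁, l₂, rfl⟩ := hpq
  simp only [Ascending, List.pairwise_append, List.mem_append, List.pairwise_cons,
    List.mem_cons] at h
  refine ⟨by simp, by simp, ?_, ?_⟩
  · exact h.1.2.1.1 q (by simp)
  · intro r hr
    simp only [List.mem_toFinset, List.mem_append, List.mem_cons, List.not_mem_nil, or_false] at hr
    rcases hr with (hr | rfl | rfl) | hr
    · exact Or.inl (h.1.2.2 r hr p (by simp)).le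
    · exact Or.inl le_rfl
    · exact Or.inr le_rfl
    · exact Or.inr (h.2.2 q (by simp) r hr).le

theorem Ascending.nodup {l : List (ℝ × ℝ)} (h : Ascending l) : l.Nodup :=
  h.imp fun h => ne_of_snd_lt h

theorem exists_ascending {A : Finset (ℝ × ℝ)} (hD : DistinctHeights A) :
    ∃ l : List (ℝ × ℝ), Ascending l ∧ l.toFinset = A ∧ l.length = A.card := by
  classical
  let r : ℝ × ℝ → ℝ × ℝ → Prop := fun p q => p.2 ≤ q.2
  have : Std.Total r := ⟨fun p q => le_total _ _⟩
  have : IsTrans (ℝ × ℝ) r := ⟨fun p q s h1 h2 => le_trans h1 h2⟩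
  have hp := List.perm_insertionSort r A.toList
  refine ⟨A.toList.insertionSort r, ?_, ?_, by simp⟩
  · have h1 := List.pairwise_insertionSort r A.toList
    have h2 : (A.toList.insertionSort r).Nodup := hp.nodup_iff.2 A.nodup_toList
    refine (h1.and h2).imp_of_mem ?_
    rintro p q hp' hq' ⟨h3, h4⟩
    refine lt_of_le_of_ne h3 fun e => h4 (hD p ?_ q ?_ e)
    · simpa using hp.subset hp'
    · simpa using hp.subset hq'
  · ext x
    simp

theorem Ascending.head_eq {l : List (ℝ × ℝ)} (h : Ascending l) {p : ℝ × ℝ} (hp : p ∈ l)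
    (hmin : ∀ q ∈ l, p.2 ≤ q.2) : l.head? = some p := by
  cases l with
  | nil => simp at hp
  | cons q l =>
    simp only [Ascending, List.pairwise_cons] at h
    rcases List.mem_cons.1 hp with rfl | hp
    · rfl
    · have := h.1 p hp
      have := hmin q (by simp)
      linarith

theorem Ascending.getLast_eq {l : List (ℝ × ℝ)} (h : Ascending l) {p : ℝ × ℝ} (hp : p ∈ l)
    (hmax : ∀ q ∈ l, q.2 ≤ p.2) : l.getLast? = some p := by
  rcases List.eq_nil_or_concat l with rfl | ⟨l, q, rfl⟩
  · simp at hp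
  · simp only [Ascending, List.pairwise_append, List.concat_eq_append] at h hp hmax ⊢
    rcases List.mem_append.1 hp with hp | hp
    · have := h.2.2 p hp q (by simp)
      have := hmax q (by simp)
      linarith
    · simp only [List.mem_singleton] at hp
      simp [hp]

/-! ### Drawings of two `st`-paths -/

section TwoPaths

variable {V : Type*} {G : Digraph V} {s t : V} {PL PR : List V}

theorem ConsistsOfTwoSTPaths.symm (h : ConsistsOfTwoSTPaths G s t PL PR) :
    ConsistsOfTwoSTPaths G s t PR PL where
  left := h.right
  right := h.left
  internally_disjoint v h1 h2 := h.internally_disjoint v h2 h1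
  vertices v := (h.vertices v).symm
  edges u v huv := (h.edges u v huv).symm

theorem IsSTPath.source_mem {P : List V} (h : IsSTPath G s t P) : s ∈ P :=
  List.mem_of_mem_head? (by rw [h.head]; rfl)

theorem IsSTPath.target_mem {P : List V} (h : IsSTPath G s t P) : t ∈ P :=
  List.mem_of_mem_getLast? (by rw [h.last]; rfl)

theorem IsSTPath.eq_singleton {P : List V} (h : IsSTPath G s s P) : P = [s] := by
  have h1 := h.head
  have h2 := h.last
  have h3 := h.nodup
  cases P with
  | nil => simp at h1
  | cons a l =>
    simp only [List.head?_cons, Option.some.injEq] at h1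
    subst h1
    cases l with
    | nil => rfl
    | cons b l =>
      rw [List.getLast?_cons_cons] at h2
      exact absurd (List.mem_of_mem_getLast? (by rw [h2]; rfl)) (List.nodup_cons.1 h3).1

theorem IsSTPath.adj {P : List V} (h : IsSTPath G s t P) {u v : V} (huv : [u, v] <:+: P) :
    G.Adj u v := by
  have := h.chain.infix huv
  simpa using this

theorem ConsistsOfTwoSTPaths.source_ne_target [Fintype V] (h : ConsistsOfTwoSTPaths G s t PL PR)
    (hn : 3 ≤ Fintype.card V) : s ≠ t := by
  rintro rfl
  have : ∀ v : V, v = s := fun v => by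
    have := h.vertices v
    rw [h.left.eq_singleton, h.right.eq_singleton] at this
    simpa using this
  have : Fintype.card V ≤ 1 := Fintype.card_le_one_iff.2 fun a b => by rw [this a, this b]
  omega

theorem ConsistsOfTwoSTPaths.length_add_length [Fintype V] (h : ConsistsOfTwoSTPaths G s t PL PR)
    (hst : s ≠ t) : PL.length + PR.length = Fintype.card V + 2 := by
  classical
  rw [← List.toFinset_card_of_nodup h.left.nodup, ← List.toFinset_card_of_nodup h.right.nodup,
    ← Finset.card_union_add_card_inter]
  congr 1
  · rw [← Finset.card_univ]
    congr 1
    ext v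
    simpa using h.vertices v
  · rw [← Finset.card_pair hst]
    congr 1
    ext v
    simp only [Finset.mem_inter, List.mem_toFinset, Finset.mem_insert, Finset.mem_singleton]
    constructor
    · rintro ⟨h1, h2⟩
      exact h.internally_disjoint v h1 h2
    · rintro (rfl | rfl)
      · exact ⟨h.left.source_mem, h.right.source_mem⟩
      · exact ⟨h.left.target_mem, h.right.target_mem⟩

/-- Two lists that agree where the paths meet are the images of the paths under a common map. -/
theorem ConsistsOfTwoSTPaths.exists_map {α : Type*} (h : ConsistsOfTwoSTPaths G s t PL PR)
    {l l' : List α} {a b : α} (hl : l.length = PL.length) (hl' : l'.length = PR.length)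
    (ha : l.head? = some a) (hb : l.getLast? = some b) (ha' : l'.head? = some a)
    (hb' : l'.getLast? = some b) :
    ∃ φ : V → α, PL.map φ = l ∧ PR.map φ = l' ∧ φ s = a ∧ φ t = b := by
  classical
  -- Every vertex is on a path, so the default `a` is never attained as such. On `PR` the first
  -- branch applies only to `s` and `t`, where the two lists agree.
  let φ : V → α := fun v => if v ∈ PL then l.getD (PL.idxOf v) a else l'.getD (PR.idxOf v) a
  have hL : PL.map φ = l := by
    refine List.ext_getElem (by simp [hl]) fun i h1 h2 => ?_
    simp only [List.length_map] at h1
    simp only [List.getElem_map, φ, List.getElem_mem, if_true, h.left.nodup.idxOf_getElem i h1,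
      List.getD_eq_getElem?_getD, List.getElem?_eq_getElem h2, Option.getD_some]
  have hs : φ s = a := by
    have := congrArg List.head? hL
    rw [List.head?_map, h.left.head, ha] at this
    simpa using this
  have ht : φ t = b := by
    have := congrArg List.getLast? hL
    rw [List.getLast?_map, h.left.last, hb] at this
    simpa using this
  refine ⟨φ, hL, ?_, hs, ht⟩
  refine List.ext_getElem (by simp [hl']) fun i h1 h2 => ?_
  simp only [List.length_map] at h1
  rw [List.getElem_map]
  by_cases hmem : PR[i] ∈ PL
  · rcases h.internally_disjoint _ hmem (List.getElem_mem h1) with e | e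
    · have h0 : 0 < PR.length := by omega
      have hP := h.right.head
      rw [List.head?_eq_getElem?, List.getElem?_eq_getElem h0, Option.some.injEq] at hP
      obtain rfl := (h.right.nodup.getElem_inj_iff).1 (e.trans hP.symm)
      rw [List.head?_eq_getElem?, List.getElem?_eq_getElem h2, Option.some.injEq] at ha'
      rw [e, hs, ha']
    · have h0 : PR.length - 1 < PR.length := by omega
      have hP := h.right.last
      rw [List.getLast?_eq_getElem?, List.getElem?_eq_getElem h0, Option.some.injEq] at hP
      have hi := (h.right.nodup.getElem_inj_iff).1 (e.trans hP.symm)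
      rw [List.getLast?_eq_getElem?, hl', ← hi, List.getElem?_eq_getElem h2,
        Option.some.injEq] at hb'
      rw [e, ht, hb']
  · simp only [φ, hmem, if_false, h.right.nodup.idxOf_getElem i h1,
      List.getD_eq_getElem?_getD, List.getElem?_eq_getElem h2, Option.getD_some]

/-- Each path is placed on its chain in order of height. Edges become pairs of consecutive points,
so planarity reduces to `Consec.segment_inter` within a chain and to `IsSplit.segment_lt` between
the chains. -/
theorem exists_upse_of_isSplit [Fintype V] (h : ConsistsOfTwoSTPaths G s t PL PR)
    {S A B : Finset (ℝ × ℝ)} {p q : ℝ × ℝ} (hn : 3 ≤ Fintype.card V)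
    (hS : S.card = Fintype.card V) (hD : DistinctHeights S) (hp : IsSouthExtreme S p)
    (hq : IsNorthExtreme S q) (hsp : IsSplit S A B p q) (hA : A.card = PL.length)
    (hB : B.card = PR.length) : ∃ φ : V → ℝ × ℝ, IsUPSE G S φ ∧ DrawnLeftOf φ PL PR := by
  have hDA : DistinctHeights A := fun x hx y hy => hD x (hsp.left_mem hx) y (hsp.left_mem hy)
  have hDB : DistinctHeights B := fun x hx y hy => hD x (hsp.right_mem' hx) y (hsp.right_mem' hy)
  obtain ⟨l, hl, hlA, hlc⟩ := exists_ascending hDA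
  obtain ⟨l', hl', hlB, hlc'⟩ := exists_ascending hDB
  have hpAB : p ∈ A ∧ p ∈ B := Finset.mem_inter.1 (hsp.inter ▸ by simp)
  have hqAB : q ∈ A ∧ q ∈ B := Finset.mem_inter.1 (hsp.inter ▸ by simp)
  have hmA : ∀ x, x ∈ l ↔ x ∈ A := fun x => by rw [← hlA, List.mem_toFinset]
  have hmB : ∀ x, x ∈ l' ↔ x ∈ B := fun x => by rw [← hlB, List.mem_toFinset]
  obtain ⟨φ, hL, hR, hφs, hφt⟩ := h.exists_map (hlc.trans hA) (hlc'.trans hB)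
    (hl.head_eq ((hmA p).2 hpAB.1) fun x hx => hp.2 x (hsp.left_mem ((hmA x).1 hx)))
    (hl.getLast_eq ((hmA q).2 hqAB.1) fun x hx => hq.2 x (hsp.left_mem ((hmA x).1 hx)))
    (hl'.head_eq ((hmB p).2 hpAB.2) fun x hx => hp.2 x (hsp.right_mem' ((hmB x).1 hx)))
    (hl'.getLast_eq ((hmB q).2 hqAB.2) fun x hx => hq.2 x (hsp.right_mem' ((hmB x).1 hx)))
  have hmem : ∀ v, φ v ∈ S := by
    intro v
    rcases h.vertices v with hv | hv
    · exact hsp.left_mem ((hmA _).1 (hL ▸ List.mem_map_of_mem hv))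
    · exact hsp.right_mem' ((hmB _).1 (hR ▸ List.mem_map_of_mem hv))
  -- The chains cover `S`, so `φ` maps onto a set with as many elements as `V`.
  have hinj : Function.Injective φ := by
    classical
    have himg : Finset.univ.image φ = S := by
      ext x
      simp only [Finset.mem_image, Finset.mem_univ, true_and]
      constructor
      · rintro ⟨v, rfl⟩
        exact hmem v
      · intro hx
        rw [← hsp.union, Finset.mem_union, ← hmA, ← hmB, ← hL, ← hR, List.mem_map,
          List.mem_map] at hx
        rcases hx with ⟨v, -, hv⟩ | ⟨v, -, hv⟩ <;> exact ⟨v, hv⟩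
    have := Finset.card_image_iff.1 (by rw [himg, hS, Finset.card_univ] :
      (Finset.univ.image φ).card = (Finset.univ : Finset V).card)
    simpa using this
  have hcL : ∀ u v, [u, v] <:+: PL → Consec A (φ u) (φ v) := fun u v huv => by
    have := hl.consec (p := φ u) (q := φ v) (hL ▸ huv.map φ)
    rwa [hlA] at this
  have hcR : ∀ u v, [u, v] <:+: PR → Consec B (φ u) (φ v) := fun u v huv => by
    have := hl'.consec (p := φ u) (q := φ v) (hR ▸ huv.map φ)
    rwa [hlB] at this
  have hcross : ∀ u v u' v', [u, v] <:+: PL → [u', v'] <:+: PR →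
      ∀ x ∈ segment ℝ (φ u) (φ v), x ∈ segment ℝ (φ u') (φ v') →
      (u = u' ∧ x = φ u) ∨ (v = v' ∧ x = φ v) := by
    intro u v u' v' h1 h2 x hx hx'
    rcases hsp.segment_lt hD hp hq (by omega) (hcL u v h1) (hcR u' v' h2) hx hx' rfl with
      hlt | ⟨-, ⟨e, hxe⟩ | ⟨e, hxe⟩⟩
    · exact absurd hlt (lt_irrefl _)
    · exact Or.inl ⟨hinj e, hxe⟩
    · exact Or.inr ⟨hinj e, hxe⟩
  have hsame : ∀ (C : Finset (ℝ × ℝ)), DistinctHeights C → ∀ u v u' v', Consec C (φ u) (φ v) →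
      Consec C (φ u') (φ v') → (u, v) ≠ (u', v') → ∀ x ∈ segment ℝ (φ u) (φ v),
      x ∈ segment ℝ (φ u') (φ v') → ∃ w, (w = u ∨ w = v) ∧ (w = u' ∨ w = v') ∧ x = φ w := by
    intro C hC u v u' v' h1 h2 hne x hx hx'
    rcases h1.segment_inter hC h2 hx hx' with ⟨e1, e2⟩ | ⟨e1, e2⟩ | ⟨e1, e2⟩
    · exact absurd (by rw [hinj e1, hinj e2]) hne
    · exact ⟨v, Or.inr rfl, Or.inl (hinj (e1.symm.trans e2)), e1⟩
    · exact ⟨u, Or.inl rfl, Or.inr (hinj (e1.symm.trans e2)), e1⟩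
  refine ⟨φ, ⟨hinj, hmem, ?_, ?_⟩, ?_⟩
  · intro u v huv
    rcases h.edges u v huv with h1 | h1
    · exact (hcL u v h1).2.2.1
    · exact (hcR u v h1).2.2.1
  · intro u v u' v' huv huv' hne x hx hx'
    rcases h.edges u v huv with h1 | h1 <;> rcases h.edges u' v' huv' with h2 | h2
    · exact hsame A hDA u v u' v' (hcL u v h1) (hcL u' v' h2) hne x hx hx'
    · rcases hcross u v u' v' h1 h2 x hx hx' with ⟨e, hxe⟩ | ⟨e, hxe⟩
      · exact ⟨u, Or.inl rfl, Or.inl e, hxe⟩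
      · exact ⟨v, Or.inr rfl, Or.inr e, hxe⟩
    · rcases hcross u' v' u v h2 h1 x hx' hx with ⟨e, hxe⟩ | ⟨e, hxe⟩
      · exact ⟨u', Or.inl e, Or.inl rfl, hxe⟩
      · exact ⟨v', Or.inr e, Or.inr rfl, hxe⟩
    · exact hsame B hDB u v u' v' (hcR u v h1) (hcR u' v' h2) hne x hx hx'
  · rintro x ⟨u, v, huv, hx⟩ y ⟨u', v', huv', hy⟩ hxy
    rcases hsp.segment_lt hD hp hq (by omega) (hcL u v huv) (hcR u' v' huv') hx hy hxy with
      hlt | ⟨e, -⟩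
    · exact hlt.le
    · rw [e]

/-! ### Upward planar drawings put one path to the left of the other -/

/-- A discrete intermediate value argument. The element `c` of the tail only ensures that the path
has an edge. -/
theorem exists_edge_at_height {φ : V → ℝ × ℝ} {y : ℝ} : ∀ {P : List V} {a b c : V},
    P.head? = some a → P.getLast? = some b → c ∈ P.tail → (φ a).2 ≤ y → y ≤ (φ b).2 →
    ∃ u v, [u, v] <:+: P ∧ (φ u).2 ≤ y ∧ y ≤ (φ v).2
  | [], _, _, _, h, _, _, _, _ => by simp at h
  | [_], _, _, _, _, _, h, _, _ => by simp at h
  | [u, v], a, b, _, ha, hb, _, h1, h2 => by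
    simp only [List.head?_cons, Option.some.injEq] at ha
    simp only [List.getLast?_cons_cons, List.getLast?_singleton, Option.some.injEq] at hb
    subst ha hb
    exact ⟨u, v, List.infix_rfl, h1, h2⟩
  | u :: v :: w :: l, a, b, _, ha, hb, _, h1, h2 => by
    simp only [List.head?_cons, Option.some.injEq] at ha
    subst ha
    rcases le_total y (φ v).2 with h | h
    · exact ⟨u, v, ⟨[], w :: l, rfl⟩, h1, h⟩
    · rw [List.getLast?_cons_cons] at hb
      obtain ⟨u', v', h3, h4⟩ := exists_edge_at_height (P := v :: w :: l) (a := v) (b := b)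
        (c := w) rfl hb (by simp) h h2
      exact ⟨u', v', List.infix_cons h3, h4⟩

theorem IsSTPath.tail_ne_nil {P : List V} (h : IsSTPath G s t P) (hst : s ≠ t) :
    ∃ c, c ∈ P.tail := by
  have h1 := h.head
  have h2 := h.last
  cases P with
  | nil => simp at h1
  | cons a l =>
    cases l with
    | nil => simp_all
    | cons b l => exact ⟨b, by simp⟩

theorem IsSTPath.ascending {P : List V} (h : IsSTPath G s t P) {S : Finset (ℝ × ℝ)}
    {φ : V → ℝ × ℝ} (hφ : IsUPSE G S φ) : Ascending (P.map φ) := by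
  have : IsTrans (ℝ × ℝ) (fun p q => p.2 < q.2) := ⟨fun _ _ _ h1 h2 => lt_trans h1 h2⟩
  refine List.IsChain.pairwise ?_
  rw [List.isChain_map]
  exact h.chain.imp fun u v huv => hφ.upward u v huv

theorem IsSTPath.source_le {P : List V} (h : IsSTPath G s t P) {S : Finset (ℝ × ℝ)}
    {φ : V → ℝ × ℝ} (hφ : IsUPSE G S φ) {v : V} (hv : v ∈ P) : (φ s).2 ≤ (φ v).2 := by
  have h1 := h.ascending hφ
  have h2 := h.head
  cases P with
  | nil => simp at hv
  | cons a l =>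
    simp only [List.head?_cons, Option.some.injEq] at h2
    subst h2
    simp only [Ascending, List.map_cons, List.pairwise_cons] at h1
    rcases List.mem_cons.1 hv with rfl | hv
    · exact le_rfl
    · exact (h1.1 _ (List.mem_map_of_mem hv)).le

theorem IsSTPath.le_target {P : List V} (h : IsSTPath G s t P) {S : Finset (ℝ × ℝ)}
    {φ : V → ℝ × ℝ} (hφ : IsUPSE G S φ) {v : V} (hv : v ∈ P) : (φ v).2 ≤ (φ t).2 := by
  have h1 := h.ascending hφ
  have h2 := h.last
  rcases List.eq_nil_or_concat P with rfl | ⟨l, q, rfl⟩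
  · simp at hv
  · simp only [List.concat_eq_append, List.getLast?_append, List.getLast?_singleton,
      Option.some_or, Option.some.injEq] at h2
    subst h2
    simp only [Ascending, List.concat_eq_append, List.map_append, List.pairwise_append] at h1
    simp only [List.concat_eq_append, List.mem_append, List.mem_singleton] at hv
    rcases hv with hv | rfl
    · exact (h1.2.2 _ (List.mem_map_of_mem hv) (φ q) (by simp)).le
    · exact le_rfl

theorem ConsistsOfTwoSTPaths.source_le (h : ConsistsOfTwoSTPaths G s t PL PR)
    {S : Finset (ℝ × ℝ)} {φ : V → ℝ × ℝ} (hφ : IsUPSE G S φ) (v : V) : (φ s).2 ≤ (φ v).2 :=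
  (h.vertices v).elim (h.left.source_le hφ) (h.right.source_le hφ)

theorem ConsistsOfTwoSTPaths.le_target (h : ConsistsOfTwoSTPaths G s t PL PR)
    {S : Finset (ℝ × ℝ)} {φ : V → ℝ × ℝ} (hφ : IsUPSE G S φ) (v : V) : (φ v).2 ≤ (φ t).2 :=
  (h.vertices v).elim (h.left.le_target hφ) (h.right.le_target hφ)

/-- The drawings of the two paths meet only at `s` and `t`. -/
theorem ConsistsOfTwoSTPaths.eq_of_mem_both (h : ConsistsOfTwoSTPaths G s t PL PR)
    {S : Finset (ℝ × ℝ)} {φ : V → ℝ × ℝ} (hφ : IsUPSE G S φ) {x : ℝ × ℝ} {v₀ : V} (h₁ : v₀ ≠ s)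
    (h₂ : v₀ ≠ t) (hL : x ∈ pathDrawing φ PL) (hR : x ∈ pathDrawing φ PR) :
    x = φ s ∨ x = φ t := by
  obtain ⟨u, v, huv, hx⟩ := hL
  obtain ⟨u', v', huv', hx'⟩ := hR
  -- Planarity speaks of distinct edges only. An edge common to both paths must run from `s` to `t`,
  -- and then there is no place for the third vertex `v₀`.
  by_cases hne : (u, v) = (u', v')
  · simp only [Prod.mk.injEq] at hne
    obtain ⟨rfl, rfl⟩ := hne
    have e1 := h.internally_disjoint u (huv.subset (by simp)) (huv'.subset (by simp))
    have e2 := h.internally_disjoint v (huv.subset (by simp)) (huv'.subset (by simp))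
    have hup := hφ.upward u v (h.left.adj huv)
    have hus : u = s := by
      rcases e1 with e | rfl
      · exact e
      · have := h.le_target hφ v
        linarith
    have hvt : v = t := by
      rcases e2 with rfl | e
      · have := h.source_le hφ u
        linarith
      · exact e
    subst hus hvt
    exfalso
    have key : ∀ P, IsSTPath G u v P → [u, v] <:+: P → v₀ ∉ P := by
      intro P hP hinf hmem
      have h1 := (hP.ascending hφ).consec (p := φ u) (q := φ v) (hinf.map φ)
      rcases h1.2.2.2 (φ v₀) (by simpa using ⟨v₀, hmem, rfl⟩) with h2 | h2
      · rcases (hP.source_le hφ hmem).eq_or_lt with e | e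
        · obtain ⟨l₁, l₂, hl⟩ := List.append_of_mem hmem
          have hasc := hP.ascending hφ
          have hh := hP.head
          cases l₁ with
          | nil =>
            rw [hl] at hh
            simp only [List.nil_append, List.head?_cons, Option.some.injEq] at hh
            exact h₁ hh
          | cons a l₁ =>
            rw [hl] at hh hasc
            simp only [List.cons_append, List.head?_cons, Option.some.injEq] at hh
            subst hh
            simp only [Ascending, List.cons_append, List.map_cons, List.map_append,
              List.pairwise_cons] at hasc
            have := hasc.1 (φ v₀) (by simp)
            linarith
        · linarith
      · rcases (hP.le_target hφ hmem).eq_or_lt with e | e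
        · have hasc := hP.ascending hφ
          have hnd := hasc.nodup
          have h3 := hP.target_mem
          obtain ⟨i, hi, hi'⟩ := List.getElem_of_mem hmem
          obtain ⟨j, hj, hj'⟩ := List.getElem_of_mem h3
          rcases lt_trichotomy i j with hij | hij | hij
          · have := (List.pairwise_iff_getElem.1 hasc) i j (by simpa) (by simpa) hij
            simp only [List.getElem_map, hi', hj'] at this
            linarith
          · subst hij
            exact h₂ (hi'.symm.trans hj')
          · have := (List.pairwise_iff_getElem.1 hasc) j i (by simpa) (by simpa) hij
            simp only [List.getElem_map, hi', hj'] at this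
            linarith
        · linarith
    rcases h.vertices v₀ with hv | hv
    · exact key PL h.left huv hv
    · exact key PR h.right huv' hv
  · obtain ⟨w, hw, hw', rfl⟩ := hφ.planar u v u' v' (h.left.adj huv) (h.right.adj huv') hne x hx hx'
    have h1 : w ∈ PL := huv.subset (by simpa using hw)
    have h2 : w ∈ PR := huv'.subset (by simpa using hw')
    rcases h.internally_disjoint w h1 h2 with rfl | rfl <;> simp

end TwoPaths

/-- The abscissa at height `y` of the polyline through an ascending list of points. -/
noncomputable def polyX : List (ℝ × ℝ) → ℝ → ℝ
  | [], _ => 0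
  | [p], _ => p.1
  | p :: q :: l, y => if y ≤ q.2 then (atHeight p q y).1 else polyX (q :: l) y

theorem polyX_left {q : ℝ × ℝ} {l : List (ℝ × ℝ)} (h : Ascending (q :: l)) :
    polyX (q :: l) q.2 = q.1 := by
  cases l with
  | nil => rfl
  | cons r l =>
    have : q.2 < r.2 := by
      simp only [Ascending, List.pairwise_cons] at h
      exact h.1 r (by simp)
    rw [polyX, if_pos this.le, atHeight_left]

theorem continuous_polyX : ∀ {l : List (ℝ × ℝ)}, Ascending l → Continuous (polyX l)
  | [], _ => continuous_const
  | [_], _ => continuous_const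
  | p :: q :: l, h => by
    have hpq : p.2 < q.2 := by
      simp only [Ascending, List.pairwise_cons] at h
      exact h.1 q (by simp)
    have hq : Ascending (q :: l) := (List.pairwise_cons.1 h).2
    refine Continuous.if_le ?_ (continuous_polyX hq) continuous_id continuous_const ?_
    · unfold atHeight
      fun_prop
    · intro y hy
      obtain rfl : y = q.2 := hy
      rw [atHeight_right hpq, polyX_left hq]

theorem polyX_eq : ∀ {l : List (ℝ × ℝ)}, Ascending l → ∀ {u v : ℝ × ℝ} {y : ℝ}, [u, v] <:+: l →
    u.2 ≤ y → y ≤ v.2 → polyX l y = (atHeight u v y).1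
  | [], _, u, v, y, huv, _, _ => by simp at huv
  | [_], _, u, v, y, huv, _, _ => by
    have := huv.length_le
    simp at this
  | p :: q :: l, h, u, v, y, huv, h1, h2 => by
    have hpq : p.2 < q.2 := by
      simp only [Ascending, List.pairwise_cons] at h
      exact h.1 q (by simp)
    have hq : Ascending (q :: l) := (List.pairwise_cons.1 h).2
    rcases List.infix_cons_iff.1 huv with h3 | h3
    · simp only [List.cons_prefix_cons] at h3
      obtain ⟨rfl, rfl, -⟩ := h3
      rw [polyX, if_pos h2]
    · have ih := polyX_eq hq h3 h1 h2
      rw [polyX]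
      split_ifs with hy
      -- A later edge meets the height range of the first one only at their common breakpoint.
      · have hle : q.2 ≤ u.2 := by
          have := h3.subset (List.mem_cons_self ..)
          rcases List.mem_cons.1 this with rfl | hu
          · exact le_rfl
          · exact ((List.pairwise_cons.1 hq).1 u hu).le
        obtain rfl : y = q.2 := by linarith
        rw [atHeight_right hpq, ← ih, polyX_left hq]
      · exact ih

section TwoPaths

variable {V : Type*} {G : Digraph V} {s t : V} {PL PR : List V}

theorem IsSTPath.fst_eq_polyX {P : List V} (h : IsSTPath G s t P) {S : Finset (ℝ × ℝ)}
    {φ : V → ℝ × ℝ} (hφ : IsUPSE G S φ) {x : ℝ × ℝ} (hx : x ∈ pathDrawing φ P) :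
    x.1 = polyX (P.map φ) x.2 ∧ (φ s).2 ≤ x.2 ∧ x.2 ≤ (φ t).2 := by
  obtain ⟨u, v, huv, hx⟩ := hx
  obtain ⟨h1, h2, h3⟩ := eq_atHeight_of_mem_segment (hφ.upward u v (h.adj huv)) hx
  refine ⟨?_, (h.source_le hφ (huv.subset (by simp))).trans h2,
    h3.trans (h.le_target hφ (huv.subset (by simp)))⟩
  rw [polyX_eq (h.ascending hφ) (u := φ u) (v := φ v) (huv.map φ) h2 h3, ← h1]

theorem IsSTPath.exists_mem_pathDrawing {P : List V} (h : IsSTPath G s t P) (hst : s ≠ t)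
    {S : Finset (ℝ × ℝ)} {φ : V → ℝ × ℝ} (hφ : IsUPSE G S φ) {y : ℝ} (h1 : (φ s).2 ≤ y)
    (h2 : y ≤ (φ t).2) : (polyX (P.map φ) y, y) ∈ pathDrawing φ P := by
  obtain ⟨c, hc⟩ := h.tail_ne_nil hst
  obtain ⟨u, v, huv, h3, h4⟩ := exists_edge_at_height h.head h.last hc h1 h2
  refine ⟨u, v, huv, ?_⟩
  rw [polyX_eq (h.ascending hφ) (u := φ u) (v := φ v) (huv.map φ) h3 h4]
  exact atHeight_mem_segment h3 h4 (hφ.upward u v (h.adj huv))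

/-- The difference of the abscissas of the two polylines is continuous in the height. If it took
both signs, it would vanish strictly between the extreme heights, and the drawings would meet away
from `s` and `t`. -/
theorem ConsistsOfTwoSTPaths.drawnLeftOf_or [Fintype V] (h : ConsistsOfTwoSTPaths G s t PL PR)
    (hn : 3 ≤ Fintype.card V) {S : Finset (ℝ × ℝ)} {φ : V → ℝ × ℝ} (hφ : IsUPSE G S φ) :
    DrawnLeftOf φ PL PR ∨ DrawnLeftOf φ PR PL := by
  have hst := h.source_ne_target hn
  obtain ⟨v₀, h₁, h₂⟩ : ∃ v₀, v₀ ≠ s ∧ v₀ ≠ t := by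
    classical
    have : ({s, t} : Finset V).card < Fintype.card V := lt_of_le_of_lt Finset.card_le_two (by omega)
    obtain ⟨v, hv⟩ : ∃ v, v ∉ ({s, t} : Finset V) := by
      by_contra! hc
      rw [Finset.eq_univ_iff_forall.2 hc, Finset.card_univ] at this
      exact lt_irrefl _ this
    exact ⟨v, by simpa using hv⟩
  by_contra! hc
  obtain ⟨hc1, hc2⟩ := hc
  unfold DrawnLeftOf at hc1 hc2
  push Not at hc1 hc2
  obtain ⟨p, hp, q, hq, hpq, hlt⟩ := hc1
  obtain ⟨p', hp', q', hq', hpq', hlt'⟩ := hc2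
  obtain ⟨e1, h1, h2⟩ := h.left.fst_eq_polyX hφ hp
  obtain ⟨e2, -, -⟩ := h.right.fst_eq_polyX hφ hq
  obtain ⟨e3, h3, h4⟩ := h.right.fst_eq_polyX hφ hp'
  obtain ⟨e4, -, -⟩ := h.left.fst_eq_polyX hφ hq'
  rw [← hpq] at e2
  rw [← hpq'] at e4
  set f : ℝ → ℝ := fun y => polyX (PL.map φ) y - polyX (PR.map φ) y with hf
  have hcont : Continuous f :=
    (continuous_polyX (h.left.ascending hφ)).sub (continuous_polyX (h.right.ascending hφ))
  have hpos : 0 < f p.2 := by simp only [hf]; linarith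
  have hneg : f p'.2 < 0 := by simp only [hf]; linarith
  have hzero : ∃ y ∈ Set.uIcc p.2 p'.2, f y = 0 := by
    have := intermediate_value_uIcc (a := p.2) (b := p'.2) hcont.continuousOn
    have h0 : (0 : ℝ) ∈ Set.uIcc (f p.2) (f p'.2) := Set.mem_uIcc.2 (Or.inr ⟨hneg.le, hpos.le⟩)
    obtain ⟨y, hy, hy0⟩ := this h0
    exact ⟨y, hy, hy0⟩
  obtain ⟨y, hy, hy0⟩ := hzero
  -- The zero differs from both heights of nonzero sign, which places it strictly between the
  -- heights of `s` and `t`.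
  have hy1 : y ≠ p.2 := fun e => by rw [e] at hy0; linarith
  have hy2 : y ≠ p'.2 := fun e => by rw [e] at hy0; linarith
  have hys : (φ s).2 < y ∧ y < (φ t).2 := by
    rcases Set.mem_uIcc.1 hy with ⟨h5, h6⟩ | ⟨h5, h6⟩
    · exact ⟨lt_of_le_of_lt h1 (lt_of_le_of_ne h5 hy1.symm),
        lt_of_lt_of_le (lt_of_le_of_ne h6 hy2) h4⟩
    · exact ⟨lt_of_le_of_lt h3 (lt_of_le_of_ne h5 hy2.symm),
        lt_of_lt_of_le (lt_of_le_of_ne h6 hy1) h2⟩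
  have hL := h.left.exists_mem_pathDrawing hst hφ hys.1.le hys.2.le
  have hR := h.right.exists_mem_pathDrawing hst hφ hys.1.le hys.2.le
  have heq : polyX (PL.map φ) y = polyX (PR.map φ) y := by
    simp only [hf] at hy0
    linarith
  rw [heq] at hL
  rcases h.eq_of_mem_both hφ h₁ h₂ hL hR with e | e
  · rw [← e] at hys
    exact lt_irrefl _ hys.1
  · rw [← e] at hys
    exact lt_irrefl _ hys.2

/-! ### Necessity of the size conditions, and the characterization. -/

theorem IsUPSE.image_eq [Fintype V] [DecidableEq V] {S : Finset (ℝ × ℝ)} {φ : V → ℝ × ℝ}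
    (hφ : IsUPSE G S φ) (hS : S.card = Fintype.card V) : Finset.univ.image φ = S := by
  refine Finset.eq_of_subset_of_card_le (fun x hx => ?_) ?_
  · obtain ⟨v, -, rfl⟩ := Finset.mem_image.1 hx
    exact hφ.mem v
  · rw [Finset.card_image_of_injective _ hφ.injective, hS, Finset.card_univ]

/-- A vertex that is not on the path `P` is not on the drawing of `P`. -/
theorem ConsistsOfTwoSTPaths.exists_ne_at_height (h : ConsistsOfTwoSTPaths G s t PL PR)
    (hst : s ≠ t) {S : Finset (ℝ × ℝ)} (hD : DistinctHeights S) {φ : V → ℝ × ℝ}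
    (hφ : IsUPSE G S φ) {v : V} (hv : v ∉ PL) :
    ∃ u w, [u, w] <:+: PL ∧ (φ u).2 < (φ v).2 ∧ (φ v).2 < (φ w).2 ∧
      (atHeight (φ u) (φ w) (φ v).2).1 ≠ (φ v).1 ∧
      atHeight (φ u) (φ w) (φ v).2 ∈ pathDrawing φ PL ∧ φ v ∈ pathDrawing φ PR := by
  obtain ⟨c, hc⟩ := h.left.tail_ne_nil hst
  obtain ⟨u, w, huw, h1, h2⟩ := exists_edge_at_height h.left.head h.left.last hc
    (h.source_le hφ v) (h.le_target hφ v)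
  have hne : ∀ z, z ∈ PL → (φ z).2 ≠ (φ v).2 := fun z hz e =>
    hv (hφ.injective (hD _ (hφ.mem z) _ (hφ.mem v) e) ▸ hz)
  have h1' := lt_of_le_of_ne h1 (hne u (huw.subset (by simp)))
  have h2' := lt_of_le_of_ne h2 (hne w (huw.subset (by simp))).symm
  have hmem : atHeight (φ u) (φ w) (φ v).2 ∈ pathDrawing φ PL :=
    ⟨u, w, huw, atHeight_mem_segment h1 h2 (h1'.trans h2')⟩
  have hvR : φ v ∈ pathDrawing φ PR := by
    have hvP := (h.vertices v).resolve_left hv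
    obtain ⟨l₁, l₂, hl⟩ := List.append_of_mem hvP
    cases l₂ with
    | nil =>
      have := h.right.last
      rw [hl] at this
      simp only [List.getLast?_append, List.getLast?_singleton, Option.some_or,
        Option.some.injEq] at this
      exact absurd (this ▸ h.left.target_mem) hv
    | cons b l₂ =>
      exact ⟨v, b, ⟨l₁, l₂, by simp [hl]⟩, left_mem_segment ..⟩
  refine ⟨u, w, huw, h1', h2', fun e => ?_, hmem, hvR⟩
  have heq : atHeight (φ u) (φ w) (φ v).2 = φ v := Prod.ext e rfl
  rw [heq] at hmem
  rcases h.eq_of_mem_both hφ (v₀ := v) (fun e => hv (e ▸ h.left.source_mem))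
    (fun e => hv (e ▸ h.left.target_mem)) hmem hvR with e | e
  · exact hv (hφ.injective e ▸ h.left.source_mem)
  · exact hv (hφ.injective e ▸ h.left.target_mem)

/-- Otherwise an edge of `PL`, which joins two points of `S`, would pass strictly to the left of the
point. -/
theorem ConsistsOfTwoSTPaths.mem_left_of_isLeftExtreme (h : ConsistsOfTwoSTPaths G s t PL PR)
    (hst : s ≠ t) {S : Finset (ℝ × ℝ)} (hD : DistinctHeights S) {φ : V → ℝ × ℝ}
    (hφ : IsUPSE G S φ) (hleft : DrawnLeftOf φ PL PR) {v : V} (hv : IsLeftExtreme S (φ v)) :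
    v ∈ PL := by
  by_contra hvL
  obtain ⟨u, w, huw, h1, h2, hne, hmem, hmem'⟩ := h.exists_ne_at_height hst hD hφ hvL
  have h3 := lt_of_le_of_ne (hleft _ hmem _ hmem' rfl) hne
  have h4 := hv.2 _ (hφ.mem u) _ (hφ.mem w) h1 h2
  rw [orient_eq_atHeight _ (h1.trans h2)] at h4
  have h5 := mul_neg_of_pos_of_neg (sub_pos.2 (h1.trans h2)) (sub_neg.2 h3)
  linarith

theorem ConsistsOfTwoSTPaths.mem_right_of_isRightExtreme (h : ConsistsOfTwoSTPaths G s t PL PR)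
    (hst : s ≠ t) {S : Finset (ℝ × ℝ)} (hD : DistinctHeights S) {φ : V → ℝ × ℝ}
    (hφ : IsUPSE G S φ) (hleft : DrawnLeftOf φ PL PR) {v : V} (hv : IsRightExtreme S (φ v)) :
    v ∈ PR := by
  by_contra hvR
  obtain ⟨u, w, huw, h1, h2, hne, hmem, hmem'⟩ := h.symm.exists_ne_at_height hst hD hφ hvR
  have h3 := lt_of_le_of_ne (hleft _ hmem' _ hmem rfl) hne.symm
  have h4 := hv.2 _ (hφ.mem u) _ (hφ.mem w) h1 h2
  rw [orient_eq_atHeight _ (h1.trans h2)] at h4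
  have h5 := mul_pos (sub_pos.2 (h1.trans h2)) (sub_pos.2 h3)
  linarith

theorem card_filter_le_length [Fintype V] {S : Finset (ℝ × ℝ)} {φ : V → ℝ × ℝ}
    (hφ : IsUPSE G S φ) (hS : S.card = Fintype.card V) {Q : ℝ × ℝ → Prop} [DecidablePred Q]
    {P : List V} (h : ∀ v, Q (φ v) → v ∈ P) : (S.filter Q).card ≤ P.length := by
  classical
  calc (S.filter Q).card ≤ (P.toFinset.image φ).card := by
        refine Finset.card_le_card fun x hx => ?_
        obtain ⟨hx, hQ⟩ := Finset.mem_filter.1 hx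
        rw [← hφ.image_eq hS] at hx
        obtain ⟨v, -, rfl⟩ := Finset.mem_image.1 hx
        exact Finset.mem_image_of_mem _ (List.mem_toFinset.2 (h v hQ))
    _ ≤ P.toFinset.card := Finset.card_image_le
    _ ≤ P.length := List.toFinset_card_le P

/-- The characterization of the point sets on which `G` has an upward pointset embedding with `PL`
to the left of `PR`. -/
theorem ConsistsOfTwoSTPaths.exists_upse_iff [Fintype V] (h : ConsistsOfTwoSTPaths G s t PL PR)
    {S : Finset (ℝ × ℝ)} (hn : 3 ≤ Fintype.card V) (hS : S.card = Fintype.card V)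
    (hD : DistinctHeights S) (hG : GeneralPosition S) :
    (∃ φ : V → ℝ × ℝ, IsUPSE G S φ ∧ DrawnLeftOf φ PL PR) ↔
      (convL S).ncard ≤ PL.length ∧ (convR S).ncard ≤ PR.length := by
  classical
  have hne : S.Nonempty := Finset.card_pos.1 (by omega)
  have hst := h.source_ne_target hn
  rw [ncard_convL hD hG hne, ncard_convR hD hG hne]
  constructor
  · rintro ⟨φ, hφ, hleft⟩
    exact ⟨card_filter_le_length hφ hS fun v hv => h.mem_left_of_isLeftExtreme hst hD hφ hleft hv,
      card_filter_le_length hφ hS fun v hv => h.mem_right_of_isRightExtreme hst hD hφ hleft hv⟩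
  · rintro ⟨h1, h2⟩
    obtain ⟨p, hp, hp'⟩ := Finset.exists_min_image S Prod.snd hne
    obtain ⟨q, hq, hq'⟩ := Finset.exists_max_image S Prod.snd hne
    have hpq : p ≠ q := by
      rintro rfl
      have : S ⊆ {p} := fun x hx =>
        Finset.mem_singleton.2 (hD x hx p hp (le_antisymm (hq' x hx) (hp' x hx)))
      have := Finset.card_le_card this
      simp only [Finset.card_singleton] at this
      omega
    obtain ⟨A, B, hsp, hA, hB⟩ := exists_isSplit_card hD hG ⟨hp, hp'⟩ ⟨hq, hq'⟩ hpq
      (by rw [hS, h.length_add_length hst]) h1 h2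
    exact exists_upse_of_isSplit h hn hS hD ⟨hp, hp'⟩ ⟨hq, hq'⟩ hsp hA hB

theorem ConsistsOfTwoSTPaths.exists_upse_iff_or [Fintype V]
    (h : ConsistsOfTwoSTPaths G s t PL PR) {S : Finset (ℝ × ℝ)} (hn : 3 ≤ Fintype.card V)
    (hS : S.card = Fintype.card V) (hD : DistinctHeights S) (hG : GeneralPosition S) :
    (∃ φ : V → ℝ × ℝ, IsUPSE G S φ) ↔
      ((convL S).ncard ≤ PL.length ∧ (convR S).ncard ≤ PR.length) ∨
      ((convL S).ncard ≤ PR.length ∧ (convR S).ncard ≤ PL.length) := by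
  rw [← h.exists_upse_iff hn hS hD hG, ← h.symm.exists_upse_iff hn hS hD hG]
  constructor
  · rintro ⟨φ, hφ⟩
    exact (h.drawnLeftOf_or hn hφ).imp (fun h => ⟨φ, hφ, h⟩) (fun h => ⟨φ, hφ, h⟩)
  · rintro (⟨φ, hφ, -⟩ | ⟨φ, hφ, -⟩) <;> exact ⟨φ, hφ⟩

end TwoPaths

namespace RealRAM

/-! ### Reasoning about programs -/

/-- Started in `σ`, the program `c` halts within `k` steps in a state that satisfies `Q`. -/
def Runs (c : Cmd) (σ : State) (k : ℕ) (Q : State → Prop) : Prop :=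
  ∃ T τ, Exec c σ T τ ∧ T ≤ k ∧ Q τ

theorem Runs.mono {c : Cmd} {σ : State} {k k' : ℕ} {Q Q' : State → Prop} (h : Runs c σ k Q)
    (hk : k ≤ k') (hQ : ∀ τ, Q τ → Q' τ) : Runs c σ k' Q' := by
  obtain ⟨T, τ, h1, h2, h3⟩ := h
  exact ⟨T, τ, h1, h2.trans hk, hQ τ h3⟩

theorem Runs.seq {c d : Cmd} {σ : State} {k l : ℕ} {P Q : State → Prop} (h : Runs c σ k P)
    (h' : ∀ τ, P τ → Runs d τ l Q) : Runs (.seq c d) σ (k + l) Q := by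
  obtain ⟨T, τ, h1, h2, h3⟩ := h
  obtain ⟨U, υ, h4, h5, h6⟩ := h' τ h3
  exact ⟨T + U, υ, .seq h1 h4, by omega, h6⟩

/-- The rule for loops: `I m` holds when at most `m` iterations remain. -/
theorem Runs.loop {b : BExpr} {c : Cmd} {k : ℕ} (I : ℕ → State → Prop)
    (hbody : ∀ m σ, I m σ → b.Holds σ → ∃ m' < m, Runs c σ k (I m')) :
    ∀ {m σ}, I m σ → Runs (.loop b c) σ (m * (b.cost + k + 1) + (b.cost + 1))
      (fun τ => (∃ m', I m' τ) ∧ ¬ b.Holds τ) := by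
  intro m
  induction m using Nat.strong_induction_on with
  | _ m ih =>
    intro σ hσ
    by_cases hb : b.Holds σ
    · obtain ⟨m', hm, T, τ, h1, h2, h3⟩ := hbody m σ hσ hb
      obtain ⟨U, υ, h4, h5, h6⟩ := ih m' hm h3
      refine ⟨_, υ, .loop_true hb h1 h4, ?_, h6⟩
      have : (m' + 1) * (b.cost + k + 1) ≤ m * (b.cost + k + 1) := Nat.mul_le_mul_right _ hm
      rw [add_mul, one_mul] at this
      omega
    · exact ⟨_, σ, .loop_false hb, by omega, ⟨m, hσ⟩, hb⟩

def Cmd.LoopFree : Cmd → Prop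
  | .seq c d => c.LoopFree ∧ d.LoopFree
  | .ite _ c d => c.LoopFree ∧ d.LoopFree
  | .loop _ _ => False
  | _ => True

/-- An upper bound for the running time of a loop-free program. -/
def Cmd.bound : Cmd → ℕ
  | .skip => 1
  | .nset _ e => e.cost + 1
  | .rset _ e => e.cost + 1
  | .nput _ i e => i.cost + e.cost + 1
  | .rput _ i e => i.cost + e.cost + 1
  | .seq c d => c.bound + d.bound
  | .ite b c d => b.cost + (c.bound + d.bound) + 1
  | .loop _ _ => 0

open Classical in
/-- The effect of a loop-free program. -/
noncomputable def Cmd.run : Cmd → State → State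
  | .skip, σ => σ
  | .nset i e, σ => σ.setN i (e.eval σ)
  | .rset i e, σ => σ.setR i (e.eval σ)
  | .nput a i e, σ => σ.putN a (i.eval σ) (e.eval σ)
  | .rput a i e, σ => σ.putR a (i.eval σ) (e.eval σ)
  | .seq c d, σ => d.run (c.run σ)
  | .ite b c d, σ => if b.Holds σ then c.run σ else d.run σ
  | .loop _ _, σ => σ

theorem exec_of_loopFree : ∀ {c : Cmd}, c.LoopFree → ∀ σ, ∃ T ≤ c.bound, Exec c σ T (c.run σ)
  | .skip, _, σ => ⟨_, le_rfl, .skip σ⟩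
  | .nset i e, _, σ => ⟨_, le_rfl, .nset i e σ⟩
  | .rset i e, _, σ => ⟨_, le_rfl, .rset i e σ⟩
  | .nput a i e, _, σ => ⟨_, le_rfl, .nput a i e σ⟩
  | .rput a i e, _, σ => ⟨_, le_rfl, .rput a i e σ⟩
  | .seq c d, h, σ => by
    obtain ⟨T, hT, h1⟩ := exec_of_loopFree h.1 σ
    obtain ⟨U, hU, h2⟩ := exec_of_loopFree h.2 (c.run σ)
    exact ⟨T + U, Nat.add_le_add hT hU, .seq h1 h2⟩
  | .ite b c d, h, σ => by
    by_cases hb : b.Holds σ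
    · obtain ⟨T, hT, h1⟩ := exec_of_loopFree h.1 σ
      refine ⟨_, ?_, by simpa [Cmd.run, hb] using Exec.ite_true hb h1⟩
      simp only [Cmd.bound]
      omega
    · obtain ⟨T, hT, h1⟩ := exec_of_loopFree h.2 σ
      refine ⟨_, ?_, by simpa [Cmd.run, hb] using Exec.ite_false hb h1⟩
      simp only [Cmd.bound]
      omega
  | .loop _ _, h, _ => h.elim

theorem Runs.of_loopFree {c : Cmd} (h : c.LoopFree) {σ : State} {Q : State → Prop}
    (hQ : Q (c.run σ)) : Runs c σ c.bound Q := by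
  obtain ⟨T, hT, hex⟩ := exec_of_loopFree h σ
  exact ⟨T, _, hex, hT, hQ⟩

theorem Runs.seq_loopFree {c d : Cmd} (h : c.LoopFree) {σ : State} {l : ℕ} {Q : State → Prop}
    (h' : Runs d (c.run σ) l Q) : Runs (.seq c d) σ (c.bound + l) Q :=
  (Runs.of_loopFree h (Q := fun τ => τ = c.run σ) rfl).seq fun _ hτ => hτ ▸ h'

section StateLemmas

variable (σ : State) (a b i j v : ℕ) (x : ℝ)

@[simp] theorem State.setN_nreg : (σ.setN i v).nreg j = if j = i then v else σ.nreg j := by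
  simp [State.setN, Function.update_apply]

@[simp] theorem State.setN_narr : (σ.setN i v).narr = σ.narr := rfl

@[simp] theorem State.setN_rarr : (σ.setN i v).rarr = σ.rarr := rfl

@[simp] theorem State.putN_nreg : (σ.putN a i v).nreg = σ.nreg := rfl

@[simp] theorem State.putN_rarr : (σ.putN a i v).rarr = σ.rarr := rfl

@[simp] theorem State.putN_narr :
    (σ.putN a i v).narr b j = if b = a ∧ j = i then v else σ.narr b j := by
  by_cases h : b = a
  · subst h
    simp [State.putN, Function.update_apply]
  · simp [State.putN, h]

@[simp] theorem State.putR_nreg : (σ.putR a i x).nreg = σ.nreg := rfl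

@[simp] theorem State.putR_narr : (σ.putR a i x).narr = σ.narr := rfl

@[simp] theorem State.putR_rarr :
    (σ.putR a i x).rarr b j = if b = a ∧ j = i then x else σ.rarr b j := by
  by_cases h : b = a
  · subst h
    simp [State.putR, Function.update_apply]
  · simp [State.putR, h]

end StateLemmas

/-! ### The scan for the envelopes -/

/-- Twice the signed area of the triangle formed by the second entry from the top of the stack, the
current point and the top of the stack. -/
def scanOrient : RExpr :=
  let a : NExpr := .get 3 (.sub (.reg 21) (.const 2))
  let b : NExpr := .get 3 (.sub (.reg 21) (.const 1))
  let c : NExpr := .reg 20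
  .sub (.mul (.sub (.get 0 c) (.get 0 a)) (.sub (.get 1 b) (.get 1 a)))
    (.mul (.sub (.get 1 c) (.get 1 a)) (.sub (.get 0 b) (.get 0 a)))

/-- One iteration does a single pop or a single push, so it has bounded cost and amortization enters
only through the number of iterations. -/
def scanBody (test : BExpr) : Cmd :=
  .ite (.and (.nlt (.const 1) (.reg 21)) test)
    (.nset 21 (.sub (.reg 21) (.const 1)))
    (.seq (.nput 3 (.reg 21) (.reg 20))
      (.seq (.nset 21 (.add (.reg 21) (.const 1))) (.nset 20 (.add (.reg 20) (.const 1)))))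

/-- Pushes the points on a stack of indices in order, where the top of the stack is removed as long
as `test` holds. Register `21` holds the size of the stack. -/
def scan (test : BExpr) : Cmd :=
  .seq (.nset 20 (.const 0)) (.seq (.nset 21 (.const 0))
    (.loop (.nlt (.reg 20) (.reg 0)) (scanBody test)))

/-- The invariant of the scan of the indices below `n`, with the current index `i` and a stack `st`
of size `m`, where `bad a c b` means that `b` has to be removed between `a` and `c`. -/
structure ScanInv (bad : ℕ → ℕ → ℕ → Prop) (n : ℕ) (st : ℕ → ℕ) (m i : ℕ) : Prop where
  le : i ≤ n
  lt : ∀ j < m, st j < i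
  mono : ∀ j, j + 1 < m → st j < st (j + 1)
  good : ∀ j, j + 2 < m → ¬ bad (st j) (st (j + 2)) (st (j + 1))
  removed : ∀ p < i, (∃ j < m, st j = p) ∨ ∃ q r, q < p ∧ p < r ∧ r < n ∧ bad q r p

/-- The entry below the top and the current index are the witnesses that the popped point is not on
the envelope. -/
theorem ScanInv.pop {bad : ℕ → ℕ → ℕ → Prop} {n : ℕ} {st : ℕ → ℕ} {m i : ℕ}
    (h : ScanInv bad n st m i) (hi : i < n) (hm : 1 < m)
    (hbad : bad (st (m - 2)) i (st (m - 1))) : ScanInv bad n st (m - 1) i where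
  le := h.le
  lt j hj := h.lt j (by omega)
  mono j hj := h.mono j (by omega)
  good j hj := h.good j (by omega)
  removed p hp := by
    rcases h.removed p hp with ⟨j, hj, rfl⟩ | h'
    · by_cases hjm : j = m - 1
      · subst hjm
        have := h.mono (m - 2) (by omega)
        rw [show m - 2 + 1 = m - 1 by omega] at this
        exact Or.inr ⟨_, i, this, hp, hi, hbad⟩
      · exact Or.inl ⟨j, by omega, rfl⟩
    · exact Or.inr h'

theorem ScanInv.push {bad : ℕ → ℕ → ℕ → Prop} {n : ℕ} {st st' : ℕ → ℕ} {m i : ℕ}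
    (h : ScanInv bad n st m i) (hi : i < n)
    (hbad : 1 < m → ¬ bad (st (m - 2)) i (st (m - 1))) (hst : ∀ j, j ≠ m → st' j = st j)
    (hm : st' m = i) : ScanInv bad n st' (m + 1) (i + 1) where
  le := hi
  lt j hj := by
    by_cases hjm : j = m
    · subst hjm
      omega
    · rw [hst j hjm]
      have := h.lt j (by omega)
      omega
  mono j hj := by
    rw [hst j (by omega)]
    by_cases hjm : j + 1 = m
    · rw [hjm, hm]
      exact h.lt j (by omega)
    · rw [hst _ hjm]
      exact h.mono j (by omega)
  good j hj := by
    rw [hst j (by omega), hst (j + 1) (by omega)]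
    by_cases hjm : j + 2 = m
    · rw [hjm, hm]
      have := hbad (by omega)
      rwa [show m - 2 = j by omega, show m - 1 = j + 1 by omega] at this
    · rw [hst _ hjm]
      exact h.good j (by omega)
  removed p hp := by
    by_cases hpi : p = i
    · exact Or.inl ⟨m, by omega, by rw [hm, hpi]⟩
    · rcases h.removed p (by omega) with ⟨j, hj, hj'⟩ | h'
      · exact Or.inl ⟨j, by omega, by rw [hst j (by omega), hj']⟩
      · exact Or.inr h'

theorem runs_scan {test : BExpr} {bad : (ℕ → ℕ → ℝ) → ℕ → ℕ → ℕ → Prop}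
    (htest : ∀ σ : State, test.Holds σ ↔ bad σ.rarr (σ.narr 3 (σ.nreg 21 - 2)) (σ.nreg 20)
      (σ.narr 3 (σ.nreg 21 - 1))) :
    ∃ K, ∀ σ : State, Runs (scan test) σ (K * (σ.nreg 0 + 1)) (fun τ =>
      ScanInv (bad σ.rarr) (σ.nreg 0) (τ.narr 3) (τ.nreg 21) (σ.nreg 0) ∧ τ.rarr = σ.rarr ∧
      ∀ i, i ≠ 20 → i ≠ 21 → τ.nreg i = σ.nreg i) := by
  set L := (BExpr.nlt (.reg 20) (.reg 0)).cost + (scanBody test).bound + 1 with hL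
  -- At most `2 * n` iterations of at most `L` steps each, and `8` steps for the two initializations
  -- and the final test.
  refine ⟨2 * L + 8, fun σ => ?_⟩
  set n := σ.nreg 0 with hn
  -- The potential counts the pushes and pops that can still occur: each unread index weighs two and
  -- each stack entry one, so either kind of iteration lowers it by one.
  let I : ℕ → State → Prop := fun m τ =>
    ScanInv (bad σ.rarr) n (τ.narr 3) (τ.nreg 21) (τ.nreg 20) ∧ τ.rarr = σ.rarr ∧
    (∀ i, i ≠ 20 → i ≠ 21 → τ.nreg i = σ.nreg i) ∧ 2 * (n - τ.nreg 20) + τ.nreg 21 = m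
  have hloop : ∀ τ, I (2 * n) τ → Runs (.loop (.nlt (.reg 20) (.reg 0)) (scanBody test)) τ
      (2 * n * L + 4) _ := fun τ hτ => Runs.loop I (c := scanBody test) ?_ hτ
  · unfold scan
    refine (Runs.seq_loopFree (by trivial) (Runs.seq_loopFree (by trivial)
      (hloop _ ?_))).mono ?_ ?_
    · refine ⟨⟨?_, ?_, ?_, ?_, ?_⟩, rfl, ?_, ?_⟩ <;>
        simp +contextual [Cmd.run, NExpr.eval]
    · simp only [Cmd.bound, NExpr.cost]
      ring_nf
      omega
    · rintro τ ⟨⟨m, h1, h2, h3, -⟩, h4⟩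
      refine ⟨?_, h2, h3⟩
      have : τ.nreg 20 = n := by
        simp only [BExpr.Holds, NExpr.eval, h3 0 (by norm_num) (by norm_num)] at h4
        have := h1.le
        omega
      rwa [this] at h1
  · rintro m τ ⟨h1, h2, h3, h4⟩ hb
    have hi : τ.nreg 20 < n := by
      simpa only [BExpr.Holds, NExpr.eval, h3 0 (by norm_num) (by norm_num)] using hb
    have h0 : τ.nreg 0 = n := h3 0 (by norm_num) (by norm_num)
    by_cases hc : (BExpr.and (.nlt (.const 1) (.reg 21)) test).Holds τ
    · have hc1 : 1 < τ.nreg 21 := hc.1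
      have hc2 := (htest τ).1 hc.2
      rw [h2] at hc2
      refine ⟨m - 1, by omega, Runs.of_loopFree (c := scanBody test)
        (by simp [scanBody, Cmd.LoopFree]) ?_⟩
      simp only [scanBody, Cmd.run, if_pos hc]
      refine ⟨?_, h2, ?_, ?_⟩
      · simpa [NExpr.eval] using h1.pop hi hc1 hc2
      · intro i hi1 hi2
        simp [hi2, h3 i hi1 hi2]
      · simp [NExpr.eval]
        omega
    · refine ⟨m - 1, by omega, Runs.of_loopFree (c := scanBody test)
        (by simp [scanBody, Cmd.LoopFree]) ?_⟩
      simp only [scanBody, Cmd.run, if_neg hc]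
      refine ⟨?_, h2, ?_, ?_⟩
      · have := h1.push (st' := fun j => if j = τ.nreg 21 then τ.nreg 20 else τ.narr 3 j) hi ?_
          (fun j hj => by simp [hj]) (by simp)
        · convert this using 1
          · funext j
            simp [NExpr.eval]
          · simp [NExpr.eval]
          · simp [NExpr.eval]
        · intro h5 h6
          refine hc ⟨h5, (htest τ).2 ?_⟩
          rwa [h2]
      · intro i hi1 hi2
        simp [hi1, hi2, h3 i hi1 hi2]
      · simp [NExpr.eval]
        omega

end RealRAM

/-! ### The result of the scan -/

/-- `S` is listed by `f` in ascending order. -/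
structure IsListing (S : Finset (ℝ × ℝ)) (n : ℕ) (f : ℕ → ℝ × ℝ) : Prop where
  mem : ∀ i < n, f i ∈ S
  exists_index : ∀ p ∈ S, ∃ i < n, f i = p
  lt : ∀ i j, i < j → j < n → (f i).2 < (f j).2

open Classical in
-- No right extreme point is ever removed, since removal exhibits a segment to its right. The final
-- stack has no concave vertex, so by `exists_concave_vertex` it contains nothing else.
theorem IsListing.scan_card {S : Finset (ℝ × ℝ)} {n : ℕ} {f : ℕ → ℝ × ℝ} (h : IsListing S n f)
    (hD : DistinctHeights S) (hG : GeneralPosition S) {st : ℕ → ℕ} {m : ℕ}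
    (hst : RealRAM.ScanInv (fun a c b => 0 < orient (f a) (f c) (f b)) n st m n) :
    m = (S.filter (IsRightExtreme S)).card := by
  have hmono : ∀ d j, j + d < m → st j ≤ st (j + d) ∧ (0 < d → st j < st (j + d)) := by
    intro d
    induction d with
    | zero => intro j _; simp
    | succ d ih =>
      intro j hj
      have h1 := (ih j (by omega)).1
      have h2 := hst.mono (j + d) (by omega)
      rw [← add_assoc]
      constructor
      · omega
      · intro _; omega
  have hlt : ∀ j j', j < j' → j' < m → (f (st j)).2 < (f (st j')).2 := by
    intro j j' hj hj'
    refine h.lt _ _ ?_ (hst.lt j' hj')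
    have := (hmono (j' - j) j (by omega)).2 (by omega)
    rwa [show j + (j' - j) = j' by omega] at this
  have hlt_iff : ∀ j j', j < m → j' < m → (f (st j)).2 < (f (st j')).2 → j < j' := by
    intro j j' hj hj' hjj
    by_contra! hc
    rcases hc.eq_or_lt with rfl | hc
    · exact lt_irrefl _ hjj
    · exact lt_asymm hjj (hlt _ _ hc hj)
  set B := (Finset.range m).image (fun j => f (st j)) with hB
  have hmemB : ∀ x, x ∈ B ↔ ∃ j < m, f (st j) = x := fun x => by simp [hB]
  have hBcard : B.card = m := by
    rw [hB, Finset.card_image_of_injOn, Finset.card_range]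
    intro j hj j' hj' he
    simp only [Finset.coe_range, Set.mem_Iio] at hj hj'
    dsimp only at he
    rcases lt_trichotomy j j' with hl | hl | hl
    · exact absurd he (ne_of_snd_lt (hlt _ _ hl hj'))
    · exact hl
    · exact absurd he.symm (ne_of_snd_lt (hlt _ _ hl hj))
  have hBS : B ⊆ S := by
    intro x hx
    obtain ⟨j, hj, rfl⟩ := (hmemB x).1 hx
    exact h.mem _ (hst.lt j hj)
  have hsub : ∀ p, IsRightExtreme S p → p ∈ B := by
    intro p hp
    obtain ⟨i, hi, rfl⟩ := h.exists_index p hp.1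
    rcases hst.removed i hi with ⟨j, hj, rfl⟩ | ⟨q, r, hq, hr, hrn, hbad⟩
    · exact (hmemB _).2 ⟨j, hj, rfl⟩
    · exact absurd (hp.2 _ (h.mem q (by omega)) _ (h.mem r hrn) (h.lt _ _ hq hi) (h.lt _ _ hr hrn))
        (not_le.2 hbad)
  -- Neighbours in height within `B` are neighbours on the stack, so the invariant on adjacent
  -- triples speaks about vertices of the chain.
  have hconsec : ∀ j j', j < m → j' < m → Consec B (f (st j)) (f (st j')) → j' = j + 1 := by
    intro j j' hj hj' hc
    have h1 := hlt_iff _ _ hj hj' hc.2.2.1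
    by_contra hne
    rcases hc.2.2.2 (f (st (j + 1))) ((hmemB _).2 ⟨_, by omega, rfl⟩) with h2 | h2
    · have := hlt j (j + 1) (by omega) (by omega)
      linarith
    · have := hlt (j + 1) j' (by omega) hj'
      linarith
  have hBeq : B = S.filter (IsRightExtreme S) := by
    refine Finset.Subset.antisymm (fun b hb => ?_)
      (fun b hb => hsub b (Finset.mem_filter.1 hb).2)
    refine Finset.mem_filter.2 ⟨hBS hb, ?_⟩
    by_contra hbad
    obtain ⟨p, q, r, hpq, hqr, hpos⟩ := exists_concave_vertex hD hG hBS hsub hb hbad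
    obtain ⟨j₁, hj₁, rfl⟩ := (hmemB _).1 hpq.1
    obtain ⟨j₂, hj₂, rfl⟩ := (hmemB _).1 hpq.2.1
    obtain ⟨j₃, hj₃, rfl⟩ := (hmemB _).1 hqr.2.1
    obtain rfl := hconsec _ _ hj₁ hj₂ hpq
    obtain rfl := hconsec _ _ hj₂ hj₃ hqr
    exact hst.good j₁ hj₃ hpos
  rw [← hBeq, hBcard]

theorem IsListing.reflect {S : Finset (ℝ × ℝ)} {n : ℕ} {f : ℕ → ℝ × ℝ} (h : IsListing S n f) :
    IsListing (S.image mirror) n (fun i => mirror (f i)) where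
  mem i hi := Finset.mem_image_of_mem _ (h.mem i hi)
  exists_index p hp := by
    obtain ⟨q, hq, rfl⟩ := Finset.mem_image.1 hp
    obtain ⟨i, hi, rfl⟩ := h.exists_index q hq
    exact ⟨i, hi, rfl⟩
  lt i j hi hj := h.lt i j hi hj

open Classical in
theorem card_filter_isLeftExtreme (S : Finset (ℝ × ℝ)) :
    (S.filter (IsLeftExtreme S)).card =
      ((S.image mirror).filter (IsRightExtreme (S.image mirror))).card := by
  rw [Finset.filter_image, Finset.card_image_of_injective _ mirror_injective]
  simp only [isRightExtreme_mirror]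

open Classical in
theorem IsListing.scan_card_left {S : Finset (ℝ × ℝ)} {n : ℕ} {f : ℕ → ℝ × ℝ}
    (h : IsListing S n f) (hD : DistinctHeights S) (hG : GeneralPosition S) {st : ℕ → ℕ} {m : ℕ}
    (hst : RealRAM.ScanInv (fun a c b => orient (f a) (f c) (f b) < 0) n st m n) :
    m = (S.filter (IsLeftExtreme S)).card := by
  rw [card_filter_isLeftExtreme]
  refine h.reflect.scan_card (distinctHeights_mirror hD) (generalPosition_mirror hG) (st := st) ?_
  simpa only [orient_mirror, Left.neg_pos_iff] using hst

namespace RealRAM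

/-! ### Merge sort -/

/-- The blocks of length `w` among the first `m` entries of `f` are sorted by height: the heights of
two entries with no multiple of `w` between them are in order. -/
def SortedRuns (w m : ℕ) (f : ℕ → ℝ × ℝ) : Prop :=
  ∀ p q, p < q → q < m → (∀ e, e * w ≤ q → e * w ≤ p) → (f p).2 ≤ (f q).2

theorem SortedRuns.of_le {w m a b : ℕ} {f : ℕ → ℝ × ℝ} (h : SortedRuns w m f) (c : ℕ)
    (ha : a = c * w) (hb : b ≤ a + w) (hbm : b ≤ m) :
    ∀ p q, a ≤ p → p < q → q < b → (f p).2 ≤ (f q).2 := by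
  intro p q hp hpq hq
  refine h p q hpq (by omega) fun e he => ?_
  rcases le_or_gt e c with hec | hec
  · exact (Nat.mul_le_mul_right w hec).trans (by omega)
  · have := Nat.mul_le_mul_right w hec
    rw [Nat.succ_mul] at this
    omega

/-- The invariant of a pass that merges adjacent blocks of length `w` of `src` into `dst`. The blocks
that are being merged have the unread parts `[i, mid)` and `[j, hi)`, and `k` entries have been
written. -/
structure MergeInv (n w : ℕ) (src dst : ℕ → ℝ × ℝ) (k i mid j hi : ℕ) : Prop where
  i_le : i ≤ mid
  mid_le : mid ≤ j
  j_le : j ≤ hi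
  hi_le : hi ≤ n
  written : mid + k = i + j
  block : ∃ c, hi = min (c * (2 * w)) n ∧ c * (2 * w) ≤ k + 2 * w ∧
    ∀ p < k, c * (2 * w) ≤ p + 2 * w → ∀ q, (i ≤ q ∧ q < mid ∨ j ≤ q ∧ q < hi) →
      (dst p).2 ≤ (src q).2
  sorted : SortedRuns (2 * w) k dst
  left_sorted : ∀ p q, i ≤ p → p < q → q < mid → (src p).2 ≤ (src q).2
  right_sorted : ∀ p q, j ≤ p → p < q → q < hi → (src p).2 ≤ (src q).2
  content : ∀ q < hi, ¬ (i ≤ q ∧ q < mid) → q < j → ∃ p < k, dst p = src q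

theorem MergeInv.init (n w : ℕ) (src dst : ℕ → ℝ × ℝ) : MergeInv n w src dst 0 0 0 0 0 where
  i_le := le_rfl
  mid_le := le_rfl
  j_le := le_rfl
  hi_le := Nat.zero_le _
  written := rfl
  block := ⟨0, by simp, by simp, by simp⟩
  sorted := fun p q _ hq => by omega
  left_sorted := fun p q _ _ hq => by omega
  right_sorted := fun p q _ _ hq => by omega
  content := fun q hq => by omega

theorem MergeInv.open_block {n w : ℕ} {src dst : ℕ → ℝ × ℝ} {k i mid j hi : ℕ}
    (h : MergeInv n w src dst k i mid j hi) (hs : SortedRuns w n src) (hkn : k < n) (hk : k = hi) :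
    MergeInv n w src dst k hi (min (hi + w) n) (min (hi + w) n)
      (min (min (hi + w) n + w) n) := by
  obtain ⟨h1, h2, h3, h4, h5, ⟨c, hc1, hc2, -⟩, h7, h8, h9, h10⟩ := h
  -- Because `hi = k < n`, the minimum is not truncated and the next block starts at a multiple of
  -- `2 * w`.
  have hkc : hi = c * (2 * w) := by omega
  have hc' : hi = (2 * c) * w := by rw [hkc]; ring
  have hc'' : hi + w = (2 * c + 1) * w := by rw [hc']; ring
  refine ⟨by omega, le_rfl, by omega, by omega, by omega, ⟨c + 1, ?_, ?_, ?_⟩, h7, ?_, ?_, ?_⟩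
  · rw [add_mul, ← hkc]
    omega
  · rw [add_mul, ← hkc]
    omega
  · intro p hp hcp
    rw [add_mul, ← hkc] at hcp
    omega
  · exact hs.of_le (2 * c) hc' (by omega) (by omega)
  · rcases le_total (hi + w) n with hle | hle
    · rw [min_eq_left hle]
      exact hs.of_le (2 * c + 1) hc'' (by omega) (by omega)
    · intro p q hp hpq hq
      omega
  · intro q hq hq1 hq2
    exact h10 q (by omega) (by omega) (by omega)

/-- Both unread runs are sorted, so the smaller of their heads bounds everything unread from below.
By the clause `block` it is also above everything already written to the current block. -/
theorem MergeInv.take_left {n w : ℕ} {src dst dst' : ℕ → ℝ × ℝ} {k i mid j hi : ℕ}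
    (h : MergeInv n w src dst k i mid j hi) (hk : k < hi) (hi' : i < mid)
    (hle : j < hi → (src i).2 ≤ (src j).2) (hdst : ∀ p, p ≠ k → dst' p = dst p)
    (hdk : dst' k = src i) : MergeInv n w src dst' (k + 1) (i + 1) mid j hi := by
  obtain ⟨h1, h2, h3, h4, h5, ⟨c, hc1, hc2, hc3⟩, h7, h8, h9, h10⟩ := h
  refine ⟨by omega, h2, h3, h4, by omega, ⟨c, hc1, by omega, ?_⟩, ?_, ?_, h9, ?_⟩
  · intro p hp hcp q hq
    rcases eq_or_ne p k with rfl | hpk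
    · rw [hdk]
      rcases hq with ⟨hq1, hq2⟩ | ⟨hq1, hq2⟩
      · exact h8 i q le_rfl (by omega) hq2
      · rcases hq1.eq_or_lt with rfl | hq1
        · exact hle hq2
        · exact (hle (by omega)).trans (h9 j q le_rfl hq1 hq2)
    · rw [hdst p hpk]
      exact hc3 p (by omega) hcp q (by omega)
  · intro p q hpq hq he
    rw [hdst p (by omega)]
    rcases eq_or_ne q k with rfl | hqk
    · rw [hdk]
      refine hc3 p hpq ?_ i (Or.inl ⟨le_rfl, hi'⟩)
      -- The block ends at multiple number `c`, so it starts at the preceding multiple; as no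
      -- multiple separates `p` from `q`, also `p` is in the block.
      cases c with
      | zero => omega
      | succ c =>
        have := he c (by rw [add_mul] at hc2; omega)
        rw [add_mul]
        omega
    · rw [hdst q hqk]
      exact h7 p q hpq (by omega) he
  · intro p q hp
    exact h8 p q (by omega)
  · intro q hq hq1 hq2
    rcases eq_or_ne q i with rfl | hqi
    · exact ⟨k, by omega, hdk⟩
    · obtain ⟨p, hp, hpq⟩ := h10 q hq (by omega) hq2
      exact ⟨p, by omega, by rw [hdst p (by omega), hpq]⟩

theorem MergeInv.take_right {n w : ℕ} {src dst dst' : ℕ → ℝ × ℝ} {k i mid j hi : ℕ}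
    (h : MergeInv n w src dst k i mid j hi) (hk : k < hi) (hj : j < hi)
    (hle : i < mid → (src j).2 ≤ (src i).2) (hdst : ∀ p, p ≠ k → dst' p = dst p)
    (hdk : dst' k = src j) : MergeInv n w src dst' (k + 1) i mid (j + 1) hi := by
  obtain ⟨h1, h2, h3, h4, h5, ⟨c, hc1, hc2, hc3⟩, h7, h8, h9, h10⟩ := h
  refine ⟨h1, by omega, by omega, h4, by omega, ⟨c, hc1, by omega, ?_⟩, ?_, h8, ?_, ?_⟩
  · intro p hp hcp q hq
    rcases eq_or_ne p k with rfl | hpk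
    · rw [hdk]
      rcases hq with ⟨hq1, hq2⟩ | ⟨hq1, hq2⟩
      · rcases hq1.eq_or_lt with rfl | hq1
        · exact hle hq2
        · exact (hle (by omega)).trans (h8 i q le_rfl hq1 hq2)
      · exact h9 j q le_rfl (by omega) hq2
    · rw [hdst p hpk]
      exact hc3 p (by omega) hcp q (by omega)
  · intro p q hpq hq he
    rw [hdst p (by omega)]
    rcases eq_or_ne q k with rfl | hqk
    · rw [hdk]
      refine hc3 p hpq ?_ j (Or.inr ⟨le_rfl, hj⟩)
      cases c with
      | zero => omega
      | succ c =>
        have := he c (by rw [add_mul] at hc2; omega)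
        rw [add_mul]
        omega
    · rw [hdst q hqk]
      exact h7 p q hpq (by omega) he
  · intro p q hp
    exact h9 p q (by omega)
  · intro q hq hq1 hq2
    rcases eq_or_ne q j with rfl | hqi
    · exact ⟨k, by omega, hdk⟩
    · obtain ⟨p, hp, hpq⟩ := h10 q hq hq1 (by omega)
      exact ⟨p, by omega, by rw [hdst p (by omega), hpq]⟩

/-- The points whose coordinates are in the real arrays `a` and `a + 1`. -/
def pointArray (r : ℕ → ℕ → ℝ) (a : ℕ) : ℕ → ℝ × ℝ := fun p => (r a p, r (a + 1) p)

/-- With truncated subtraction, `x - (x - n)` computes `min x n`. -/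
def openBlock : Cmd :=
  .seq (.nset 12 (.reg 15))
    (.seq (.nset 13 (.sub (.add (.reg 15) (.reg 10)) (.sub (.add (.reg 15) (.reg 10)) (.reg 0))))
      (.seq (.nset 14 (.reg 13))
        (.nset 15 (.sub (.add (.reg 13) (.reg 10)) (.sub (.add (.reg 13) (.reg 10)) (.reg 0))))))

/-- Copies the entry of `s` with the index in register `i` to the end of `d`. -/
def takeEntry (s d i : ℕ) : Cmd :=
  .seq (.rput d (.reg 11) (.get s (.reg i)))
    (.seq (.rput (d + 1) (.reg 11) (.get (s + 1) (.reg i)))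
      (.seq (.nset i (.add (.reg i) (.const 1))) (.nset 11 (.add (.reg 11) (.const 1)))))

def takeTest (s : ℕ) : BExpr :=
  .and (.nlt (.reg 12) (.reg 13)) (.not (.and (.nlt (.reg 14) (.reg 15))
    (.rlt (.get (s + 1) (.reg 14)) (.get (s + 1) (.reg 12)))))

/-- Each iteration writes exactly one entry, even when it opens a block, so a pass takes `n`
iterations. -/
def passBody (s d : ℕ) : Cmd :=
  .seq (.ite (.neq (.reg 11) (.reg 15)) openBlock .skip)
    (.ite (takeTest s) (takeEntry s d 12) (takeEntry s d 14))

/-- Merges adjacent blocks of the point array `s`, of the length in register `10`, into the point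
array `d`. -/
def mergePass (s d : ℕ) : Cmd :=
  .seq (.nset 11 (.const 0)) (.seq (.nset 12 (.const 0)) (.seq (.nset 13 (.const 0))
    (.seq (.nset 14 (.const 0)) (.seq (.nset 15 (.const 0))
      (.loop (.nlt (.reg 11) (.reg 0)) (passBody s d))))))

/-- The state of a merge pass from `s` to `d` that was started in the state `σ`. -/
def PassInv (σ : State) (s d : ℕ) (τ : State) : Prop :=
  MergeInv (σ.nreg 0) (σ.nreg 10) (pointArray σ.rarr s) (pointArray τ.rarr d)
    (τ.nreg 11) (τ.nreg 12) (τ.nreg 13) (τ.nreg 14) (τ.nreg 15) ∧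
  pointArray τ.rarr s = pointArray σ.rarr s ∧ (∀ i ≤ 10, τ.nreg i = σ.nreg i)

theorem PassInv.openBlock {σ τ : State} {s d : ℕ} (h : PassInv σ s d τ)
    (hs : SortedRuns (σ.nreg 10) (σ.nreg 0) (pointArray σ.rarr s)) (hk : τ.nreg 11 < σ.nreg 0)
    (hw : 0 < σ.nreg 10) : ∃ τ', Cmd.run (.ite (.neq (.reg 11) (.reg 15)) openBlock .skip) τ = τ' ∧
      PassInv σ s d τ' ∧ τ'.nreg 11 = τ.nreg 11 ∧ τ'.nreg 11 < τ'.nreg 15 := by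
  obtain ⟨h1, h2, h3⟩ := h
  refine ⟨_, rfl, ?_⟩
  by_cases hc : τ.nreg 11 = τ.nreg 15
  · have h4 := h1.open_block hs hk hc
    have hmin : ∀ x y : ℕ, x - (x - y) = min x y := fun x y => by omega
    have h10 := h3 10 le_rfl
    have h0 := h3 0 (by norm_num)
    rw [Cmd.run, if_pos (show (BExpr.neq (.reg 11) (.reg 15)).Holds τ from hc)]
    have e15 : (RealRAM.openBlock.run τ).nreg 15 =
        min (min (τ.nreg 15 + σ.nreg 10) (σ.nreg 0) + σ.nreg 10) (σ.nreg 0) := by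
      simp [RealRAM.openBlock, Cmd.run, NExpr.eval, h0, h10, hmin]
    have e11 : (RealRAM.openBlock.run τ).nreg 11 = τ.nreg 11 := by
      simp [RealRAM.openBlock, Cmd.run]
    refine ⟨⟨?_, h2, fun i hi => ?_⟩, e11, ?_⟩
    · rw [e15, e11]
      convert h4 using 1 <;> simp [RealRAM.openBlock, Cmd.run, NExpr.eval, h0, h10, hmin]
    · simp only [RealRAM.openBlock, Cmd.run, State.setN_nreg, show i ≠ 12 by omega,
        show i ≠ 13 by omega, show i ≠ 14 by omega, show i ≠ 15 by omega, if_false]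
      exact h3 i hi
    · rw [e15, e11]
      omega
  · have : τ.nreg 11 < τ.nreg 15 := by
      have := h1.written
      have := h1.i_le
      have := h1.j_le
      omega
    rw [Cmd.run, if_neg (show ¬ (BExpr.neq (.reg 11) (.reg 15)).Holds τ from hc)]
    exact ⟨⟨h1, h2, h3⟩, rfl, this⟩

/-- The condition on `s` and `d` makes the array pairs `s`, `s + 1` and `d`, `d + 1` disjoint, so
writing does not disturb the source. -/
theorem PassInv.take {σ τ : State} {s d : ℕ} (hsd : s + 1 < d ∨ d + 1 < s) (h : PassInv σ s d τ)
    (hk : τ.nreg 11 < τ.nreg 15) :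
    ∃ τ', Cmd.run (.ite (takeTest s) (takeEntry s d 12) (takeEntry s d 14)) τ = τ' ∧
      PassInv σ s d τ' ∧ τ'.nreg 11 = τ.nreg 11 + 1 := by
  obtain ⟨h1, h2, h3⟩ := h
  have hsnd : ∀ i, (pointArray σ.rarr s i).2 = τ.rarr (s + 1) i := fun i => by rw [← h2]; rfl
  have hsrc : ∀ i, pointArray σ.rarr s i = (τ.rarr s i, τ.rarr (s + 1) i) := fun i => by
    rw [← h2]; rfl
  have htest : (takeTest s).Holds τ ↔ τ.nreg 12 < τ.nreg 13 ∧ ¬ (τ.nreg 14 < τ.nreg 15 ∧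
      (pointArray σ.rarr s (τ.nreg 14)).2 < (pointArray σ.rarr s (τ.nreg 12)).2) := by
    rw [hsnd, hsnd]
    rfl
  have e1 : s ≠ d := by omega
  have e2 : s + 1 ≠ d := by omega
  have e3 : s ≠ d + 1 := by omega
  have frame : ∀ i, i = 12 ∨ i = 14 → pointArray (Cmd.run (takeEntry s d i) τ).rarr s =
      pointArray σ.rarr s ∧ (∀ i' ≤ 10, (Cmd.run (takeEntry s d i) τ).nreg i' = σ.nreg i') := by
    intro i hi
    constructor
    · rw [← h2]
      funext p
      simp [takeEntry, Cmd.run, pointArray, e1, e2, e3]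
    · intro i' hi'
      simp only [takeEntry, Cmd.run, State.setN_nreg, State.putR_nreg,
        show i' ≠ 11 by omega, show i' ≠ i by omega, if_false]
      exact h3 i' hi'
  refine ⟨_, rfl, ?_⟩
  by_cases hc : (takeTest s).Holds τ
  · have hc' := htest.1 hc
    rw [Cmd.run, if_pos hc]
    refine ⟨⟨?_, frame 12 (Or.inl rfl)⟩, ?_⟩
    · have := h1.take_left (dst' := pointArray (Cmd.run (takeEntry s d 12) τ).rarr d) hk hc'.1
        (fun hj => not_lt.1 fun h => hc'.2 ⟨hj, h⟩) (fun p hp => ?_) ?_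
      · simpa [takeEntry, Cmd.run, NExpr.eval] using this
      · simp [takeEntry, Cmd.run, pointArray, NExpr.eval, hp]
      · rw [hsrc]
        simp [takeEntry, Cmd.run, pointArray, NExpr.eval, RExpr.eval, e2]
    · simp [takeEntry, Cmd.run, NExpr.eval]
  · have hc' : τ.nreg 12 < τ.nreg 13 → τ.nreg 14 < τ.nreg 15 ∧
        (pointArray σ.rarr s (τ.nreg 14)).2 < (pointArray σ.rarr s (τ.nreg 12)).2 := by
      rw [htest] at hc
      tauto
    have hj : τ.nreg 14 < τ.nreg 15 := by
      have := h1.written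
      have := h1.i_le
      by_cases hi : τ.nreg 12 < τ.nreg 13
      · exact (hc' hi).1
      · omega
    rw [Cmd.run, if_neg hc]
    refine ⟨⟨?_, frame 14 (Or.inr rfl)⟩, ?_⟩
    · have := h1.take_right (dst' := pointArray (Cmd.run (takeEntry s d 14) τ).rarr d) hk hj
        (fun hi => (hc' hi).2.le) (fun p hp => ?_) ?_
      · simpa [takeEntry, Cmd.run, NExpr.eval] using this
      · simp [takeEntry, Cmd.run, pointArray, NExpr.eval, hp]
      · rw [hsrc]
        simp [takeEntry, Cmd.run, pointArray, NExpr.eval, RExpr.eval, e2]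
    · simp [takeEntry, Cmd.run, NExpr.eval]

theorem runs_mergePass {s d : ℕ} (hsd : s + 1 < d ∨ d + 1 < s) :
    ∃ K, ∀ σ : State, 0 < σ.nreg 10 →
      SortedRuns (σ.nreg 10) (σ.nreg 0) (pointArray σ.rarr s) →
      Runs (mergePass s d) σ (K * (σ.nreg 0 + 1)) (fun τ =>
        SortedRuns (2 * σ.nreg 10) (σ.nreg 0) (pointArray τ.rarr d) ∧
        (∀ q < σ.nreg 0, ∃ p < σ.nreg 0, pointArray τ.rarr d p = pointArray σ.rarr s q) ∧
        ∀ i ≤ 10, τ.nreg i = σ.nreg i) := by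
  set L := (BExpr.nlt (.reg 11) (.reg 0)).cost + (passBody s d).bound + 1 with hL
  refine ⟨L + 14, fun σ hw hs => ?_⟩
  set n := σ.nreg 0 with hn
  let I : ℕ → State → Prop := fun m τ => PassInv σ s d τ ∧ τ.nreg 11 ≤ n ∧ n - τ.nreg 11 = m
  have hloop : ∀ τ, I n τ → Runs (.loop (.nlt (.reg 11) (.reg 0)) (passBody s d)) τ
      (n * L + 4) _ := fun τ hτ => Runs.loop I (c := passBody s d) ?_ hτ
  · unfold mergePass
    refine (Runs.seq_loopFree (by trivial) (Runs.seq_loopFree (by trivial)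
      (Runs.seq_loopFree (by trivial) (Runs.seq_loopFree (by trivial)
      (Runs.seq_loopFree (by trivial) (hloop _ ?_)))))).mono ?_ ?_
    · refine ⟨⟨?_, rfl, fun i hi => ?_⟩, ?_⟩
      · simpa [Cmd.run, NExpr.eval] using MergeInv.init n (σ.nreg 10) _ _
      · simp [Cmd.run, show i ≠ 11 by omega, show i ≠ 12 by omega, show i ≠ 13 by omega,
          show i ≠ 14 by omega, show i ≠ 15 by omega]
      · simp [Cmd.run, NExpr.eval]
    · simp only [Cmd.bound, NExpr.cost]
      ring_nf
      omega
    · rintro τ ⟨⟨m, ⟨h1, h2, h3⟩, h4, -⟩, h5⟩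
      have hk : τ.nreg 11 = n := by
        simp only [BExpr.Holds, NExpr.eval, h3 0 (by norm_num)] at h5
        omega
      refine ⟨hk ▸ h1.sorted, fun q hq => ?_, h3⟩
      have g1 := h1.written
      have g2 := h1.i_le
      have g3 := h1.j_le
      have g4 := h1.hi_le
      obtain ⟨p, hp, hpq⟩ := h1.content q (by omega) (by omega) (by omega)
      exact ⟨p, by omega, hpq⟩
  · rintro m τ ⟨h1, h2, h3⟩ hb
    have hk : τ.nreg 11 < n := by
      simpa only [BExpr.Holds, NExpr.eval, h1.2.2 0 (by norm_num)] using hb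
    refine ⟨m - 1, by omega, Runs.of_loopFree (c := passBody s d)
      (by simp [passBody, Cmd.LoopFree, RealRAM.openBlock, takeEntry]) ?_⟩
    obtain ⟨τ₁, e1, h4, h5, h6⟩ := h1.openBlock hs hk hw
    obtain ⟨τ₂, e2, h7, h8⟩ := h4.take hsd h6
    rw [passBody, Cmd.run, e1, e2]
    exact ⟨h7, by omega, by omega⟩

/-- Array names are fixed in a program, so passes come in pairs: to the auxiliary arrays `2` and
`3`, and back. -/
def sortBody : Cmd :=
  .seq (mergePass 0 2) (.seq (.nset 10 (.add (.reg 10) (.reg 10)))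
    (.seq (mergePass 2 0) (.nset 10 (.add (.reg 10) (.reg 10)))))

/-- Sorts the points in the real arrays `0` and `1` by height. -/
def sortPoints : Cmd :=
  .seq (.nset 10 (.const 1)) (.loop (.nlt (.reg 10) (.reg 0)) sortBody)

theorem runs_sortBody : ∃ K, ∀ σ : State, 0 < σ.nreg 10 →
      SortedRuns (σ.nreg 10) (σ.nreg 0) (pointArray σ.rarr 0) →
      Runs sortBody σ (K * (σ.nreg 0 + 1)) (fun τ => τ.nreg 10 = 4 * σ.nreg 10 ∧
        SortedRuns (τ.nreg 10) (σ.nreg 0) (pointArray τ.rarr 0) ∧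
        (∀ q < σ.nreg 0, ∃ p < σ.nreg 0, pointArray τ.rarr 0 p = pointArray σ.rarr 0 q) ∧
        ∀ i < 10, τ.nreg i = σ.nreg i) := by
  obtain ⟨K, hK⟩ := runs_mergePass (s := 0) (d := 2) (by norm_num)
  obtain ⟨K', hK'⟩ := runs_mergePass (s := 2) (d := 0) (by norm_num)
  refine ⟨K + K' + 8, fun σ hw hs => ?_⟩
  refine Runs.mono (Runs.seq (hK σ hw hs) (l := 4 + (K' * (σ.nreg 0 + 1) + 4)) ?_) ?_
    fun _ => id
  · rintro τ ⟨h1, h2, h3⟩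
    set τ' := Cmd.run (.nset 10 (.add (.reg 10) (.reg 10))) τ with hτ'
    have e1 : τ'.nreg 10 = 2 * σ.nreg 10 := by
      simp only [hτ', Cmd.run, NExpr.eval, State.setN_nreg, h3 10 le_rfl, if_true]
      omega
    have e2 : ∀ i < 10, τ'.nreg i = σ.nreg i := fun i hi => by
      simp only [hτ', Cmd.run, State.setN_nreg, show i ≠ 10 by omega, if_false]
      exact h3 i hi.le
    have e0 := e2 0 (by norm_num)
    have er : τ'.rarr = τ.rarr := rfl
    refine Runs.seq_loopFree (by trivial) ?_
    have h4 := hK' τ' (by omega) (by rw [e1, e0, er]; exact h1)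
    rw [e0] at h4
    refine h4.seq (l := 4) ?_
    rintro υ ⟨h5, h6, h7⟩
    refine Runs.of_loopFree (c := .nset 10 (.add (.reg 10) (.reg 10))) trivial ?_
    refine ⟨?_, ?_, fun q hq => ?_, fun i hi => ?_⟩
    · simp only [Cmd.run, NExpr.eval, State.setN_nreg, h7 10 le_rfl, if_true, e1]
      omega
    · simp only [Cmd.run, NExpr.eval, State.setN_nreg, h7 10 le_rfl, if_true, State.setN_rarr,
        ← two_mul]
      exact h5
    · obtain ⟨p, hp, hpq⟩ := h2 q hq
      obtain ⟨p', hp', hpq'⟩ := h6 p hp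
      exact ⟨p', hp', by rw [← hpq, ← er, ← hpq']; rfl⟩
    · simp only [Cmd.run, State.setN_nreg, show i ≠ 10 by omega, if_false]
      rw [h7 i hi.le, e2 i hi]
  · ring_nf
    omega

theorem runs_sortPoints : ∃ K, ∀ σ : State,
      Runs sortPoints σ (K * ((Nat.clog 2 (σ.nreg 0) + 1) * (σ.nreg 0 + 1))) (fun τ =>
        (∀ p q, p < q → q < σ.nreg 0 → (pointArray τ.rarr 0 p).2 ≤ (pointArray τ.rarr 0 q).2) ∧
        (∀ q < σ.nreg 0, ∃ p < σ.nreg 0, pointArray τ.rarr 0 p = pointArray σ.rarr 0 q) ∧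
        ∀ i < 10, τ.nreg i = σ.nreg i) := by
  obtain ⟨K, hK⟩ := runs_sortBody
  refine ⟨K + 10, fun σ => ?_⟩
  set n := σ.nreg 0 with hn
  -- `m` doublings suffice to bring the block length from its current value to `n`. An iteration
  -- quadruples the length, more than is needed to lower `m` by one.
  let I : ℕ → State → Prop := fun m τ => 0 < τ.nreg 10 ∧ n ≤ τ.nreg 10 * 2 ^ m ∧
    SortedRuns (τ.nreg 10) n (pointArray τ.rarr 0) ∧
    (∀ q < n, ∃ p < n, pointArray τ.rarr 0 p = pointArray σ.rarr 0 q) ∧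
    ∀ i < 10, τ.nreg i = σ.nreg i
  have hloop : ∀ τ, I (Nat.clog 2 n) τ → Runs (.loop (.nlt (.reg 10) (.reg 0)) sortBody) τ
      (Nat.clog 2 n * (3 + K * (n + 1) + 1) + 4) _ :=
    fun τ hτ => Runs.loop I (c := sortBody) (k := K * (n + 1)) ?_ hτ
  · unfold sortPoints
    refine (Runs.seq_loopFree (by trivial) (hloop _ ?_)).mono ?_ ?_
    · have h10 : (Cmd.run (.nset 10 (.const 1)) σ).nreg 10 = 1 := by simp [Cmd.run, NExpr.eval]
      refine ⟨by omega, ?_, ?_, fun q hq => ⟨q, hq, rfl⟩, fun i hi => ?_⟩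
      · rw [h10, one_mul]
        exact Nat.le_pow_clog (by norm_num) n
      · rw [h10]
        -- Blocks of length one are sorted vacuously: `q` itself is a multiple of `1` that separates
        -- `p` from `q`.
        intro p q hpq _ he
        have := he q (by omega)
        omega
      · simp [Cmd.run, show i ≠ 10 by omega]
    · simp only [Cmd.bound, NExpr.cost]
      generalize Nat.clog 2 n = c
      nlinarith [Nat.zero_le (c * n), Nat.zero_le (K * n), Nat.zero_le K, Nat.zero_le (K * n * c)]
    · rintro τ ⟨⟨m, h1, h2, h3, h4, h5⟩, h6⟩
      -- Once the block length is at least `n`, no positive multiple of it is a valid index and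
      -- everything forms one block.
      refine ⟨fun p q hpq hq => h3 p q hpq hq fun e he => ?_, h4, h5⟩
      simp only [BExpr.Holds, NExpr.eval, h5 0 (by norm_num), not_lt] at h6
      rcases Nat.eq_zero_or_pos e with rfl | hpos
      · simp
      · have := Nat.le_mul_of_pos_left (τ.nreg 10) hpos
        omega
  · rintro m τ ⟨h1, h2, h3, h4, h5⟩ hb
    have h0 : τ.nreg 0 = n := h5 0 (by norm_num)
    have hlt : τ.nreg 10 < n := by
      simpa only [BExpr.Holds, NExpr.eval, h0] using hb
    cases m with
    | zero => omega
    | succ m =>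
      have hrun := hK τ h1 (by rwa [h0])
      rw [h0] at hrun
      refine ⟨m, by omega, hrun.mono le_rfl ?_⟩
      rintro υ ⟨g1, g2, g3, g4⟩
      refine ⟨by omega, ?_, g2, fun q hq => ?_, fun i hi => by rw [g4 i hi, h5 i hi]⟩
      · rw [g1]
        rw [pow_succ] at h2
        nlinarith [Nat.zero_le (τ.nreg 10 * 2 ^ m)]
      · obtain ⟨p, hp, hpq⟩ := h4 q hq
        obtain ⟨p', hp', hpq'⟩ := g3 p hp
        exact ⟨p', hp', hpq'.trans hpq⟩

end RealRAM

/-! ### The edges of two `st`-paths -/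

theorem pair_infix_iff {α : Type*} {P : List α} {u v : α} :
    [u, v] <:+: P ↔ ∃ (i : ℕ) (h : i + 1 < P.length), P[i] = u ∧ P[i + 1] = v := by
  constructor
  · rintro ⟨l₁, l₂, rfl⟩
    exact ⟨l₁.length, by simp, by simp⟩
  · rintro ⟨i, h, rfl, rfl⟩
    refine ⟨P.take i, P.drop (i + 2), ?_⟩
    conv_rhs => rw [← List.take_append_drop i P, List.drop_eq_getElem_cons (by omega : i < P.length),
      List.drop_eq_getElem_cons h]
    simp

section TwoPaths

variable {V : Type*} {G : Digraph V} {s t : V} {PL PR : List V}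

theorem IsSTPath.getElem_zero {P : List V} (h : IsSTPath G s t P) (h0 : 0 < P.length) :
    P[0] = s := by
  have := h.head
  rwa [List.head?_eq_getElem?, List.getElem?_eq_getElem h0, Option.some.injEq] at this

theorem IsSTPath.getElem_last {P : List V} (h : IsSTPath G s t P) (h0 : P.length - 1 < P.length) :
    P[P.length - 1] = t := by
  have := h.last
  rwa [List.getLast?_eq_getElem?, List.getElem?_eq_getElem h0, Option.some.injEq] at this

theorem IsSTPath.two_le_length {P : List V} (h : IsSTPath G s t P) (hst : s ≠ t) :
    2 ≤ P.length := by
  obtain ⟨c, hc⟩ := h.tail_ne_nil hst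
  have := List.length_pos_of_mem hc
  rw [List.length_tail] at this
  omega

theorem IsSTPath.succ_unique {P : List V} (h : IsSTPath G s t P) {u v w : V}
    (h1 : [u, v] <:+: P) (h2 : [u, w] <:+: P) : v = w := by
  obtain ⟨i, hi, rfl, rfl⟩ := pair_infix_iff.1 h1
  obtain ⟨j, hj, hij, rfl⟩ := pair_infix_iff.1 h2
  obtain rfl := h.nodup.getElem_inj_iff.1 hij
  rfl

theorem IsSTPath.not_infix_target {P : List V} (h : IsSTPath G s t P) {v : V} :
    ¬ [t, v] <:+: P := by
  intro h1
  obtain ⟨i, hi, hit, -⟩ := pair_infix_iff.1 h1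
  have := h.nodup.getElem_inj_iff.1 (hit.trans (h.getElem_last (by omega)).symm)
  omega

theorem ConsistsOfTwoSTPaths.not_adj_target (h : ConsistsOfTwoSTPaths G s t PL PR) (v : V) :
    ¬ G.Adj t v := fun hv =>
  (h.edges t v hv).elim h.left.not_infix_target h.right.not_infix_target

/-- Successors within a path are unique, so two different out-neighbours place `u` on both paths;
and `t` has no out-neighbour. -/
theorem ConsistsOfTwoSTPaths.eq_source (h : ConsistsOfTwoSTPaths G s t PL PR) {u v w : V}
    (hv : G.Adj u v) (hw : G.Adj u w) (hne : v ≠ w) : u = s := by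
  have key : u ∈ PL → u ∈ PR → u = s := fun h1 h2 =>
    (h.internally_disjoint u h1 h2).resolve_right fun e => h.not_adj_target v (e ▸ hv)
  rcases h.edges u v hv with h1 | h1 <;> rcases h.edges u w hw with h2 | h2
  · exact absurd (h.left.succ_unique h1 h2) hne
  · exact key (h1.subset (by simp)) (h2.subset (by simp))
  · exact key (h2.subset (by simp)) (h1.subset (by simp))
  · exact absurd (h.right.succ_unique h1 h2) hne

theorem ConsistsOfTwoSTPaths.exists_two_adj [Fintype V] (h : ConsistsOfTwoSTPaths G s t PL PR)
    (hn : 3 ≤ Fintype.card V) : ∃ v w, v ≠ w ∧ G.Adj s v ∧ G.Adj s w := by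
  have hst := h.source_ne_target hn
  have hlen := h.length_add_length hst
  have hL := h.left.two_le_length hst
  have hR := h.right.two_le_length hst
  refine ⟨PL[1], PR[1], fun e => ?_, ?_, ?_⟩
  · have hmem := h.internally_disjoint PL[1] (List.getElem_mem _) (by rw [e]; exact List.getElem_mem _)
    rcases hmem with e1 | e1
    · have := h.left.nodup.getElem_inj_iff.1 (e1.trans (h.left.getElem_zero (by omega)).symm)
      omega
    -- If both second vertices were `t`, there would be only two vertices.
    · have h1 := h.left.nodup.getElem_inj_iff.1 (e1.trans (h.left.getElem_last (by omega)).symm)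
      have h2 := h.right.nodup.getElem_inj_iff.1
        ((e.symm.trans e1).trans (h.right.getElem_last (by omega)).symm)
      omega
  · exact h.left.adj (pair_infix_iff.2 ⟨0, by omega, h.left.getElem_zero (by omega), rfl⟩)
  · exact h.right.adj (pair_infix_iff.2 ⟨0, by omega, h.right.getElem_zero (by omega), rfl⟩)

/-- This makes time linear in the number of edges linear in `n`. -/
theorem ConsistsOfTwoSTPaths.length_edges_le (h : ConsistsOfTwoSTPaths G s t PL PR)
    {edges : List (V × V)} (hnd : edges.Nodup) (hadj : ∀ u v, (u, v) ∈ edges → G.Adj u v) :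
    edges.length ≤ PL.length + PR.length := by
  have hzip : ∀ {P : List V} {u v : V}, [u, v] <:+: P → (u, v) ∈ P.zip P.tail := by
    intro P u v huv
    obtain ⟨i, hi, rfl, rfl⟩ := pair_infix_iff.1 huv
    refine List.mem_iff_getElem.2 ⟨i, by simp; omega, by simp⟩
  have hsub : edges ⊆ PL.zip PL.tail ++ PR.zip PR.tail := by
    rintro ⟨u, v⟩ huv
    exact List.mem_append.2 ((h.edges u v (hadj u v huv)).imp hzip hzip)
  have := (hnd.subperm hsub).length_le
  simp only [List.length_append, List.length_zip, List.length_tail] at this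
  omega

/-- Along a path, the recorded successor of a vertex is the next vertex of the path. -/
theorem ConsistsOfTwoSTPaths.next_eq {n : ℕ} {G : Digraph (Fin n)} {s t : Fin n}
    {PL PR P : List (Fin n)} (h : ConsistsOfTwoSTPaths G s t PL PR) (hP : IsSTPath G s t P)
    {N : ℕ → ℕ} (hN : ∀ u : Fin n, (N u = 0 ∧ ∀ v, ¬ G.Adj u v) ∨ ∃ v, G.Adj u v ∧ N u = v + 1)
    {v₀ : Fin n} (hv₀ : [s, v₀] <:+: P) (hNs : N s = v₀ + 1) {k : ℕ} (hk : k < P.length) :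
    N P[k] = if h : k + 1 < P.length then (P[k + 1] : ℕ) + 1 else 0 := by
  split_ifs with hk1
  · have hinf : [P[k], P[k + 1]] <:+: P := pair_infix_iff.2 ⟨k, hk1, rfl, rfl⟩
    have hadj := hP.adj hinf
    by_cases hks : P[k] = s
    · rw [hks] at hinf ⊢
      rw [hP.succ_unique hinf hv₀, hNs]
    · rcases hN P[k] with ⟨-, h1⟩ | ⟨v, h1, h2⟩
      · exact absurd hadj (h1 _)
      · rw [h2]
        by_cases hv : v = P[k + 1]
        · rw [hv]
        · exact absurd (h.eq_source h1 hadj hv) hks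
  · have hkt : P[k] = t := by
      have := hP.getElem_last (by omega)
      rw [← this]
      congr 1
      omega
    rcases hN P[k] with ⟨h1, -⟩ | ⟨v, h1, -⟩
    · exact h1
    · exact absurd (hkt ▸ h1) (h.not_adj_target v)

end TwoPaths

namespace RealRAM

/-! ### The length of a path -/

/-- Storing `v + 1` lets the initial value `0` mean that no successor has been recorded. -/
def linkBody : Cmd :=
  .seq (.ite (.neq (.get 2 (.get 0 (.reg 2))) (.const 0)) .skip (.nset 3 (.get 0 (.reg 2))))
    (.seq (.nput 2 (.get 0 (.reg 2)) (.add (.get 1 (.reg 2)) (.const 1)))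
      (.nset 2 (.add (.reg 2) (.const 1))))

/-- Writes `v + 1` to cell `u` of array `2`, for the last edge from `u` to a `v`, and a vertex with
two outgoing edges to register `3`. -/
def linkEdges : Cmd := .loop (.nlt (.reg 2) (.reg 1)) linkBody

structure LinkInv (tail head : ℕ → ℕ) (i s : ℕ) (N : ℕ → ℕ) : Prop where
  dup : ∀ j j', j < j' → j' < i → tail j = tail j' → s = tail j
  next : ∀ u, (N u = 0 ∧ ∀ j < i, tail j ≠ u) ∨ ∃ j < i, tail j = u ∧ N u = head j + 1

/-- All repeated tails equal `s₀`, so overwriting the register on a repetition cannot destroy the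
answer. -/
theorem LinkInv.step {tail head : ℕ → ℕ} {i s s' s₀ : ℕ} {N N' : ℕ → ℕ}
    (h : LinkInv tail head i s N) (hdup : ∀ j < i, tail j = tail i → tail i = s₀)
    (hdup' : ∀ j j', j < j' → j' < i → tail j = tail j' → tail j = s₀)
    (hs : s' = if N (tail i) = 0 then s else tail i)
    (hN : ∀ u, N' u = if u = tail i then head i + 1 else N u) :
    LinkInv tail head (i + 1) s' N' where
  dup j j' hj hj' he := by
    have hlink : N (tail i) = 0 ∨ ∃ j < i, tail j = tail i := by
      rcases h.next (tail i) with ⟨h1, -⟩ | ⟨j, hj, h1, -⟩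
      · exact Or.inl h1
      · exact Or.inr ⟨j, hj, h1⟩
    by_cases hji : j' = i
    · subst hji
      have : N (tail j') ≠ 0 := by
        intro h0
        rcases h.next (tail j') with ⟨-, h1⟩ | ⟨j, -, -, h1⟩
        · exact h1 j hj he
        · omega
      rw [hs, if_neg this, he]
    · have h1 := h.dup j j' hj (by omega) he
      rw [hs]
      split_ifs with h0
      · exact h1
      · obtain ⟨l, hl, hl'⟩ := hlink.resolve_left h0
        rw [hdup l hl hl', hdup' j j' hj (by omega) he]
  next u := by
    rw [hN]
    split_ifs with hu
    · exact Or.inr ⟨i, by omega, hu.symm, rfl⟩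
    · rcases h.next u with ⟨h1, h2⟩ | ⟨j, hj, h1⟩
      · refine Or.inl ⟨h1, fun j hj => ?_⟩
        rcases Nat.lt_succ_iff_lt_or_eq.1 hj with hj | rfl
        · exact h2 j hj
        · exact fun e => hu e.symm
      · exact Or.inr ⟨j, by omega, h1⟩

theorem runs_linkEdges : ∃ K, ∀ (σ : State) (s₀ : ℕ), σ.nreg 2 = 0 → (∀ u, σ.narr 2 u = 0) →
    (∀ j j', j < j' → j' < σ.nreg 1 → σ.narr 0 j = σ.narr 0 j' → σ.narr 0 j = s₀) →
    Runs linkEdges σ (K * (σ.nreg 1 + 1)) (fun τ =>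
      LinkInv (σ.narr 0) (σ.narr 1) (σ.nreg 1) (τ.nreg 3) (τ.narr 2) ∧
      τ.rarr = σ.rarr ∧ τ.nreg 0 = σ.nreg 0) := by
  set L := (BExpr.nlt (.reg 2) (.reg 1)).cost + linkBody.bound + 1 with hL
  refine ⟨L + 4, fun σ s₀ h2 hN hdup => ?_⟩
  let I : ℕ → State → Prop := fun m τ =>
    LinkInv (σ.narr 0) (σ.narr 1) (τ.nreg 2) (τ.nreg 3) (τ.narr 2) ∧ τ.rarr = σ.rarr ∧
    τ.narr 0 = σ.narr 0 ∧ τ.narr 1 = σ.narr 1 ∧ τ.nreg 0 = σ.nreg 0 ∧ τ.nreg 1 = σ.nreg 1 ∧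
    τ.nreg 2 + m = σ.nreg 1
  have hI : I (σ.nreg 1) σ := by
    refine ⟨⟨fun j j' _ hj => by omega, fun u => Or.inl ⟨hN u, fun j hj => by omega⟩⟩,
      rfl, rfl, rfl, rfl, rfl, by omega⟩
  refine (Runs.loop I (c := linkBody) (k := linkBody.bound) ?_ hI).mono ?_ ?_
  · rintro m τ ⟨h1, hr, ha0, ha1, h0, h1', hm⟩ hb
    have hlt : τ.nreg 2 < σ.nreg 1 := by
      simpa only [BExpr.Holds, NExpr.eval, h1'] using hb
    refine ⟨m - 1, by omega, Runs.of_loopFree (c := linkBody)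
      (by simp [linkBody, Cmd.LoopFree]) ?_⟩
    -- `ρ` is the state after the conditional; only register `3` depends on the branch.
    obtain ⟨ρ, hρ, n3, ne3, na, nr⟩ : ∃ ρ : State, linkBody.run τ =
        (ρ.putN 2 (ρ.narr 0 (ρ.nreg 2)) (ρ.narr 1 (ρ.nreg 2) + 1)).setN 2 (ρ.nreg 2 + 1) ∧
        (ρ.nreg 3 = if τ.narr 2 (τ.narr 0 (τ.nreg 2)) = 0 then τ.nreg 3
          else τ.narr 0 (τ.nreg 2)) ∧
        (∀ j ≠ 3, ρ.nreg j = τ.nreg j) ∧ ρ.narr = τ.narr ∧ ρ.rarr = τ.rarr := by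
      by_cases hz : τ.narr 2 (τ.narr 0 (τ.nreg 2)) = 0
      · exact ⟨τ, by simp [linkBody, Cmd.run, BExpr.Holds, NExpr.eval, hz], by simp [hz],
          fun _ _ => rfl, rfl, rfl⟩
      · exact ⟨τ.setN 3 (τ.narr 0 (τ.nreg 2)), by
          simp [linkBody, Cmd.run, BExpr.Holds, NExpr.eval, hz], by simp [hz],
          fun j hj => by simp [hj], rfl, rfl⟩
    have e2 := ne3 2 (by norm_num)
    rw [na, e2] at hρ
    rw [hρ]
    refine ⟨?_, ?_, ?_, ?_, ?_, ?_, ?_⟩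
    · rw [ha0] at n3
      have := h1.step (s₀ := s₀) (s' := ρ.nreg 3)
        (N' := fun u => if u = σ.narr 0 (τ.nreg 2) then σ.narr 1 (τ.nreg 2) + 1 else τ.narr 2 u)
        (fun j hj he => he ▸ hdup j _ hj hlt he)
        (fun j j' hj hj' => hdup j j' hj (by omega)) n3 (fun u => rfl)
      convert this using 1
      · simp
      · simp
      · funext u
        simp [ha0, ha1, na]
    · simp [nr, hr]
    · funext u
      simp [na, ha0]
    · funext u
      simp [na, ha1]
    · simp [ne3, h0]
    · simp [ne3, h1']
    · simp
      omega
  · rw [← hL]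
    simp only [BExpr.cost, NExpr.cost]
    ring_nf
    omega
  · rintro τ ⟨⟨m, h1, hr, ha0, ha1, h0, h1', hm⟩, hb⟩
    simp only [BExpr.Holds, NExpr.eval, h1'] at hb
    have : τ.nreg 2 = σ.nreg 1 := by omega
    exact ⟨this ▸ h1, hr, h0⟩

def walkBody : Cmd :=
  .seq (.nset 5 (.get 2 (.sub (.reg 5) (.const 1)))) (.nset 4 (.add (.reg 4) (.const 1)))

/-- Follows the links from the vertex in register `3` and counts the vertices in register `4`. -/
def walkPath : Cmd :=
  .seq (.nset 4 (.const 1)) (.seq (.nset 5 (.get 2 (.reg 3)))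
    (.loop (.nlt (.const 0) (.reg 5)) walkBody))

theorem runs_walkPath : ∃ K, ∀ (σ : State) (l : ℕ) (p : ℕ → ℕ), 0 < l → σ.nreg 3 = p 0 →
    (∀ k < l, σ.narr 2 (p k) = if k + 1 < l then p (k + 1) + 1 else 0) →
    Runs walkPath σ (K * (l + 1)) (fun τ => τ.nreg 4 = l ∧ τ.rarr = σ.rarr ∧
      τ.nreg 0 = σ.nreg 0) := by
  set L := (BExpr.nlt (.const 0) (.reg 5)).cost + walkBody.bound + 1 with hL
  refine ⟨L + 10, fun σ l p hl hs hp => ?_⟩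
  -- Register `5` holds the shifted successor of the last vertex counted, and `0` when that vertex
  -- is the last one of the path.
  let I : ℕ → State → Prop := fun m τ => τ.nreg 4 + m = l ∧ 1 ≤ τ.nreg 4 ∧
    τ.nreg 5 = (if τ.nreg 4 < l then p (τ.nreg 4) + 1 else 0) ∧ τ.rarr = σ.rarr ∧
    τ.narr 2 = σ.narr 2 ∧ τ.nreg 0 = σ.nreg 0
  have hloop : ∀ τ, I (l - 1) τ → Runs (.loop (.nlt (.const 0) (.reg 5)) walkBody) τ
      ((l - 1) * L + 4) _ := fun τ hτ => Runs.loop I (c := walkBody) ?_ hτ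
  · unfold walkPath
    refine (Runs.seq_loopFree (by trivial) (Runs.seq_loopFree (by trivial)
      (hloop _ ?_))).mono ?_ ?_
    · refine ⟨?_, ?_, ?_, rfl, rfl, ?_⟩
      · simp only [Cmd.run, NExpr.eval, State.setN_nreg]
        simp
        omega
      · simp [Cmd.run, NExpr.eval]
      · simp [Cmd.run, NExpr.eval, hs, hp 0 hl]
      · simp [Cmd.run]
    · simp only [Cmd.bound, NExpr.cost]
      have := Nat.mul_le_mul_right L (Nat.sub_le l 1)
      ring_nf at this ⊢
      omega
    · rintro τ ⟨⟨m, h1, h2, h3, h4, -, h5⟩, hb⟩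
      simp only [BExpr.Holds, NExpr.eval, h3] at hb
      refine ⟨?_, h4, h5⟩
      split_ifs at hb <;> omega
  · rintro m τ ⟨h1, h2, h3, h4, h5, h6⟩ hb
    simp only [BExpr.Holds, NExpr.eval] at hb
    have hlt : τ.nreg 4 < l := by
      by_contra hc
      rw [if_neg hc] at h3
      omega
    rw [if_pos hlt] at h3
    refine ⟨m - 1, by omega, Runs.of_loopFree (c := walkBody) ⟨trivial, trivial⟩ ?_⟩
    refine ⟨?_, ?_, ?_, h4, h5, ?_⟩
    · simp [walkBody, Cmd.run, NExpr.eval]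
      omega
    · simp [walkBody, Cmd.run, NExpr.eval]
    · simp [walkBody, Cmd.run, NExpr.eval, h3, h5, hp _ hlt]
    · simp [walkBody, Cmd.run, h6]

end RealRAM

/-- It is enough that the sorted array contains every point: by counting, its `n` entries are then
exactly the points of `S` without repetition, and distinct heights make the order strict. -/
theorem isListing_of_sorted {S : Finset (ℝ × ℝ)} {n : ℕ} {f : ℕ → ℝ × ℝ} (hS : S.card = n)
    (hD : DistinctHeights S) (hsort : ∀ p q, p < q → q < n → (f p).2 ≤ (f q).2)
    (hex : ∀ x ∈ S, ∃ p < n, f p = x) : IsListing S n f := by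
  classical
  have hsub : S ⊆ (Finset.range n).image f := fun x hx => by
    obtain ⟨p, hp, rfl⟩ := hex x hx
    exact Finset.mem_image_of_mem _ (Finset.mem_range.2 hp)
  have hcard : ((Finset.range n).image f).card ≤ n :=
    Finset.card_image_le.trans (by rw [Finset.card_range])
  have heq := Finset.eq_of_subset_of_card_le hsub (hcard.trans hS.ge)
  have hmem : ∀ i < n, f i ∈ S := fun i hi =>
    heq ▸ Finset.mem_image_of_mem _ (Finset.mem_range.2 hi)
  have hinj : Set.InjOn f (Finset.range n) :=
    Finset.card_image_iff.1 (by rw [← heq, hS, Finset.card_range])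
  refine ⟨hmem, hex, fun i j hij hj => lt_of_le_of_ne (hsort i j hij hj) fun e => ?_⟩
  have := hinj (by simp; omega) (by simp; omega)
    (hD _ (hmem i (by omega)) _ (hmem j hj) e)
  omega

namespace RealRAM

/-- The edge out of `s` that is recorded last decides which path is followed, hence the disjunction.
Every other vertex has at most one successor. -/
theorem runs_pathLength : ∃ K, ∀ (n : ℕ) (G : Digraph (Fin n)) (s t : Fin n)
    (PL PR : List (Fin n)) (edges : List (Fin n × Fin n)) (points : List (ℝ × ℝ)),
    ConsistsOfTwoSTPaths G s t PL PR → 3 ≤ n → edges.Nodup →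
    (∀ u v, (u, v) ∈ edges ↔ G.Adj u v) →
    Runs (.seq linkEdges walkPath) (inputState edges points) (K * (n + 1)) (fun τ =>
      (τ.nreg 4 = PL.length ∨ τ.nreg 4 = PR.length) ∧
      τ.rarr = (inputState edges points).rarr ∧ τ.nreg 0 = n) := by
  obtain ⟨K, hK⟩ := runs_linkEdges
  obtain ⟨K', hK'⟩ := runs_walkPath
  refine ⟨3 * K + 3 * K', fun n G s t PL PR edges points h hn hnd hadj => ?_⟩
  have hn' : 3 ≤ Fintype.card (Fin n) := by simpa using hn
  have hst := h.source_ne_target hn'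
  have hlen := h.length_add_length hst
  rw [Fintype.card_fin] at hlen
  have hm := h.length_edges_le hnd fun u v => (hadj u v).1
  set σ := inputState edges points with hσ
  have e0 : σ.nreg 0 = n := rfl
  have e1 : σ.nreg 1 = edges.length := rfl
  have htail : ∀ j (hj : j < edges.length), σ.narr 0 j = (edges[j].1 : ℕ) := fun j hj => by
    simp [hσ, inputState, hj]
  have hhead : ∀ j (hj : j < edges.length), σ.narr 1 j = (edges[j].2 : ℕ) := fun j hj => by
    simp [hσ, inputState, hj]
  have hadj' : ∀ j (hj : j < edges.length), G.Adj edges[j].1 edges[j].2 := fun j hj =>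
    (hadj _ _).1 (List.getElem_mem hj)
  have hdup : ∀ j j', j < j' → j' < edges.length → σ.narr 0 j = σ.narr 0 j' →
      σ.narr 0 j = s := by
    intro j j' hj hj' he
    rw [htail j (by omega), htail j' hj'] at he
    rw [htail j (by omega)]
    have he' := Fin.ext he
    have h1 := hadj' j (by omega)
    have h2 := hadj' j' hj'
    rw [← he'] at h2
    rw [h.eq_source h1 h2 fun e => ?_]
    have := hnd.getElem_inj_iff.1 (Prod.ext he' e : edges[j] = edges[j'])
    omega
  have hrun := hK σ s (by simp [hσ, inputState]) (fun u => by simp [hσ, inputState])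
    (by rw [e1]; exact hdup)
  rw [e1] at hrun
  refine (hrun.seq (l := K' * (n + 1)) ?_).mono ?_ (fun _ => id)
  · rintro τ ⟨⟨h1, h2⟩, h3, h4⟩
    have hs : τ.nreg 3 = s := by
      obtain ⟨v, w, hvw, hv, hw⟩ := h.exists_two_adj hn'
      obtain ⟨j, hj, hje⟩ := List.getElem_of_mem ((hadj _ _).2 hv)
      obtain ⟨j', hj', hje'⟩ := List.getElem_of_mem ((hadj _ _).2 hw)
      have h5 : σ.narr 0 j = s := by rw [htail j hj, hje]
      have h6 : σ.narr 0 j' = s := by rw [htail j' hj', hje']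
      rcases lt_trichotomy j j' with hlt | rfl | hlt
      · rw [h1 j j' hlt hj' (h5.trans h6.symm), h5]
      · rw [hje] at hje'
        exact absurd (congrArg Prod.snd hje') hvw
      · rw [h1 j' j hlt hj (h6.trans h5.symm), h6]
    have hN : ∀ u : Fin n, (τ.narr 2 u = 0 ∧ ∀ v, ¬ G.Adj u v) ∨
        ∃ v, G.Adj u v ∧ τ.narr 2 u = v + 1 := by
      intro u
      rcases h2 u with ⟨h5, h6⟩ | ⟨j, hj, h5, h6⟩
      · refine Or.inl ⟨h5, fun v hv => ?_⟩
        obtain ⟨j, hj, hje⟩ := List.getElem_of_mem ((hadj _ _).2 hv)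
        exact h6 j hj (by rw [htail j hj, hje])
      · rw [htail j hj] at h5
        rw [hhead j hj] at h6
        exact Or.inr ⟨_, Fin.ext h5 ▸ hadj' j hj, h6⟩
    have hP : ∃ P, (P = PL ∨ P = PR) ∧ IsSTPath G s t P ∧ ∃ v₀, [s, v₀] <:+: P ∧
        τ.narr 2 s = v₀ + 1 := by
      rcases hN s with ⟨-, h5⟩ | ⟨v₀, h5, h6⟩
      · obtain ⟨v, w, -, hv, -⟩ := h.exists_two_adj hn'
        exact absurd hv (h5 v)
      · rcases h.edges _ _ h5 with h7 | h7
        · exact ⟨PL, Or.inl rfl, h.left, v₀, h7, h6⟩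
        · exact ⟨PR, Or.inr rfl, h.right, v₀, h7, h6⟩
    obtain ⟨P, hPeq, hP, v₀, hv₀, hNs⟩ := hP
    have hP2 := hP.two_le_length hst
    have hPn : P.length ≤ n := by
      simpa using hP.nodup.length_le_card
    have hwalk := hK' τ P.length (fun k => ((P.getD k s : Fin n) : ℕ)) (by omega) ?_ ?_
    · refine hwalk.mono (Nat.mul_le_mul_left K' (by omega)) ?_
      rintro υ ⟨h5, h6, h7⟩
      refine ⟨?_, h6.trans h3, h7.trans (h4.trans e0)⟩
      rcases hPeq with rfl | rfl
      · exact Or.inl h5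
      · exact Or.inr h5
    · rw [hs]
      have := hP.getElem_zero (by omega)
      simp [List.getD_eq_getElem?_getD, List.getElem?_eq_getElem (show 0 < P.length by omega), this]
    · intro k hk
      have := h.next_eq hP hN hv₀ hNs hk
      simp only [List.getD_eq_getElem?_getD, List.getElem?_eq_getElem hk, Option.getD_some]
      rw [this]
      split_ifs with hk1
      · simp [List.getElem?_eq_getElem hk1]
      · rfl
  -- There are at most `n + 2` edges, so `edges.length + 1` is at most `3 * (n + 1)`.
  · have : K * (edges.length + 1) ≤ K * (3 * (n + 1)) := Nat.mul_le_mul_left K (by omega)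
    nlinarith [Nat.zero_le (K' * n)]

/-! ### The complete decision program. -/

def rightTest : BExpr := .rlt (.const 0) scanOrient

def leftTest : BExpr := .rlt scanOrient (.const 0)

theorem scanOrient_eval (σ : State) : scanOrient.eval σ =
    orient (pointArray σ.rarr 0 (σ.narr 3 (σ.nreg 21 - 2))) (pointArray σ.rarr 0 (σ.nreg 20))
      (pointArray σ.rarr 0 (σ.narr 3 (σ.nreg 21 - 1))) := rfl

/-- Compares the sizes of the right and left envelopes, in registers `6` and `7`, with the lengths
of the paths, of which one is in register `4`. -/
def compareSizes : Cmd :=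
  -- The paths share exactly `s` and `t`, so their lengths add up to `n + 2`.
  .seq (.nset 5 (.sub (.add (.reg 0) (.const 2)) (.reg 4)))
    (.ite (.and (.not (.nlt (.reg 4) (.reg 7))) (.not (.nlt (.reg 5) (.reg 6))))
      (.nset 0 (.const 1))
      (.ite (.and (.not (.nlt (.reg 5) (.reg 7))) (.not (.nlt (.reg 4) (.reg 6))))
        (.nset 0 (.const 1)) (.nset 0 (.const 0))))

open Classical in
theorem compareSizes_run (σ : State) : (compareSizes.run σ).nreg 0 =
    if (σ.nreg 7 ≤ σ.nreg 4 ∧ σ.nreg 6 ≤ σ.nreg 0 + 2 - σ.nreg 4) ∨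
      (σ.nreg 7 ≤ σ.nreg 0 + 2 - σ.nreg 4 ∧ σ.nreg 6 ≤ σ.nreg 4) then 1 else 0 := by
  set τ := Cmd.run (.nset 5 (.sub (.add (.reg 0) (.const 2)) (.reg 4))) σ with hτ
  have h4 : τ.nreg 4 = σ.nreg 4 := by simp [hτ, Cmd.run]
  have h5 : τ.nreg 5 = σ.nreg 0 + 2 - σ.nreg 4 := by simp [hτ, Cmd.run, NExpr.eval]
  have h6 : τ.nreg 6 = σ.nreg 6 := by simp [hτ, Cmd.run]
  have h7 : τ.nreg 7 = σ.nreg 7 := by simp [hτ, Cmd.run]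
  have e1 : (BExpr.and (.not (.nlt (.reg 4) (.reg 7))) (.not (.nlt (.reg 5) (.reg 6)))).Holds τ ↔
      σ.nreg 7 ≤ σ.nreg 4 ∧ σ.nreg 6 ≤ σ.nreg 0 + 2 - σ.nreg 4 := by
    simp [BExpr.Holds, NExpr.eval, h4, h5, h6, h7]
  have e2 : (BExpr.and (.not (.nlt (.reg 5) (.reg 7))) (.not (.nlt (.reg 4) (.reg 6)))).Holds τ ↔
      σ.nreg 7 ≤ σ.nreg 0 + 2 - σ.nreg 4 ∧ σ.nreg 6 ≤ σ.nreg 4 := by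
    simp [BExpr.Holds, NExpr.eval, h4, h5, h6, h7]
  rw [compareSizes, Cmd.run, ← hτ, Cmd.run]
  by_cases c1 : σ.nreg 7 ≤ σ.nreg 4 ∧ σ.nreg 6 ≤ σ.nreg 0 + 2 - σ.nreg 4
  · rw [if_pos (e1.2 c1), if_pos (Or.inl c1)]
    simp [Cmd.run, NExpr.eval]
  · rw [if_neg (e1.not.2 c1), Cmd.run]
    by_cases c2 : σ.nreg 7 ≤ σ.nreg 0 + 2 - σ.nreg 4 ∧ σ.nreg 6 ≤ σ.nreg 4
    · rw [if_pos (e2.2 c2), if_pos (Or.inr c2)]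
      simp [Cmd.run, NExpr.eval]
    · rw [if_neg (e2.not.2 c2), if_neg (by tauto)]
      simp [Cmd.run, NExpr.eval]

/-- The test for the existence of an upward pointset embedding. -/
def embeddingTest : Cmd :=
  .seq (.seq linkEdges walkPath) (.seq sortPoints (.seq (scan rightTest) (.seq (.nset 6 (.reg 21))
    (.seq (scan leftTest) (.seq (.nset 7 (.reg 21)) compareSizes)))))

theorem runs_embeddingTest : ∃ K, ∀ (n : ℕ) (G : Digraph (Fin n)) (s t : Fin n)
    (PL PR : List (Fin n)) (S : Finset (ℝ × ℝ)) (edges : List (Fin n × Fin n))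
    (points : List (ℝ × ℝ)), ConsistsOfTwoSTPaths G s t PL PR → 3 ≤ n → S.card = n →
    DistinctHeights S → GeneralPosition S → edges.Nodup →
    (∀ u v, (u, v) ∈ edges ↔ G.Adj u v) → points.Nodup → (∀ p, p ∈ points ↔ p ∈ S) →
    Runs embeddingTest (inputState edges points) (K * ((Nat.clog 2 n + 1) * (n + 1))) (fun τ =>
      ((∃ φ : Fin n → ℝ × ℝ, IsUPSE G S φ) → τ.nreg 0 = 1) ∧
      ((¬ ∃ φ : Fin n → ℝ × ℝ, IsUPSE G S φ) → τ.nreg 0 = 0)) := by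
  obtain ⟨K₁, hK₁⟩ := runs_pathLength
  obtain ⟨K₂, hK₂⟩ := runs_sortPoints
  obtain ⟨K₃, hK₃⟩ := runs_scan (test := rightTest) (bad := fun r a c b =>
    0 < orient (pointArray r 0 a) (pointArray r 0 c) (pointArray r 0 b)) (fun σ => by
      simp only [rightTest, BExpr.Holds, scanOrient_eval, RExpr.eval, Int.cast_zero])
  obtain ⟨K₄, hK₄⟩ := runs_scan (test := leftTest) (bad := fun r a c b =>
    orient (pointArray r 0 a) (pointArray r 0 c) (pointArray r 0 b) < 0) (fun σ => by
      simp only [leftTest, BExpr.Holds, scanOrient_eval, RExpr.eval, Int.cast_zero])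
  refine ⟨K₁ + K₂ + K₃ + K₄ + 4 + compareSizes.bound,
    fun n G s t PL PR S edges points h hn hS hD hG hnd hadj hndp hpts => ?_⟩
  classical
  have hn' : 3 ≤ Fintype.card (Fin n) := by simpa using hn
  have hlen := h.length_add_length (h.source_ne_target hn')
  rw [Fintype.card_fin] at hlen
  have hplen : points.length = n := by
    rw [← hS, ← List.toFinset_card_of_nodup hndp]
    congr 1
    ext p
    simp [hpts]
  have hne : S.Nonempty := Finset.card_pos.1 (by omega)
  have hiff := h.exists_upse_iff_or hn' (by simpa using hS) hD hG
  rw [ncard_convL hD hG hne, ncard_convR hD hG hne] at hiff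
  refine Runs.mono (Runs.seq (hK₁ n G s t PL PR edges points h hn hnd hadj)
    (l := K₂ * ((Nat.clog 2 n + 1) * (n + 1)) + (K₃ * (n + 1) + (2 + (K₄ * (n + 1) +
      (2 + compareSizes.bound))))) ?_) ?_ fun _ => id
  · rintro σ₁ ⟨hl, hr₁, h₁⟩
    have hsort := hK₂ σ₁
    rw [h₁] at hsort
    refine hsort.seq ?_
    rintro σ₂ ⟨h2, h3, h4⟩
    have hlist : IsListing S n (pointArray σ₂.rarr 0) := by
      refine isListing_of_sorted hS hD h2 fun x hx => ?_
      obtain ⟨q, hq, rfl⟩ := List.getElem_of_mem ((hpts x).2 hx)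
      obtain ⟨p, hp, hpq⟩ := h3 q (by omega)
      refine ⟨p, hp, hpq.trans ?_⟩
      rw [hr₁]
      ext <;> simp [pointArray, inputState, hq]
    have h₂ : σ₂.nreg 0 = n := (h4 0 (by norm_num)).trans h₁
    have hscan := hK₃ σ₂
    rw [h₂] at hscan
    refine hscan.seq ?_
    rintro σ₃ ⟨h5, h6, h7⟩
    have hR := hlist.scan_card hD hG h5
    refine Runs.seq_loopFree (c := .nset 6 (.reg 21)) trivial ?_
    set σ₄ := Cmd.run (.nset 6 (.reg 21)) σ₃ with hσ₄
    have h₄ : σ₄.nreg 0 = n := by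
      rw [← h₂, ← h7 0 (by norm_num) (by norm_num)]
      simp [hσ₄, Cmd.run]
    have hr₄ : σ₄.rarr = σ₂.rarr := h6
    have hscan' := hK₄ σ₄
    rw [h₄, hr₄] at hscan'
    refine hscan'.seq ?_
    rintro σ₅ ⟨h8, h9, h10⟩
    have hL := hlist.scan_card_left hD hG h8
    refine Runs.seq_loopFree (c := .nset 7 (.reg 21)) trivial ?_
    set σ₆ := Cmd.run (.nset 7 (.reg 21)) σ₅ with hσ₆
    have g7 : σ₆.nreg 7 = (S.filter (IsLeftExtreme S)).card := by
      rw [← hL]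
      simp [hσ₆, Cmd.run, NExpr.eval]
    have g6 : σ₆.nreg 6 = (S.filter (IsRightExtreme S)).card := by
      rw [← hR]
      simp [hσ₆, hσ₄, Cmd.run, NExpr.eval, h10]
    have g0 : σ₆.nreg 0 = n := by
      rw [← h₄, ← h10 0 (by norm_num) (by norm_num)]
      simp [hσ₆, Cmd.run]
    have g4 : σ₆.nreg 4 = σ₁.nreg 4 := by
      rw [← h4 4 (by norm_num), ← h7 4 (by norm_num) (by norm_num)]
      simp [hσ₆, hσ₄, Cmd.run, h10]
    refine Runs.of_loopFree (c := compareSizes) (by simp [compareSizes, Cmd.LoopFree]) ?_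
    have key : ((σ₆.nreg 7 ≤ σ₆.nreg 4 ∧ σ₆.nreg 6 ≤ σ₆.nreg 0 + 2 - σ₆.nreg 4) ∨
        (σ₆.nreg 7 ≤ σ₆.nreg 0 + 2 - σ₆.nreg 4 ∧ σ₆.nreg 6 ≤ σ₆.nreg 4)) ↔
        ∃ φ : Fin n → ℝ × ℝ, IsUPSE G S φ := by
      rw [hiff, g7, g6, g0, g4]
      -- Exchanging the paths exchanges the two alternatives, so it does not matter which path was
      -- measured.
      rcases hl with hl | hl
      · rw [hl, show n + 2 - PL.length = PR.length by omega]
      · rw [hl, show n + 2 - PR.length = PL.length by omega, or_comm]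
    rw [compareSizes_run]
    exact ⟨fun hφ => if_pos (key.2 hφ), fun hφ => if_neg (key.not.2 hφ)⟩
  · have e : n + 1 ≤ (Nat.clog 2 n + 1) * (n + 1) := Nat.le_mul_of_pos_left _ (by omega)
    have e1 := Nat.mul_le_mul_left K₁ e
    have e3 := Nat.mul_le_mul_left K₃ e
    have e4 := Nat.mul_le_mul_left K₄ e
    have e5 := Nat.mul_le_mul_left (4 + compareSizes.bound) ((Nat.le_add_left 1 n).trans e)
    nlinarith

end RealRAM

/-- From `2 ^ (clog - 1) ≤ n` and `log 2 ≥ 1/2` follows `clog + 1 ≤ 2 * log n + 2`, which is at most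
`4 * log n` because `n ≥ 3 > e`. With `n + 1 ≤ 2 * n` this gives the factor `8`. -/
theorem clog_mul_le {n : ℕ} (hn : 3 ≤ n) :
    (((Nat.clog 2 n + 1) * (n + 1) : ℕ) : ℝ) ≤ 8 * (n * Real.log n) := by
  have hn0 : (3 : ℝ) ≤ n := by exact_mod_cast hn
  have hlog : 1 ≤ Real.log n := by
    rw [Real.le_log_iff_exp_le (by linarith)]
    linarith [Real.exp_one_lt_d9]
  have h2 : (2 : ℝ) ^ (Nat.clog 2 n - 1) ≤ n := by
    exact_mod_cast (Nat.pow_pred_clog_lt_self (by norm_num) (by omega)).le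
  have h3 := Real.log_le_log (by positivity) h2
  rw [Real.log_pow] at h3
  have hpos : 1 ≤ Nat.clog 2 n := Nat.clog_pos (by norm_num) (by omega)
  rw [Nat.cast_sub hpos, Nat.cast_one] at h3
  have h4 : (0.5 : ℝ) ≤ Real.log 2 := by linarith [Real.log_two_gt_d9]
  have h5 : ((Nat.clog 2 n : ℝ) - 1) * 0.5 ≤ Real.log n := by
    refine le_trans (mul_le_mul_of_nonneg_left h4 ?_) h3
    have : (1 : ℝ) ≤ Nat.clog 2 n := by exact_mod_cast hpos
    linarith
  push_cast
  calc ((Nat.clog 2 n : ℝ) + 1) * (n + 1) ≤ (4 * Real.log n) * (2 * n) := by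
        refine mul_le_mul (by linarith) (by linarith) (by positivity) (by linarith)
    _ = 8 * (n * Real.log n) := by ring

end UPSE

theorem theorem5 :
    -- the characterization
    (∀ (V : Type*) [Fintype V] (G : Digraph V) (s t : V) (PL PR : List V) (S : Finset (ℝ × ℝ)),
      UPSE.ConsistsOfTwoSTPaths G s t PL PR →
      3 ≤ Fintype.card V →
      S.card = Fintype.card V →
      UPSE.DistinctHeights S →
      UPSE.GeneralPosition S →
      ((∃ φ : V → ℝ × ℝ, UPSE.IsUPSE G S φ ∧ UPSE.DrawnLeftOf φ PL PR) ↔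
        (UPSE.convL S).ncard ≤ PL.length ∧ (UPSE.convR S).ncard ≤ PR.length)) ∧
    -- the test in O(n log n) time: one program, which ends with register 0 equal to 1 or 0
    (∃ (prog : UPSE.RealRAM.Cmd) (C : ℝ),
      ∀ (n : ℕ) (G : Digraph (Fin n)) (s t : Fin n) (PL PR : List (Fin n)) (S : Finset (ℝ × ℝ))
        (edges : List (Fin n × Fin n)) (points : List (ℝ × ℝ)),
      UPSE.ConsistsOfTwoSTPaths G s t PL PR →
      3 ≤ n →
      S.card = n →
      UPSE.DistinctHeights S →
      UPSE.GeneralPosition S →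
      edges.Nodup →
      (∀ u v, (u, v) ∈ edges ↔ G.Adj u v) →
      points.Nodup →
      (∀ p, p ∈ points ↔ p ∈ S) →
      ∃ (T : ℕ) (σ : UPSE.RealRAM.State),
        UPSE.RealRAM.Exec prog (UPSE.inputState edges points) T σ ∧
        (T : ℝ) ≤ C * (n * Real.log n) ∧
        ((∃ φ : Fin n → ℝ × ℝ, UPSE.IsUPSE G S φ) → σ.nreg 0 = 1) ∧
        ((¬ ∃ φ : Fin n → ℝ × ℝ, UPSE.IsUPSE G S φ) → σ.nreg 0 = 0)) := by
  refine ⟨fun V _ G s t PL PR S h hn hS hD hG => h.exists_upse_iff hn hS hD hG, ?_⟩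
  obtain ⟨K, hK⟩ := UPSE.RealRAM.runs_embeddingTest
  refine ⟨UPSE.RealRAM.embeddingTest, K * 8,
    fun n G s t PL PR S edges points h hn hS hD hG hnd hadj hndp hpts => ?_⟩
  obtain ⟨T, σ, h1, h2, h3⟩ := hK n G s t PL PR S edges points h hn hS hD hG hnd hadj hndp hpts
  refine ⟨T, σ, h1, ?_, h3⟩
  have h4 : (T : ℝ) ≤ K * (((Nat.clog 2 n + 1) * (n + 1) : ℕ) : ℝ) := by exact_mod_cast h2
  refine h4.trans ?_
  rw [mul_assoc]
  exact mul_le_mul_of_nonneg_left (UPSE.clog_mul_le hn) (Nat.cast_nonneg K)
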